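/- Let $N,d\in\mathbb N$ and $1\le p<\infty$. **Regular measures.** A Borel probability measure $\mu$ on $\mathbb R^m$ is called $W^{1,p}$-regular, written $\mu\in\mathcal P^{1,p}(\mathbb R^m)$, if $\mu$ is absolutely continuous with respect to the Lebesgue measure $\mathcal L^m$ and $\left(\frac{d\mu}{d\mathcal L^m}\right)^{1/p}\in W^{1,p}(\mathbb R^m)$. For $\mu,\nu\in\mathcal P^{1,p}(\mathbb R^m)$ put $$d^{1,p}(\mu,\nu)=\left\|\left(\tfrac{d\mu}{d\mathcal L^m}\right)^{1/p}-\left(\tfrac{d\nu}{d\mathcal L^m}\right)^{1/p}\right\|_{W^{1,p}},\qquad \|f\|_{W^{1,p}}=\Big(\|f\|_{L^p}^p+\sum_{i=1}^m\|\partial_i f\|_{L^p}^p\Big)^{1/p}.$$ **The smoothing operator.** For a Borel probability measure $\mu$ on $(\mathbb R^d)^N$ let $\mu_j$ be its $j$-th marginal, that is, its push-forward under $(x_1,\dots,x_N)\mapsto x_j$. For $\varepsilon>0$ let $\eta^\varepsilon(z)=(2\pi\varepsilon)^{-d/2}\exp\left(-\frac{|z|^2}{2\varepsilon}\right)$ for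 $z\in\mathbb R^d$, and $(\mu_k*\eta^\varepsilon)(y)=\int\eta^\varepsilon(y-x)\,d\mu_k(x)$. Let $\Lambda^\varepsilon[\mu]$ be the measure on $(\mathbb R^d)^N$ with Lebesgue density $Y\mapsto\int\prod_{k=1}^N\eta^\varepsilon(y_k-x_k)\,d\mu(X)$, and define the measure $\Theta^\varepsilon[\mu]$ on $(\mathbb R^d)^N$ by $$\int\psi\,d\Theta^\varepsilon[\mu]=\iint\psi(x_1,\dots,x_N)\prod_{k=1}^N\frac{\eta^\varepsilon(y_k-x_k)}{(\mu_k*\eta^\varepsilon)(y_k)}\,d\mu_1(x_1)\cdots d\mu_N(x_N)\,d\Lambda^\varepsilon[\mu](Y)$$ for every bounded continuous $\psi:(\mathbb R^d)^N\to\mathbb R$. **Theorem.** Let $\mu^n$ $(n\in\mathbb N)$ and $\mu$ be Borel probability measures on $(\mathbb R^d)^N$ such that 1. $\mu^n\rightharpoonup\mu$ in duality with bounded continuous functions, i.e. $\int\phi\,d\mu^n\to\int\phi\,d\mu$ for every bounded continuous $\phi:(\mathbb R^d)^N\to\mathbb R$; 2. for every $j=1,\dots,N$ and every $n$, $\mu^n_j\in\mathcal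 P^{1,p}(\mathbb R^d)$ and $\mu_j\in\mathcal P^{1,p}(\mathbb R^d)$, and $\lim_{n\to\infty}d^{1,p}(\mu^n_j,\mu_j)=0$. Then, for every $\varepsilon>0$, the measures $\Theta^\varepsilon[\mu^n]$ and $\Theta^\varepsilon[\mu]$ belong to $\mathcal P^{1,p}\left((\mathbb R^d)^N\right)$, and $$\lim_{n\to\infty}d^{1,p}\left(\Theta^\varepsilon[\mu^n],\Theta^\varepsilon[\mu]\right)=0.$$ -/

import Mathlib

open MeasureTheory Filter Topology
open scoped ENNReal ContDiff

namespace PlanSmoothing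

noncomputable section

/-! ### Weak partial derivatives and the space `W^{1,p}` -/

section Sobolev

variable {E : Type*} [NormedAddCommGroup E] [NormedSpace ℝ E] [MeasureSpace E]

/-- `g` is a weak derivative of `f` in the direction `v`: both are locally integrable, and
`∫ f ∂_v φ = - ∫ g φ` for every test function `φ ∈ C_c^∞`. -/
def IsWeakPartial (v : E) (f g : E → ℝ) : Prop :=
  LocallyIntegrable f volume ∧ LocallyIntegrable g volume ∧
    ∀ φ : E → ℝ, ContDiff ℝ ∞ φ → HasCompactSupport φ →
      ∫ x, f x * fderiv ℝ φ x v = - ∫ x, g x * φ x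

/-- Weak derivatives are unique up to null sets. -/
theorem IsWeakPartial.ae_eq [FiniteDimensional ℝ E] [BorelSpace E] {v : E} {f g h : E → ℝ}
    (hg : IsWeakPartial v f g) (hh : IsWeakPartial v f h) : g =ᵐ[volume] h := by
  refine ae_eq_of_integral_contDiff_smul_eq hg.2.1 hh.2.1 fun φ hφ hc => ?_
  have h1 := hg.2.2 φ hφ hc
  have h2 := hh.2.2 φ hφ hc
  simp only [smul_eq_mul, mul_comm (φ _)]
  linarith

open Classical in
/-- The weak derivative of `f` in the direction `v` (and `0` if there is none); by
`IsWeakPartial.ae_eq` it is determined up to null sets. -/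
def weakPartial (v : E) (f : E → ℝ) : E → ℝ :=
  if h : ∃ g, IsWeakPartial v f g then h.choose else 0

theorem isWeakPartial_weakPartial {v : E} {f g : E → ℝ} (h : IsWeakPartial v f g) :
    IsWeakPartial v f (weakPartial v f) := by
  have h' : ∃ g, IsWeakPartial v f g := ⟨g, h⟩
  rw [weakPartial, dif_pos h']
  exact h'.choose_spec

variable {ι : Type*}

/-- `f ∈ W^{1,p}`: `f ∈ L^p` and, for every coordinate direction (the vectors of the basis `b`),
`f` has a weak partial derivative in `L^p`. -/
def MemW1p (p : ℝ) (b : Module.Basis ι ℝ E) (f : E → ℝ) : Prop :=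
  MemLp f (ENNReal.ofReal p) volume ∧
    ∀ i, ∃ g, IsWeakPartial (b i) f g ∧ MemLp g (ENNReal.ofReal p) volume

/-- The norm of `W^{1,p}`, with the `p`-norm taken on gradients:
`‖f‖ = (‖f‖_p^p + ∑_i ‖∂_i f‖_p^p)^{1/p}`. It is meant for functions with `MemW1p p b f`. -/
def normW1p [Fintype ι] (p : ℝ) (b : Module.Basis ι ℝ E) (f : E → ℝ) : ℝ≥0∞ :=
  (eLpNorm f (ENNReal.ofReal p) volume ^ p
    + ∑ i, eLpNorm (weakPartial (b i) f) (ENNReal.ofReal p) volume ^ p) ^ (1 / p)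

/-! ### `W^{1,p}`-regular probability measures -/

/-- The `p`-th root of the Lebesgue density of `μ`. -/
def densityRoot (p : ℝ) (μ : Measure E) (x : E) : ℝ :=
  (μ.rnDeriv volume x).toReal ^ (1 / p)

/-- `μ ∈ 𝒫^{1,p}`: `μ` is an absolutely continuous probability measure such that the `p`-th root
of its density is in `W^{1,p}`. -/
def IsW1pRegular (p : ℝ) (b : Module.Basis ι ℝ E) (μ : Measure E) : Prop :=
  IsProbabilityMeasure μ ∧ μ ≪ volume ∧ MemW1p p b (densityRoot p μ)

/-- The distance `d^{1,p}` on `𝒫^{1,p}`. -/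
def dist1p [Fintype ι] (p : ℝ) (b : Module.Basis ι ℝ E) (μ ν : Measure E) : ℝ≥0∞ :=
  normW1p p b (fun x => densityRoot p μ x - densityRoot p ν x)

end Sobolev

/-! ### The smoothing operator -/

/-- `ℝ^d` with the Euclidean norm. -/
abbrev Space (d : ℕ) : Type := EuclideanSpace ℝ (Fin d)

/-- `(ℝ^d)^N`; its `volume` is the `Nd`-dimensional Lebesgue measure. -/
abbrev Config (N d : ℕ) : Type := Fin N → Space d

/-- The standard basis of `ℝ^d`. -/
def stdBasis (d : ℕ) : Module.Basis (Fin d) ℝ (Space d) :=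
  (EuclideanSpace.basisFun (Fin d) ℝ).toBasis

/-- The standard basis of `(ℝ^d)^N`. -/
def stdBasisConfig (N d : ℕ) : Module.Basis ((_ : Fin N) × Fin d) ℝ (Config N d) :=
  Pi.basis fun _ => stdBasis d

variable {N d : ℕ}

/-- The `j`-th marginal of `μ`. -/
def marginal (μ : Measure (Config N d)) (j : Fin N) : Measure (Space d) :=
  μ.map fun X => X j

/-- The Gaussian kernel `η^ε(z) = (2πε)^{-d/2} exp(-|z|²/(2ε))`. -/
def gaussKernel (ε : ℝ) (z : Space d) : ℝ :=
  1 / (2 * Real.pi * ε) ^ ((d : ℝ) / 2) * Real.exp (-‖z‖ ^ 2 / (2 * ε))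

/-- The density of `ρ * η^ε`. -/
def convDensity (ε : ℝ) (ρ : Measure (Space d)) (y : Space d) : ℝ :=
  ∫ x, gaussKernel ε (y - x) ∂ρ

/-- The density of `Λ^ε[μ]`. -/
def lambdaDensity (ε : ℝ) (μ : Measure (Config N d)) (Y : Config N d) : ℝ :=
  ∫ X, ∏ k, gaussKernel ε (Y k - X k) ∂μ

/-- `Λ^ε[μ]`, the convolution of `μ` with `η^ε(x_1) ⋯ η^ε(x_N)`. -/
def Lambda (ε : ℝ) (μ : Measure (Config N d)) : Measure (Config N d) :=
  volume.withDensity fun Y => ENNReal.ofReal (lambdaDensity ε μ Y)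

/-- The kernel `∏_k η^ε(y_k - x_k) / (μ_k * η^ε)(y_k)`, with `μ_k` the `k`-th marginal of `μ`. -/
def thetaKernel (ε : ℝ) (μ : Measure (Config N d)) (Y X : Config N d) : ℝ :=
  ∏ k, gaussKernel ε (Y k - X k) / convDensity ε (marginal μ k) (Y k)

/-- `Θ^ε[μ]`, the law of `X` under the measure
`∏_k η^ε(y_k - x_k) / (μ_k * η^ε)(y_k) dμ_k(x_k) dΛ^ε[μ](Y)`; see `lintegral_Theta`. -/
def Theta (ε : ℝ) (μ : Measure (Config N d)) : Measure (Config N d) :=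
  (((Lambda ε μ).prod (Measure.pi (marginal μ))).withDensity
    fun q => ENNReal.ofReal (thetaKernel ε μ q.1 q.2)).map Prod.snd

theorem continuous_gaussKernel (ε : ℝ) : Continuous (gaussKernel ε : Space d → ℝ) := by
  unfold gaussKernel
  fun_prop

instance (μ : Measure (Config N d)) [IsProbabilityMeasure μ] (j : Fin N) :
    IsProbabilityMeasure (marginal μ j) :=
  Measure.isProbabilityMeasure_map (measurable_pi_apply j).aemeasurable

theorem measurable_convDensity (ε : ℝ) (ρ : Measure (Space d)) [IsProbabilityMeasure ρ] :
    Measurable (convDensity ε ρ) := by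
  have h : Continuous fun q : Space d × Space d => gaussKernel ε (q.1 - q.2) :=
    (continuous_gaussKernel ε).comp (by fun_prop)
  exact (h.stronglyMeasurable.integral_prod_right (ν := ρ)).measurable

theorem measurable_thetaKernel (ε : ℝ) (μ : Measure (Config N d)) [IsProbabilityMeasure μ] :
    Measurable fun q : Config N d × Config N d => thetaKernel ε μ q.1 q.2 := by
  unfold thetaKernel
  refine Finset.measurable_prod _ fun k _ => Measurable.div ?_ ?_
  · exact (continuous_gaussKernel ε).measurable.comp (by fun_prop)
  · exact (measurable_convDensity ε _).comp (by fun_prop)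

/-- The defining formula of `Θ^ε[μ]`. -/
theorem lintegral_Theta (ε : ℝ) (μ : Measure (Config N d)) [IsProbabilityMeasure μ]
    (ψ : Config N d → ℝ≥0∞) (hψ : Measurable ψ) :
    ∫⁻ X, ψ X ∂(Theta ε μ) =
      ∫⁻ Y, ∫⁻ X, ENNReal.ofReal (thetaKernel ε μ Y X) * ψ X ∂(Measure.pi (marginal μ))
        ∂(Lambda ε μ) := by
  have hk := (measurable_thetaKernel ε μ).ennreal_ofReal
  have hs : Measurable fun q : Config N d × Config N d => ψ q.2 := hψ.comp measurable_snd
  rw [Theta, lintegral_map hψ measurable_snd, lintegral_withDensity_eq_lintegral_mul _ hk hs,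
    lintegral_prod _ (hk.mul hs).aemeasurable]
  rfl

end

end PlanSmoothing

open PlanSmoothing

/-! Write `r l` for the `p`-th root of the density of the `l`-th marginal, `q = planRatio ε μ` for
the density of `Λ^ε[μ]` relative to the product of the smoothed marginals, and `G(X) = ∫ gaussProd ε
X Y * q Y dY`. By Tonelli, `Θ^ε[μ]` has density `∏ (r l)^p · G` (`Theta_eq_withDensity`), so its
root is `∏ r l · G^(1/p)` (`rootPlan`). If `s` is the derivative of `r k` in direction `i`, the
product and chain rules suggest the derivative `∏ (update r k s) · G^(1/p) + (1/p) ∏ r l · G^(1/p-1)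
· ∫ w η q`, where `w = (y_k - x_k)_i / ε` (`rootPlanDeriv`).

There is no useful bound on `q` or `G`, so there is no fixed dominating function. What replaces it
is that the relevant masses can be computed exactly. The smoothed marginals in the denominator of
`q` cancel against the integrals of the marginal densities, and the weighted masses on pairs `(X,
Y)` become 1 for the root (`planMass_one_planRatio`), `‖s‖_p^p` for the term with `s`
(`planMass_update_planRatio`), and an absolute Gaussian moment for the weight `|w|^e`
(`planMass_coordWeight_planRatio`). The first and the last do not depend on the plan, and the second
converges by the hypothesis on the marginals.

Weak convergence makes `q` converge pointwise (`tendsto_planRatio`), and along a subsequence `r l`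
and `s` converge almost everywhere. With convergent masses, Scheffé's lemma gives `L¹` convergence
in `(X, Y)`, hence of the integrals over `Y`. Jensen's inequality bounds the `p`-th powers of the
terms above by these integrals, so dominated convergence with an `L¹`-convergent sequence of bounds
yields convergence in `L^p` (`tendsto_lintegral_mul_root`, `tendsto_lintegral_mul_root_deriv`).

The same convergence theorems justify the formula for the derivative (`isWeakPartial_rootPlan`): if
`q` is truncated, `G` is smooth and positive and the classical rules apply; removing the truncation
is another `L^p` limit, under which weak derivatives are stable. -/

namespace PlanSmoothing

/-! ### Scheffé's lemma, generalized dominated convergence and common subsequences -/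

section Convergence

variable {α β : Type*} [MeasurableSpace α] [MeasurableSpace β] {μ : Measure α} {ν : Measure β}

/-- **Scheffé's lemma**: nonnegative functions that converge almost everywhere and whose integrals
converge to the (finite) integral of the limit converge in `L¹`. -/
theorem tendsto_lintegral_enorm_sub_of_tendsto_mass {a : ℕ → α → ℝ} {b : α → ℝ}
    (ha : ∀ n, Measurable (a n)) (hb : Measurable b) (ha0 : ∀ n x, 0 ≤ a n x)
    (hb0 : ∀ x, 0 ≤ b x) (hae : ∀ᵐ x ∂μ, Tendsto (fun n => a n x) atTop (𝓝 (b x)))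
    (hfin : ∫⁻ x, ENNReal.ofReal (b x) ∂μ ≠ ⊤)
    (hm : Tendsto (fun n => ∫⁻ x, ENNReal.ofReal (a n x) ∂μ) atTop
      (𝓝 (∫⁻ x, ENNReal.ofReal (b x) ∂μ))) :
    Tendsto (fun n => ∫⁻ x, ‖a n x - b x‖ₑ ∂μ) atTop (𝓝 0) := by
  -- This is `|a - b| + b = a + 2 (b - a)⁺`, arranged without subtraction in `ℝ≥0∞`. Only `(b - a)⁺`
  -- needs dominated convergence, and `a ≥ 0` bounds it by `b`.
  have key : ∀ n x, ‖a n x - b x‖ₑ + ENNReal.ofReal (b x)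
      = ENNReal.ofReal (a n x) + 2 * ENNReal.ofReal (b x - a n x) := by
    intro n x
    have h2 : (2 : ℝ≥0∞) = ENNReal.ofReal 2 := by simp
    rw [Real.enorm_eq_ofReal_abs, ← ENNReal.ofReal_add (abs_nonneg _) (hb0 x)]
    rcases le_total (b x) (a n x) with h | h
    · rw [abs_of_nonneg (sub_nonneg.2 h), ENNReal.ofReal_of_nonpos (sub_nonpos.2 h)]
      simp
    · rw [abs_of_nonpos (sub_nonpos.2 h), h2, ← ENNReal.ofReal_mul (by norm_num),
        ← ENNReal.ofReal_add (ha0 n x) (by linarith)]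
      congr 1
      ring
  have hdef : Tendsto (fun n => ∫⁻ x, ENNReal.ofReal (b x - a n x) ∂μ) atTop (𝓝 0) := by
    have := tendsto_lintegral_of_dominated_convergence (μ := μ)
      (F := fun n x => ENNReal.ofReal (b x - a n x)) (f := fun _ => 0)
      (fun x => ENNReal.ofReal (b x)) (fun n => (hb.sub (ha n)).ennreal_ofReal)
      (fun n => Eventually.of_forall fun x => ENNReal.ofReal_le_ofReal (by linarith [ha0 n x]))
      hfin (by
        filter_upwards [hae] with x hx
        have h1 : Tendsto (fun n => b x - a n x) atTop (𝓝 0) := by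
          simpa using hx.const_sub (b x)
        simpa using ENNReal.tendsto_ofReal h1)
    simpa using this
  have hsum : ∀ n, ∫⁻ x, ‖a n x - b x‖ₑ ∂μ
      = (∫⁻ x, ENNReal.ofReal (a n x) ∂μ + 2 * ∫⁻ x, ENNReal.ofReal (b x - a n x) ∂μ)
        - ∫⁻ x, ENNReal.ofReal (b x) ∂μ := by
    intro n
    have h1 := lintegral_congr (μ := μ) (key n)
    rw [lintegral_add_right _ hb.ennreal_ofReal, lintegral_add_left (ha n).ennreal_ofReal,
      lintegral_const_mul _ (show Measurable fun x => ENNReal.ofReal (b x - a n x) from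
        (hb.sub (ha n)).ennreal_ofReal)] at h1
    rw [← h1, ENNReal.add_sub_cancel_right hfin]
  simp only [hsum]
  have h2 := ENNReal.Tendsto.sub (hm.add (ENNReal.Tendsto.const_mul (a := 2) hdef
    (Or.inr (by simp)))) (tendsto_const_nhds (x := ∫⁻ x, ENNReal.ofReal (b x) ∂μ)) (Or.inr hfin)
  simpa using h2

/-- Dominated convergence in `L^p` with an `L¹`-convergent sequence of dominating functions. -/
theorem tendsto_lintegral_enorm_sub_rpow_of_dominated {p : ℝ} (hp : 1 ≤ p) {v b : ℕ → α → ℝ}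
    {v' b' : α → ℝ} (hv : ∀ n, Measurable (v n)) (hv' : Measurable v')
    (hb : ∀ n, Measurable (b n)) (hb' : Measurable b')
    (hae : ∀ᵐ x ∂μ, Tendsto (fun n => v n x) atTop (𝓝 (v' x)))
    (hle : ∀ n, ∀ᵐ x ∂μ, |v n x| ^ p ≤ b n x) (hle' : ∀ᵐ x ∂μ, |v' x| ^ p ≤ b' x)
    (hfin : ∫⁻ x, ‖b' x‖ₑ ∂μ ≠ ⊤)
    (hconv : Tendsto (fun n => ∫⁻ x, ‖b n x - b' x‖ₑ ∂μ) atTop (𝓝 0)) :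
    Tendsto (fun n => ∫⁻ x, ‖v n x - v' x‖ₑ ^ p ∂μ) atTop (𝓝 0) := by
  have hp0 : 0 < p := by linarith
  set C : ℝ≥0∞ := 2 ^ (p - 1) with hC
  have hCt : C ≠ ⊤ := ENNReal.rpow_ne_top_of_nonneg (by linarith) (by simp)
  have aux : ∀ t s : ℝ, |t| ^ p ≤ s → ‖t‖ₑ ^ p ≤ ‖s‖ₑ := by
    intro t s h
    rw [Real.enorm_eq_ofReal_abs, Real.enorm_eq_ofReal_abs,
      ENNReal.ofReal_rpow_of_nonneg (abs_nonneg _) hp0.le]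
    exact ENNReal.ofReal_le_ofReal (h.trans (le_abs_self _))
  -- The bound `C (‖b n‖ + ‖b'‖)` varies with `n`. Capping at the fixed integrable function `C * (2
  -- * ‖b'‖)` leaves a part for ordinary dominated convergence, and the excess is at most `C * ‖b n
  -- - b'‖`, which vanishes in `L¹`.
  have hpt : ∀ n, ∀ᵐ x ∂μ, ‖v n x - v' x‖ₑ ^ p
      ≤ min (‖v n x - v' x‖ₑ ^ p) (C * (2 * ‖b' x‖ₑ)) + C * ‖b n x - b' x‖ₑ := by
    intro n
    filter_upwards [hle n, hle'] with x h1 h2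
    have h3 : ‖v n x - v' x‖ₑ ^ p ≤ C * (2 * ‖b' x‖ₑ) + C * ‖b n x - b' x‖ₑ := by
      calc ‖v n x - v' x‖ₑ ^ p ≤ (‖v n x‖ₑ + ‖v' x‖ₑ) ^ p := by
            gcongr; exact enorm_sub_le
        _ ≤ C * (‖v n x‖ₑ ^ p + ‖v' x‖ₑ ^ p) := ENNReal.rpow_add_le_mul_rpow_add_rpow _ _ hp
        _ ≤ C * (‖b n x‖ₑ + ‖b' x‖ₑ) := by gcongr <;> exact aux _ _ ‹_›
        _ ≤ C * ((‖b n x - b' x‖ₑ + ‖b' x‖ₑ) + ‖b' x‖ₑ) := by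
            gcongr
            calc ‖b n x‖ₑ = ‖(b n x - b' x) + b' x‖ₑ := by simp
              _ ≤ _ := enorm_add_le _ _
        _ = _ := by ring
    rcases le_total (‖v n x - v' x‖ₑ ^ p) (C * (2 * ‖b' x‖ₑ)) with h | h
    · rw [min_eq_left h]; exact le_self_add
    · rw [min_eq_right h]; exact h3
  have hmin : Tendsto (fun n => ∫⁻ x, min (‖v n x - v' x‖ₑ ^ p) (C * (2 * ‖b' x‖ₑ)) ∂μ)
      atTop (𝓝 0) := by
    have := tendsto_lintegral_of_dominated_convergence (μ := μ)
      (F := fun n x => min (‖v n x - v' x‖ₑ ^ p) (C * (2 * ‖b' x‖ₑ))) (f := fun _ => 0)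
      (fun x => C * (2 * ‖b' x‖ₑ))
      (fun n => by have := hv n; fun_prop)
      (fun n => Eventually.of_forall fun x => min_le_right _ _)
      (by
        rw [lintegral_const_mul _ (by fun_prop), lintegral_const_mul _ (by fun_prop)]
        exact ENNReal.mul_ne_top hCt (ENNReal.mul_ne_top (by simp) hfin))
      (by
        filter_upwards [hae] with x hx
        have h1 : Tendsto (fun n => ‖v n x - v' x‖ₑ ^ p) atTop (𝓝 0) := by
          have h2 : Tendsto (fun n => v n x - v' x) atTop (𝓝 0) := by
            simpa using hx.sub_const (v' x)
          have h3 := (ENNReal.continuous_rpow_const (y := p)).tendsto _ |>.comp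
            ((continuous_enorm.tendsto _).comp h2)
          simpa [Function.comp_def, hp0] using h3
        have := h1.min (tendsto_const_nhds (x := C * (2 * ‖b' x‖ₑ)))
        simpa using this)
    simpa using this
  refine tendsto_of_tendsto_of_tendsto_of_le_of_le tendsto_const_nhds
    (h := fun n => ∫⁻ x, min (‖v n x - v' x‖ₑ ^ p) (C * (2 * ‖b' x‖ₑ)) ∂μ
      + C * ∫⁻ x, ‖b n x - b' x‖ₑ ∂μ) ?_ (fun _ => bot_le) fun n => ?_
  · simpa using hmin.add (ENNReal.Tendsto.const_mul (a := C) hconv (Or.inr hCt))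
  · refine (lintegral_mono_ae (hpt n)).trans ?_
    have := hv n; have := hb n
    rw [lintegral_add_right _ (by fun_prop), lintegral_const_mul _ (by fun_prop)]

/-- Finitely many sequences that converge in measure have a common almost everywhere convergent
subsequence. -/
theorem exists_common_subseq_tendsto_ae {ι : Type*} [Finite ι] {F : ι → ℕ → α → ℝ} {f : ι → α → ℝ}
    (h : ∀ i, TendstoInMeasure μ (F i) atTop (f i)) :
    ∃ φ : ℕ → ℕ, StrictMono φ ∧
      ∀ i, ∀ᵐ x ∂μ, Tendsto (fun n => F i (φ n) x) atTop (𝓝 (f i x)) := by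
  classical
  cases nonempty_fintype ι
  suffices H : ∀ s : Finset ι, ∃ φ : ℕ → ℕ, StrictMono φ ∧
      ∀ i ∈ s, ∀ᵐ x ∂μ, Tendsto (fun n => F i (φ n) x) atTop (𝓝 (f i x)) by
    obtain ⟨φ, h1, h2⟩ := H Finset.univ
    exact ⟨φ, h1, fun i => h2 i (Finset.mem_univ i)⟩
  intro s
  induction s using Finset.induction_on with
  | empty => exact ⟨id, strictMono_id, by simp⟩
  | insert j s _ ih =>
    obtain ⟨φ, h1, h2⟩ := ih
    have h3 : TendstoInMeasure μ (fun n => F j (φ n)) atTop (f j) :=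
      fun ε hε => (h j ε hε).comp h1.tendsto_atTop
    obtain ⟨ψ, h4, h5⟩ := h3.exists_seq_tendsto_ae
    refine ⟨φ ∘ ψ, h1.comp h4, fun i hi => ?_⟩
    rcases Finset.mem_insert.1 hi with rfl | hi
    · exact h5
    · filter_upwards [h2 i hi] with x hx using hx.comp h4.tendsto_atTop

theorem tendstoInMeasure_of_tendsto_lintegral {F : ℕ → α → ℝ} {f : α → ℝ}
    (hF : ∀ n, Measurable (F n)) (hf : Measurable f)
    (h : Tendsto (fun n => ∫⁻ x, ‖F n x - f x‖ₑ ∂μ) atTop (𝓝 0)) :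
    TendstoInMeasure μ F atTop f := by
  refine tendstoInMeasure_of_tendsto_eLpNorm (p := 1) one_ne_zero
    (fun n => (hF n).aestronglyMeasurable) hf.aestronglyMeasurable ?_
  simpa [eLpNorm_one_eq_lintegral_enorm] using h

theorem enorm_integral_sub_le {f g : β → ℝ} (hf : Integrable f ν) (hg : Integrable g ν) :
    ‖∫ y, f y ∂ν - ∫ y, g y ∂ν‖ₑ ≤ ∫⁻ y, ‖f y - g y‖ₑ ∂ν := by
  rw [← integral_sub hf hg]
  exact enorm_integral_le_lintegral_enorm _

variable [SFinite ν]

/-- The partial integrals of weighted nonnegative functions converge in `L¹` if the weighted masses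
do. -/
theorem tendsto_lintegral_partial_integral {a : ℕ → α → β → ℝ} {b w : α → β → ℝ}
    (ha : ∀ n, Measurable (Function.uncurry (a n))) (hb : Measurable (Function.uncurry b))
    (hw : Measurable (Function.uncurry w)) (ha0 : ∀ n x y, 0 ≤ a n x y) (hb0 : ∀ x y, 0 ≤ b x y)
    (hae : ∀ᵐ x ∂μ, ∀ y, Tendsto (fun n => a n x y) atTop (𝓝 (b x y)))
    (hfin_n : ∀ n, ∫⁻ x, ∫⁻ y, ENNReal.ofReal (|w x y| * a n x y) ∂ν ∂μ ≠ ⊤)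
    (hfin : ∫⁻ x, ∫⁻ y, ENNReal.ofReal (|w x y| * b x y) ∂ν ∂μ ≠ ⊤)
    (hm : Tendsto (fun n => ∫⁻ x, ∫⁻ y, ENNReal.ofReal (|w x y| * a n x y) ∂ν ∂μ) atTop
      (𝓝 (∫⁻ x, ∫⁻ y, ENNReal.ofReal (|w x y| * b x y) ∂ν ∂μ))) :
    Tendsto (fun n => ∫⁻ x, ‖∫ y, w x y * a n x y ∂ν - ∫ y, w x y * b x y ∂ν‖ₑ ∂μ)
      atTop (𝓝 0) := by
  have hA : ∀ n, Measurable fun q : α × β => |w q.1 q.2| * a n q.1 q.2 :=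
    fun n => (_root_.continuous_abs.measurable.comp hw).mul (ha n)
  have hB : Measurable fun q : α × β => |w q.1 q.2| * b q.1 q.2 :=
    (_root_.continuous_abs.measurable.comp hw).mul hb
  have hA' : ∀ n, Measurable fun q : α × β => w q.1 q.2 * a n q.1 q.2 := fun n => hw.mul (ha n)
  have hB' : Measurable fun q : α × β => w q.1 q.2 * b q.1 q.2 := hw.mul hb
  have haeP : ∀ᵐ q ∂(μ.prod ν),
      Tendsto (fun n => |w q.1 q.2| * a n q.1 q.2) atTop (𝓝 (|w q.1 q.2| * b q.1 q.2)) := by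
    have := (Measure.quasiMeasurePreserving_fst (μ := μ) (ν := ν)).ae hae
    filter_upwards [this] with q hq using (hq q.2).const_mul _
  have hS := tendsto_lintegral_enorm_sub_of_tendsto_mass (μ := μ.prod ν) hA hB
    (fun n q => mul_nonneg (abs_nonneg _) (ha0 n _ _)) (fun q => mul_nonneg (abs_nonneg _) (hb0 _ _))
    haeP (by rwa [lintegral_prod _ hB.ennreal_ofReal.aemeasurable])
    (by
      simp only [fun n => lintegral_prod _ (hA n).ennreal_ofReal.aemeasurable (μ := μ) (ν := ν),
        lintegral_prod _ hB.ennreal_ofReal.aemeasurable (μ := μ) (ν := ν)]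
      exact hm)
  have hint : ∀ {u : α → β → ℝ}, Measurable (Function.uncurry u) → (∀ x y, 0 ≤ u x y) →
      ∫⁻ x, ∫⁻ y, ENNReal.ofReal (|w x y| * u x y) ∂ν ∂μ ≠ ⊤ →
      ∀ᵐ x ∂μ, Integrable (fun y => w x y * u x y) ν := by
    intro u hu hu0 hf
    have hU : Measurable fun q : α × β => ENNReal.ofReal (|w q.1 q.2| * u q.1 q.2) :=
      ((_root_.continuous_abs.measurable.comp hw).mul hu).ennreal_ofReal
    filter_upwards [ae_lt_top hU.lintegral_prod_right' hf] with x hx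
    refine ⟨((hw.of_uncurry_left).mul (hu.of_uncurry_left)).aestronglyMeasurable, ?_⟩
    rw [HasFiniteIntegral]
    convert hx using 3 with y
    rw [Real.enorm_eq_ofReal_abs, abs_mul, abs_of_nonneg (hu0 x y)]
  refine tendsto_of_tendsto_of_tendsto_of_le_of_le tendsto_const_nhds hS
    (fun _ => bot_le) fun n => ?_
  have hm1 : Measurable fun q : α × β => ‖|w q.1 q.2| * a n q.1 q.2 - |w q.1 q.2| * b q.1 q.2‖ₑ :=
    ((hA n).sub hB).enorm
  rw [lintegral_prod _ hm1.aemeasurable]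
  refine lintegral_mono_ae ?_
  filter_upwards [hint (ha n) (ha0 n) (hfin_n n), hint hb hb0 hfin] with x h1 h2
  refine (enorm_integral_sub_le h1 h2).trans (le_of_eq (lintegral_congr fun y => ?_))
  rw [← mul_sub, ← mul_sub, enorm_mul, enorm_mul, Real.enorm_abs]

end Convergence

/-! ### Jensen's inequality and `L^p` convergence of `c · (∫ k)^(1/p)` and its derivative term -/

section RootConvergence

variable {α β : Type*} [MeasurableSpace α] [MeasurableSpace β] {μ : Measure α} {ν : Measure β}

theorem abs_mul_rpow_one_div_rpow {p : ℝ} (hp : 1 ≤ p) (c : ℝ) {g : ℝ} (hg : 0 ≤ g) :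
    |c * g ^ (1 / p)| ^ p = |c| ^ p * g := by
  rw [abs_mul, Real.mul_rpow (abs_nonneg _) (abs_nonneg _),
    abs_of_nonneg (Real.rpow_nonneg hg _), ← Real.rpow_mul hg, one_div,
    inv_mul_cancel₀ (by linarith), Real.rpow_one]

/-- **Jensen's inequality** for a weighted integral. -/
theorem abs_integral_mul_rpow_le {p : ℝ} (hp : 1 ≤ p) {w k : β → ℝ} (hw : Measurable w)
    (hk : Measurable k) (hk0 : ∀ y, 0 ≤ k y) (hki : Integrable k ν)
    (hwi : Integrable (fun y => |w y| ^ p * k y) ν) :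
    |∫ y, w y * k y ∂ν| ^ p ≤ (∫ y, k y ∂ν) ^ (p - 1) * ∫ y, |w y| ^ p * k y ∂ν := by
  have hp0 : 0 < p := by linarith
  -- For the finite measure `κ = k ν` the claim is the comparison of the `L¹` and `L^p` norms of
  -- `w`, whose constant is a power of the total mass `∫ k`.
  set κ := ν.withDensity fun y => ENNReal.ofReal (k y) with hκ
  have hkm : Measurable fun y => ENNReal.ofReal (k y) := hk.ennreal_ofReal
  have hκu : κ Set.univ = ENNReal.ofReal (∫ y, k y ∂ν) := by
    rw [hκ, withDensity_apply _ MeasurableSet.univ, Measure.restrict_univ,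
      ofReal_integral_eq_lintegral_ofReal hki (Eventually.of_forall hk0)]
  have hG0 : 0 ≤ ∫ y, k y ∂ν := integral_nonneg hk0
  have hB0 : 0 ≤ ∫ y, |w y| ^ p * k y ∂ν :=
    integral_nonneg fun y => mul_nonneg (Real.rpow_nonneg (abs_nonneg _) _) (hk0 y)
  have hpE : (1 : ℝ≥0∞) ≤ ENNReal.ofReal p := by
    rw [← ENNReal.ofReal_one]; exact ENNReal.ofReal_le_ofReal hp
  have h1 := eLpNorm_le_eLpNorm_mul_rpow_measure_univ (μ := κ) hpE hw.aestronglyMeasurable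
  rw [eLpNorm_one_eq_lintegral_enorm, eLpNorm_eq_lintegral_rpow_enorm_toReal
    (by simpa using hp0) ENNReal.ofReal_ne_top, ENNReal.toReal_ofReal hp0.le, hκu,
    lintegral_withDensity_eq_lintegral_mul _ hkm (by fun_prop),
    lintegral_withDensity_eq_lintegral_mul _ hkm (by fun_prop)] at h1
  have e1 : ∫⁻ y, ((fun y => ENNReal.ofReal (k y)) * fun y => ‖w y‖ₑ) y ∂ν
      = ∫⁻ y, ‖w y * k y‖ₑ ∂ν := by
    refine lintegral_congr fun y => ?_
    simp only [Pi.mul_apply, enorm_mul]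
    rw [Real.enorm_of_nonneg (hk0 y), mul_comm]
  have e2 : ∫⁻ y, ((fun y => ENNReal.ofReal (k y)) * fun y => ‖w y‖ₑ ^ p) y ∂ν
      = ENNReal.ofReal (∫ y, |w y| ^ p * k y ∂ν) := by
    rw [ofReal_integral_eq_lintegral_ofReal hwi (Eventually.of_forall fun y =>
      mul_nonneg (Real.rpow_nonneg (abs_nonneg _) _) (hk0 y))]
    refine lintegral_congr fun y => ?_
    simp only [Pi.mul_apply]
    rw [Real.enorm_eq_ofReal_abs, ENNReal.ofReal_rpow_of_nonneg (abs_nonneg _) hp0.le,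
      ENNReal.ofReal_mul (Real.rpow_nonneg (abs_nonneg _) _), mul_comm]
  rw [e1, e2, ENNReal.toReal_one] at h1
  have h2 := (enorm_integral_le_lintegral_enorm (μ := ν) fun y => w y * k y).trans h1
  have hexp : 0 ≤ 1 / (1 : ℝ) - 1 / p := by
    rw [div_one, sub_nonneg, div_le_one hp0]; exact hp
  rw [Real.enorm_eq_ofReal_abs, ENNReal.ofReal_rpow_of_nonneg hB0 (by positivity),
    ENNReal.ofReal_rpow_of_nonneg hG0 hexp, ← ENNReal.ofReal_mul (by positivity),
    ENNReal.ofReal_le_ofReal_iff (by positivity)] at h2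
  calc |∫ y, w y * k y ∂ν| ^ p
      ≤ ((∫ y, |w y| ^ p * k y ∂ν) ^ (1 / p) * (∫ y, k y ∂ν) ^ (1 / (1 : ℝ) - 1 / p)) ^ p :=
        Real.rpow_le_rpow (abs_nonneg _) h2 hp0.le
    _ = _ := by
      rw [Real.mul_rpow (by positivity) (by positivity), ← Real.rpow_mul hB0, ← Real.rpow_mul hG0,
        one_div, inv_mul_cancel₀ hp0.ne', Real.rpow_one, mul_comm]
      congr 2
      field_simp

/-- The power of `∫ k` is chosen to cancel the factor `(∫ k)^(p-1)` in Jensen's inequality. If `∫ k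
= 0`, the conventions for `0 ^ _` and `0⁻¹` make the product with its inverse at most 1, which is
all that is needed. -/
theorem abs_rpow_mul_integral_rpow_le {p : ℝ} (hp : 1 ≤ p) {w k : β → ℝ} (hw : Measurable w)
    (hk : Measurable k) (hk0 : ∀ y, 0 ≤ k y) (hki : Integrable k ν)
    (hwi : Integrable (fun y => |w y| ^ p * k y) ν) :
    |(∫ y, k y ∂ν) ^ (1 / p - 1) * ∫ y, w y * k y ∂ν| ^ p ≤ ∫ y, |w y| ^ p * k y ∂ν := by
  have hp0 : 0 < p := by linarith
  have hG0 : 0 ≤ ∫ y, k y ∂ν := integral_nonneg hk0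
  have hB0 : 0 ≤ ∫ y, |w y| ^ p * k y ∂ν :=
    integral_nonneg fun y => mul_nonneg (Real.rpow_nonneg (abs_nonneg _) _) (hk0 y)
  have h := abs_integral_mul_rpow_le hp hw hk hk0 hki hwi
  rw [abs_mul, abs_of_nonneg (Real.rpow_nonneg hG0 _),
    Real.mul_rpow (Real.rpow_nonneg hG0 _) (abs_nonneg _), ← Real.rpow_mul hG0]
  have he : (1 / p - 1) * p = -(p - 1) := by field_simp; ring
  rw [he, Real.rpow_neg hG0]
  set g := (∫ y, k y ∂ν) ^ (p - 1)
  have hg : 0 ≤ g := Real.rpow_nonneg hG0 _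
  calc g⁻¹ * |∫ y, w y * k y ∂ν| ^ p ≤ g⁻¹ * (g * ∫ y, |w y| ^ p * k y ∂ν) := by gcongr
    _ = (g⁻¹ * g) * ∫ y, |w y| ^ p * k y ∂ν := by ring
    _ ≤ 1 * ∫ y, |w y| ^ p * k y ∂ν := by
        gcongr
        exact inv_mul_le_one
    _ = _ := one_mul _

theorem lintegral_enorm_mul_root_rpow_le {p : ℝ} (hp : 1 ≤ p) (c : α → ℝ) {k : α → β → ℝ}
    (hk0 : ∀ x y, 0 ≤ k x y) :
    ∫⁻ x, ‖c x * (∫ y, k x y ∂ν) ^ (1 / p)‖ₑ ^ p ∂μ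
      ≤ ∫⁻ x, ∫⁻ y, ENNReal.ofReal (|c x| ^ p * k x y) ∂ν ∂μ := by
  refine lintegral_mono fun x => ?_
  rw [Real.enorm_eq_ofReal_abs, ENNReal.ofReal_rpow_of_nonneg (abs_nonneg _) (by linarith),
    abs_mul_rpow_one_div_rpow hp _ (integral_nonneg (hk0 x)), ← integral_const_mul]
  refine (Real.ofReal_le_enorm _).trans ((enorm_integral_le_lintegral_enorm _).trans
    (le_of_eq (lintegral_congr fun y => ?_)))
  rw [Real.enorm_of_nonneg (mul_nonneg (Real.rpow_nonneg (abs_nonneg _) _) (hk0 x y))]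

variable [SFinite ν]

/-- Almost every section of a nonnegative kernel with finite mass is integrable. -/
theorem ae_integrable_section {a : α → β → ℝ} (ha : Measurable (Function.uncurry a))
    (ha0 : ∀ x y, 0 ≤ a x y) (hfin : ∫⁻ x, ∫⁻ y, ENNReal.ofReal (a x y) ∂ν ∂μ ≠ ⊤) :
    ∀ᵐ x ∂μ, Integrable (a x) ν := by
  have hU : Measurable fun q : α × β => ENNReal.ofReal (a q.1 q.2) := ha.ennreal_ofReal
  filter_upwards [ae_lt_top hU.lintegral_prod_right' hfin] with x hx
  refine ⟨ha.of_uncurry_left.aestronglyMeasurable, ?_⟩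
  rw [HasFiniteIntegral]
  convert hx using 3 with y
  rw [Real.enorm_of_nonneg (ha0 x y)]

/-- Finite mass with `e = 0` and `e = p` makes almost every section of `|c|^p k` and `|w|^p |c|^p k`
integrable. Where `c x ≠ 0` that factor can be divided out and Jensen applies; where `c x = 0` both
sides vanish. -/
theorem ae_abs_mul_root_deriv_rpow_le {p : ℝ} (hp : 1 ≤ p) {c : α → ℝ} {k w : α → β → ℝ}
    (hc : Measurable c) (hk : Measurable (Function.uncurry k))
    (hw : Measurable (Function.uncurry w)) (hk0 : ∀ x y, 0 ≤ k x y) (hf : ∀ e : ℝ, 0 ≤ e →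
      ∫⁻ x, ∫⁻ y, ENNReal.ofReal (|w x y| ^ e * (|c x| ^ p * k x y)) ∂ν ∂μ ≠ ⊤) :
    ∀ᵐ x ∂μ, |c x * ((∫ y, k x y ∂ν) ^ (1 / p - 1) * ∫ y, w x y * k x y ∂ν)| ^ p
      ≤ |c x| ^ p * ∫ y, |w x y| ^ p * k x y ∂ν := by
  have hp0 : 0 < p := by linarith
  have hcp0 : ∀ x, 0 ≤ |c x| ^ p := fun x => Real.rpow_nonneg (abs_nonneg _) _
  have hck : Measurable fun q : α × β => |c q.1| ^ p * k q.1 q.2 :=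
    ((_root_.continuous_abs.measurable.comp (hc.comp measurable_fst)).pow_const p).mul hk
  have hwpk : ∀ e : ℝ,
      Measurable (Function.uncurry fun x y => |w x y| ^ e * (|c x| ^ p * k x y)) := fun e =>
    ((_root_.continuous_abs.measurable.comp hw).pow_const e).mul hck
  have h0 := ae_integrable_section (ν := ν) (hwpk 0)
    (fun x y => mul_nonneg (by positivity) (mul_nonneg (hcp0 _) (hk0 x y))) (hf 0 le_rfl)
  have h1 := ae_integrable_section (ν := ν) (hwpk p)
    (fun x y => mul_nonneg (by positivity) (mul_nonneg (hcp0 _) (hk0 x y))) (hf p hp0.le)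
  filter_upwards [h0, h1] with x h0 h1
  rw [abs_mul, Real.mul_rpow (abs_nonneg _) (abs_nonneg _)]
  by_cases hcx : c x = 0
  · simp [hcx, Real.zero_rpow hp0.ne']
  have hne : |c x| ^ p ≠ 0 := (Real.rpow_pos_of_pos (abs_pos.2 hcx) _).ne'
  refine mul_le_mul_of_nonneg_left ?_ (hcp0 x)
  refine abs_rpow_mul_integral_rpow_le hp hw.of_uncurry_left hk.of_uncurry_left (hk0 x) ?_ ?_
  · simp only [Real.rpow_zero, one_mul] at h0
    exact (integrable_const_mul_iff (isUnit_iff_ne_zero.2 hne) _).1 h0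
  · simp only [mul_left_comm (|w x _| ^ p)] at h1
    exact (integrable_const_mul_iff (isUnit_iff_ne_zero.2 hne) _).1 h1

theorem lintegral_enorm_mul_root_deriv_rpow_le {p : ℝ} (hp : 1 ≤ p) {c : α → ℝ} {k w : α → β → ℝ}
    (hc : Measurable c) (hk : Measurable (Function.uncurry k))
    (hw : Measurable (Function.uncurry w)) (hk0 : ∀ x y, 0 ≤ k x y) (hf : ∀ e : ℝ, 0 ≤ e →
      ∫⁻ x, ∫⁻ y, ENNReal.ofReal (|w x y| ^ e * (|c x| ^ p * k x y)) ∂ν ∂μ ≠ ⊤) :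
    ∫⁻ x, ‖c x * ((∫ y, k x y ∂ν) ^ (1 / p - 1) * ∫ y, w x y * k x y ∂ν)‖ₑ ^ p ∂μ
      ≤ ∫⁻ x, ∫⁻ y, ENNReal.ofReal (|w x y| ^ p * (|c x| ^ p * k x y)) ∂ν ∂μ := by
  refine lintegral_mono_ae ?_
  filter_upwards [ae_abs_mul_root_deriv_rpow_le hp hc hk hw hk0 hf] with x hx
  rw [Real.enorm_eq_ofReal_abs, ENNReal.ofReal_rpow_of_nonneg (abs_nonneg _) (by linarith)]
  refine (ENNReal.ofReal_le_ofReal hx).trans ?_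
  rw [← integral_const_mul]
  refine (Real.ofReal_le_enorm _).trans ((enorm_integral_le_lintegral_enorm _).trans
    (le_of_eq (lintegral_congr fun y => ?_)))
  rw [Real.enorm_of_nonneg (mul_nonneg (Real.rpow_nonneg (abs_nonneg _) _)
    (mul_nonneg (Real.rpow_nonneg (abs_nonneg _) _) (hk0 x y))), mul_left_comm]

/-- The `p`-th power of the function is `|c|^p ∫ k`, which converges in `L¹` by Scheffé and so
serves as its own dominating sequence. A subsequence is extracted because `∫ k n` is not assumed to
converge pointwise. -/
theorem tendsto_lintegral_mul_root {p : ℝ} (hp : 1 ≤ p) {c : ℕ → α → ℝ} {c' : α → ℝ}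
    {k : ℕ → α → β → ℝ} {k' : α → β → ℝ} (hc : ∀ n, Measurable (c n)) (hc' : Measurable c')
    (hk : ∀ n, Measurable (Function.uncurry (k n))) (hk' : Measurable (Function.uncurry k'))
    (hk0 : ∀ n x y, 0 ≤ k n x y) (hk0' : ∀ x y, 0 ≤ k' x y)
    (hcae : ∀ᵐ x ∂μ, Tendsto (fun n => c n x) atTop (𝓝 (c' x)))
    (hkt : ∀ x y, Tendsto (fun n => k n x y) atTop (𝓝 (k' x y)))
    (hfin_n : ∀ n, ∫⁻ x, ∫⁻ y, ENNReal.ofReal (|c n x| ^ p * k n x y) ∂ν ∂μ ≠ ⊤)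
    (hfin : ∫⁻ x, ∫⁻ y, ENNReal.ofReal (|c' x| ^ p * k' x y) ∂ν ∂μ ≠ ⊤)
    (hm : Tendsto (fun n => ∫⁻ x, ∫⁻ y, ENNReal.ofReal (|c n x| ^ p * k n x y) ∂ν ∂μ) atTop
      (𝓝 (∫⁻ x, ∫⁻ y, ENNReal.ofReal (|c' x| ^ p * k' x y) ∂ν ∂μ))) :
    Tendsto (fun n => ∫⁻ x, ‖c n x * (∫ y, k n x y ∂ν) ^ (1 / p)
      - c' x * (∫ y, k' x y ∂ν) ^ (1 / p)‖ₑ ^ p ∂μ) atTop (𝓝 0) := by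
  have hp0 : 0 < p := by linarith
  have hG : ∀ n, Measurable fun x => ∫ y, k n x y ∂ν :=
    fun n => ((hk n).stronglyMeasurable.integral_prod_right (ν := ν)).measurable
  have hG' : Measurable fun x => ∫ y, k' x y ∂ν :=
    (hk'.stronglyMeasurable.integral_prod_right (ν := ν)).measurable
  have hG0 : ∀ n x, 0 ≤ ∫ y, k n x y ∂ν := fun n x => integral_nonneg (hk0 n x)
  have hG0' : ∀ x, 0 ≤ ∫ y, k' x y ∂ν := fun x => integral_nonneg (hk0' x)
  have hL := tendsto_lintegral_partial_integral (μ := μ) (ν := ν)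
    (a := fun n x y => |c n x| ^ p * k n x y) (b := fun x y => |c' x| ^ p * k' x y)
    (w := fun _ _ => 1)
    (fun n => by
      have := hk n; have := hc n
      simp only [Function.uncurry_def] at *
      fun_prop)
    (by simp only [Function.uncurry_def] at *; fun_prop) (by fun_prop)
    (fun n x y => mul_nonneg (Real.rpow_nonneg (abs_nonneg _) _) (hk0 n x y))
    (fun x y => mul_nonneg (Real.rpow_nonneg (abs_nonneg _) _) (hk0' x y))
    (by
      filter_upwards [hcae] with x hx y
      exact ((hx.abs).rpow_const (Or.inr hp0.le)).mul (hkt x y))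
    (by simpa using hfin_n) (by simpa using hfin) (by simpa using hm)
  simp only [one_mul, integral_const_mul] at hL
  have hb : ∀ n, Measurable fun x => |c n x| ^ p * ∫ y, k n x y ∂ν := fun n => by
    have := hG n; have := hc n; fun_prop
  have hb' : Measurable fun x => |c' x| ^ p * ∫ y, k' x y ∂ν := by fun_prop
  refine tendsto_of_subseq_tendsto fun ns hns => ?_
  have hL2 := hL.comp hns
  obtain ⟨ms, hms, hae⟩ := (tendstoInMeasure_of_tendsto_lintegral (fun n => hb (ns n)) hb'
    hL2).exists_seq_tendsto_ae
  refine ⟨ms, tendsto_lintegral_enorm_sub_rpow_of_dominated hp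
    (v := fun n x => c (ns (ms n)) x * (∫ y, k (ns (ms n)) x y ∂ν) ^ (1 / p))
    (v' := fun x => c' x * (∫ y, k' x y ∂ν) ^ (1 / p))
    (b := fun n x => |c (ns (ms n)) x| ^ p * ∫ y, k (ns (ms n)) x y ∂ν)
    (fun n => by have := hG (ns (ms n)); have := hc (ns (ms n)); fun_prop)
    (by fun_prop) (fun n => hb _) hb' ?_
    (fun n => Eventually.of_forall fun x => (abs_mul_rpow_one_div_rpow hp _ (hG0 _ x)).le)
    (Eventually.of_forall fun x => (abs_mul_rpow_one_div_rpow hp _ (hG0' x)).le)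
    ?_ (hL2.comp hms.tendsto_atTop)⟩
  · filter_upwards [hae, hcae] with x h1 h2
    have h2' := (h2.comp hns).comp hms.tendsto_atTop
    simp only [Function.comp_def] at h2'
    -- Only the product `|c|^p ∫ k` is known to converge. Where its limit is nonzero, division by
    -- `|c|^p` recovers the limit of `∫ k`; where it is zero, the function tends to 0 because its
    -- `p`-th power is that product.
    by_cases hz : |c' x| ^ p * ∫ y, k' x y ∂ν = 0
    · have h3 : c' x * (∫ y, k' x y ∂ν) ^ (1 / p) = 0 := by
        have := abs_mul_rpow_one_div_rpow hp (c' x) (hG0' x)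
        rw [hz, Real.rpow_eq_zero (abs_nonneg _) hp0.ne'] at this
        exact abs_eq_zero.1 this
      rw [h3]
      rw [hz] at h1
      rw [tendsto_zero_iff_abs_tendsto_zero]
      have h4 := h1.rpow_const (p := 1 / p) (Or.inr (by positivity))
      rw [Real.zero_rpow (by positivity)] at h4
      refine h4.congr fun n => ?_
      rw [← abs_mul_rpow_one_div_rpow hp _ (hG0 _ x), ← Real.rpow_mul (abs_nonneg _),
        mul_one_div_cancel hp0.ne', Real.rpow_one]
      rfl
    · have hc0 : |c' x| ^ p ≠ 0 := left_ne_zero_of_mul hz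
      have hcp := (h2'.abs).rpow_const (p := p) (Or.inr hp0.le)
      have hGt : Tendsto (fun n => ∫ y, k (ns (ms n)) x y ∂ν) atTop (𝓝 (∫ y, k' x y ∂ν)) := by
        have h5 := h1.div hcp hc0
        rw [mul_div_cancel_left₀ _ hc0] at h5
        refine h5.congr' ?_
        filter_upwards [hcp.eventually_ne hc0] with n hn
        simp only [Pi.div_apply]
        rw [mul_div_cancel_left₀ _ hn]
      exact h2'.mul (hGt.rpow_const (Or.inr (by positivity)))
  · have hle : ∫⁻ x, ‖|c' x| ^ p * ∫ y, k' x y ∂ν‖ₑ ∂μ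
        ≤ ∫⁻ x, ∫⁻ y, ENNReal.ofReal (|c' x| ^ p * k' x y) ∂ν ∂μ := by
      refine lintegral_mono fun x => ?_
      rw [← integral_const_mul]
      refine (enorm_integral_le_lintegral_enorm _).trans (le_of_eq (lintegral_congr fun y => ?_))
      rw [Real.enorm_of_nonneg (mul_nonneg (Real.rpow_nonneg (abs_nonneg _) _) (hk0' x y))]
    exact ne_top_of_le_ne_top hfin hle

/-- Jensen supplies the dominating sequence `|c|^p ∫ |w|^p k`, and convergence of its mass is the
hypothesis with `e = p`. The cases `e = 0` and `e = 1` give the limits of `∫ k` and `∫ w k`. -/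
theorem tendsto_lintegral_mul_root_deriv {p : ℝ} (hp : 1 ≤ p) {c : ℕ → α → ℝ} {c' : α → ℝ}
    {k : ℕ → α → β → ℝ} {k' w : α → β → ℝ} (hc : ∀ n, Measurable (c n)) (hc' : Measurable c')
    (hk : ∀ n, Measurable (Function.uncurry (k n))) (hk' : Measurable (Function.uncurry k'))
    (hw : Measurable (Function.uncurry w))
    (hk0 : ∀ n x y, 0 ≤ k n x y) (hk0' : ∀ x y, 0 ≤ k' x y)
    (hcae : ∀ᵐ x ∂μ, Tendsto (fun n => c n x) atTop (𝓝 (c' x)))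
    (hkt : ∀ x y, Tendsto (fun n => k n x y) atTop (𝓝 (k' x y)))
    (hfin_n : ∀ e : ℝ, 0 ≤ e → ∀ n,
      ∫⁻ x, ∫⁻ y, ENNReal.ofReal (|w x y| ^ e * (|c n x| ^ p * k n x y)) ∂ν ∂μ ≠ ⊤)
    (hfin : ∀ e : ℝ, 0 ≤ e →
      ∫⁻ x, ∫⁻ y, ENNReal.ofReal (|w x y| ^ e * (|c' x| ^ p * k' x y)) ∂ν ∂μ ≠ ⊤)
    (hm : ∀ e : ℝ, 0 ≤ e → Tendsto
      (fun n => ∫⁻ x, ∫⁻ y, ENNReal.ofReal (|w x y| ^ e * (|c n x| ^ p * k n x y)) ∂ν ∂μ) atTop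
      (𝓝 (∫⁻ x, ∫⁻ y, ENNReal.ofReal (|w x y| ^ e * (|c' x| ^ p * k' x y)) ∂ν ∂μ))) :
    Tendsto (fun n => ∫⁻ x, ‖c n x * ((∫ y, k n x y ∂ν) ^ (1 / p - 1) * ∫ y, w x y * k n x y ∂ν)
      - c' x * ((∫ y, k' x y ∂ν) ^ (1 / p - 1) * ∫ y, w x y * k' x y ∂ν)‖ₑ ^ p ∂μ)
      atTop (𝓝 0) := by
  have hp0 : 0 < p := by linarith
  have hcp0 : ∀ (c : α → ℝ) x, 0 ≤ |c x| ^ p := fun c x => Real.rpow_nonneg (abs_nonneg _) _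
  have hmea : ∀ {k : α → β → ℝ}, Measurable (Function.uncurry k) →
      Measurable fun x => ∫ y, k x y ∂ν :=
    fun hk => (hk.stronglyMeasurable.integral_prod_right (ν := ν)).measurable
  have hwk : ∀ {k : α → β → ℝ}, Measurable (Function.uncurry k) →
      Measurable (Function.uncurry fun x y => w x y * k x y) := fun hk => hw.mul hk
  have hwpk : ∀ (e : ℝ) {k : α → β → ℝ}, Measurable (Function.uncurry k) →
      Measurable (Function.uncurry fun x y => |w x y| ^ e * k x y) := fun e k hk =>
    ((_root_.continuous_abs.measurable.comp hw).pow_const e).mul hk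
  have hck : ∀ {c : α → ℝ} {k : α → β → ℝ}, Measurable c → Measurable (Function.uncurry k) →
      Measurable (Function.uncurry fun x y => |c x| ^ p * k x y) := fun hc hk => by
    simp only [Function.uncurry_def] at *
    fun_prop
  have hG := fun n => hmea (hk n)
  have hG' := hmea hk'
  have hM := fun n => hmea (hwk (hk n))
  have hM' := hmea (hwk hk')
  have hB := fun n => hmea (hwpk p (hk n))
  have hB' := hmea (hwpk p hk')
  have haeP : ∀ᵐ x ∂μ, ∀ y,
      Tendsto (fun n => |c n x| ^ p * k n x y) atTop (𝓝 (|c' x| ^ p * k' x y)) := by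
    filter_upwards [hcae] with x hx y
    exact ((hx.abs).rpow_const (Or.inr hp0.le)).mul (hkt x y)
  -- Only `|u|` is prescribed, so that with `e = 1` the signed weight `w` itself is covered.
  have hconv : ∀ (e : ℝ) (_ : 0 ≤ e) (u : α → β → ℝ) (_ : Measurable (Function.uncurry u))
      (_ : ∀ x y, |u x y| = |w x y| ^ e), Tendsto (fun n => ∫⁻ x,
        ‖|c n x| ^ p * ∫ y, u x y * k n x y ∂ν - |c' x| ^ p * ∫ y, u x y * k' x y ∂ν‖ₑ ∂μ)
        atTop (𝓝 0) := by
    intro e he u hu hue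
    have := tendsto_lintegral_partial_integral (μ := μ) (ν := ν)
      (a := fun n x y => |c n x| ^ p * k n x y) (b := fun x y => |c' x| ^ p * k' x y)
      (w := u) (fun n => hck (hc n) (hk n)) (hck hc' hk') hu
      (fun n x y => mul_nonneg (hcp0 _ _) (hk0 n x y))
      (fun x y => mul_nonneg (hcp0 _ _) (hk0' x y)) haeP
      (by simpa only [hue] using hfin_n e he) (by simpa only [hue] using hfin e he)
      (by simpa only [hue] using hm e he)
    simpa only [mul_left_comm (u _ _), integral_const_mul] using this
  have hwe : ∀ e : ℝ, Measurable (Function.uncurry fun x y => |w x y| ^ e) := fun e =>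
    (_root_.continuous_abs.measurable.comp hw).pow_const e
  have hL0 := hconv 0 le_rfl (fun _ _ => 1) (by fun_prop) (by simp)
  have hL1 := hconv 1 zero_le_one w hw (by simp)
  have hLp := hconv p hp0.le (fun x y => |w x y| ^ p) (hwe p)
    (fun x y => abs_of_nonneg (Real.rpow_nonneg (abs_nonneg _) _))
  simp only [one_mul] at hL0
  have hbn := fun n => ae_abs_mul_root_deriv_rpow_le hp (hc n) (hk n) hw (hk0 n) (fun e he => hfin_n e he n)
  have hb' := ae_abs_mul_root_deriv_rpow_le hp hc' hk' hw hk0' hfin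
  have hint0 := ae_integrable_section (ν := ν) (hwpk 0 (hck hc' hk'))
      (fun x y => mul_nonneg (by positivity) (mul_nonneg (hcp0 _ _) (hk0' x y))) (hfin 0 le_rfl)
  have hcG : ∀ {c g : α → ℝ}, Measurable c → Measurable g → Measurable fun x => |c x| ^ p * g x :=
    fun hc hg => by fun_prop
  refine tendsto_of_subseq_tendsto fun ns hns => ?_
  have hT : ∀ i : Fin 3, TendstoInMeasure μ
      (fun n => ![fun x => |c (ns n) x| ^ p * ∫ y, k (ns n) x y ∂ν,
        fun x => |c (ns n) x| ^ p * ∫ y, w x y * k (ns n) x y ∂ν,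
        fun x => |c (ns n) x| ^ p * ∫ y, |w x y| ^ p * k (ns n) x y ∂ν] i) atTop
      (![fun x => |c' x| ^ p * ∫ y, k' x y ∂ν,
        fun x => |c' x| ^ p * ∫ y, w x y * k' x y ∂ν,
        fun x => |c' x| ^ p * ∫ y, |w x y| ^ p * k' x y ∂ν] i) := by
    intro i
    fin_cases i
    · exact tendstoInMeasure_of_tendsto_lintegral (fun n => hcG (hc _) (hG _)) (hcG hc' hG')
        (hL0.comp hns)
    · exact tendstoInMeasure_of_tendsto_lintegral (fun n => hcG (hc _) (hM _)) (hcG hc' hM')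
        (hL1.comp hns)
    · exact tendstoInMeasure_of_tendsto_lintegral (fun n => hcG (hc _) (hB _)) (hcG hc' hB')
        (hLp.comp hns)
  obtain ⟨ms, hms, hae⟩ := exists_common_subseq_tendsto_ae hT
  have hae0 := hae 0
  have hae1 := hae 1
  have hae2 := hae 2
  simp only [Matrix.cons_val] at hae0 hae1 hae2
  refine ⟨ms, tendsto_lintegral_enorm_sub_rpow_of_dominated hp
    (v := fun n x => c (ns (ms n)) x * ((∫ y, k (ns (ms n)) x y ∂ν) ^ (1 / p - 1)
      * ∫ y, w x y * k (ns (ms n)) x y ∂ν))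
    (v' := fun x => c' x * ((∫ y, k' x y ∂ν) ^ (1 / p - 1) * ∫ y, w x y * k' x y ∂ν))
    (b := fun n x => |c (ns (ms n)) x| ^ p * ∫ y, |w x y| ^ p * k (ns (ms n)) x y ∂ν)
    (fun n => (hc _).mul (((hG _).pow_const _).mul (hM _)))
    (hc'.mul ((hG'.pow_const _).mul hM')) (fun n => hcG (hc _) (hB _)) (hcG hc' hB') ?_
    (fun n => hbn _) hb' ?_ ((hLp.comp hns).comp hms.tendsto_atTop)⟩
  · have hball : ∀ᵐ x ∂μ, ∀ n, |c n x * ((∫ y, k n x y ∂ν) ^ (1 / p - 1)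
        * ∫ y, w x y * k n x y ∂ν)| ^ p ≤ |c n x| ^ p * ∫ y, |w x y| ^ p * k n x y ∂ν :=
      ae_all_iff.2 hbn
    filter_upwards [hae0, hae1, hae2, hcae, hball, hint0] with x h0 h1 h2 hcx hb hi
    have hc2 := (hcx.comp hns).comp hms.tendsto_atTop
    simp only [Function.comp_def] at hc2
    have hcp := (hc2.abs).rpow_const (p := p) (Or.inr hp0.le)
    -- For `p > 1` the power `(∫ k)^(1/p-1)` is not continuous at 0. Where the limit mass vanishes,
    -- every weighted integral of the limit kernel vanishes too, so the Jensen bound tends to 0 and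
    -- squeezes the sequence.
    by_cases hz : |c' x| ^ p * ∫ y, k' x y ∂ν = 0
    · have hzero : ∀ u : β → ℝ, |c' x| ^ p * ∫ y, u y * k' x y ∂ν = 0 := by
        intro u
        rcases mul_eq_zero.1 hz with h | h
        · rw [h, zero_mul]
        by_cases hc0 : |c' x| ^ p = 0
        · rw [hc0, zero_mul]
        simp only [Real.rpow_zero, one_mul] at hi
        have hki := (integrable_const_mul_iff (isUnit_iff_ne_zero.2 hc0) _).1 hi
        have := (integral_eq_zero_iff_of_nonneg (hk0' x) hki).1 h
        have h3 : (fun y => u y * k' x y) =ᵐ[ν] 0 := by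
          filter_upwards [this] with y hy
          simp [hy]
        rw [integral_congr_ae h3]
        simp
      have h3 : c' x * ((∫ y, k' x y ∂ν) ^ (1 / p - 1) * ∫ y, w x y * k' x y ∂ν) = 0 := by
        rcases mul_eq_zero.1 (hzero (w x)) with h | h
        · rw [Real.rpow_eq_zero (abs_nonneg _) hp0.ne', abs_eq_zero] at h
          rw [h, zero_mul]
        · rw [h, mul_zero, mul_zero]
      rw [h3]
      rw [hzero] at h2
      rw [tendsto_zero_iff_abs_tendsto_zero]
      have h4 := h2.rpow_const (p := 1 / p) (Or.inr (by positivity))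
      rw [Real.zero_rpow (by positivity)] at h4
      refine tendsto_of_tendsto_of_tendsto_of_le_of_le tendsto_const_nhds h4
        (fun _ => abs_nonneg _) fun n => ?_
      have h5 := Real.rpow_le_rpow (z := 1 / p) (Real.rpow_nonneg (abs_nonneg _) _)
        (hb (ns (ms n))) (by positivity)
      rwa [← Real.rpow_mul (abs_nonneg _), mul_one_div_cancel hp0.ne', Real.rpow_one] at h5
    · have hc0 : |c' x| ^ p ≠ 0 := left_ne_zero_of_mul hz
      have hdiv : ∀ {f : ℕ → ℝ} {f' : ℝ},
          Tendsto (fun n => |c (ns (ms n)) x| ^ p * f n) atTop (𝓝 (|c' x| ^ p * f')) →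
          Tendsto f atTop (𝓝 f') := by
        intro f f' h
        have h5 := h.div hcp hc0
        rw [mul_div_cancel_left₀ _ hc0] at h5
        refine h5.congr' ?_
        filter_upwards [hcp.eventually_ne hc0] with n hn
        simp only [Pi.div_apply]
        rw [mul_div_cancel_left₀ _ hn]
      exact hc2.mul (((hdiv h0).rpow_const (Or.inl (right_ne_zero_of_mul hz))).mul (hdiv h1))
  · have hle : ∫⁻ x, ‖|c' x| ^ p * ∫ y, |w x y| ^ p * k' x y ∂ν‖ₑ ∂μ
        ≤ ∫⁻ x, ∫⁻ y, ENNReal.ofReal (|w x y| ^ p * (|c' x| ^ p * k' x y)) ∂ν ∂μ := by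
      refine lintegral_mono fun x => ?_
      rw [← integral_const_mul]
      refine (enorm_integral_le_lintegral_enorm _).trans (le_of_eq (lintegral_congr fun y => ?_))
      rw [Real.enorm_of_nonneg (mul_nonneg (hcp0 _ _)
        (mul_nonneg (Real.rpow_nonneg (abs_nonneg _) _) (hk0' x y))), mul_left_comm]
    exact ne_top_of_le_ne_top (hfin p hp0.le) hle

end RootConvergence

/-! ### `L^p` norms with a real exponent, and test functions -/

theorem eLpNorm_ofReal_rpow {α : Type*} [MeasurableSpace α] {μ : Measure α} {p : ℝ} (hp : 1 ≤ p)
    (f : α → ℝ) : eLpNorm f (ENNReal.ofReal p) μ ^ p = ∫⁻ x, ‖f x‖ₑ ^ p ∂μ := by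
  have h := eLpNorm_nnreal_pow_eq_lintegral (f := f) (μ := μ) (p := p.toNNReal)
    (by simpa using (by linarith : 0 < p))
  rwa [Real.coe_toNNReal p (by linarith)] at h

theorem one_le_ofReal {p : ℝ} (hp : 1 ≤ p) : (1 : ℝ≥0∞) ≤ ENNReal.ofReal p := by
  rw [← ENNReal.ofReal_one]
  exact ENNReal.ofReal_le_ofReal hp

theorem tendsto_eLpNorm_ofReal_iff {α : Type*} [MeasurableSpace α] {μ : Measure α} {p : ℝ}
    (hp : 1 ≤ p) {f : ℕ → α → ℝ} :
    Tendsto (fun n => eLpNorm (f n) (ENNReal.ofReal p) μ) atTop (𝓝 0)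
      ↔ Tendsto (fun n => ∫⁻ x, ‖f n x‖ₑ ^ p ∂μ) atTop (𝓝 0) := by
  have hp0 : 0 < p := by linarith
  simp only [← eLpNorm_ofReal_rpow hp]
  constructor <;> intro h
  · have := (ENNReal.continuous_rpow_const (y := p)).tendsto _ |>.comp h
    simpa [Function.comp_def, hp0] using this
  · have := (ENNReal.continuous_rpow_const (y := 1 / p)).tendsto _ |>.comp h
    simpa [Function.comp_def, hp0, ← ENNReal.rpow_mul, hp0.ne'] using this

theorem continuous_fderiv_apply_of_contDiff {E : Type*} [NormedAddCommGroup E] [NormedSpace ℝ E]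
    {φ : E → ℝ} (h : ContDiff ℝ ∞ φ) (v : E) :
    Continuous fun x => fderiv ℝ φ x v :=
  (h.continuous_fderiv (by simp)).clm_apply continuous_const

theorem hasCompactSupport_fderiv_apply {E : Type*} [NormedAddCommGroup E] [NormedSpace ℝ E]
    {φ : E → ℝ} (h : HasCompactSupport φ) (v : E) :
    HasCompactSupport fun x => fderiv ℝ φ x v :=
  (h.fderiv (𝕜 := ℝ)).comp_left (g := fun L : E →L[ℝ] ℝ => L v) (by simp)

theorem integrable_mul_of_hasCompactSupport {E : Type*} [NormedAddCommGroup E] [MeasureSpace E]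
    [BorelSpace E] {f φ : E → ℝ} (hf : LocallyIntegrable f volume)
    (h1 : Continuous φ) (h2 : HasCompactSupport φ) : Integrable fun x => f x * φ x := by
  simpa using hf.integrable_smul_right_of_hasCompactSupport h1 h2

/-! ### Calculus of weak derivatives and the `W^{1,p}` norm -/

section WeakPartial

variable {E : Type*} [NormedAddCommGroup E] [NormedSpace ℝ E] [MeasureSpace E]

theorem IsWeakPartial.congr_ae {v : E} {f f' g g' : E → ℝ} (h : IsWeakPartial v f g)
    (hf : f =ᵐ[volume] f') (hg : g =ᵐ[volume] g') : IsWeakPartial v f' g' := by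
  refine ⟨h.1.congr hf, h.2.1.congr hg, fun φ h1 h2 => ?_⟩
  have e1 : ∫ x, f' x * fderiv ℝ φ x v = ∫ x, f x * fderiv ℝ φ x v :=
    integral_congr_ae (by filter_upwards [hf] with x hx; rw [hx])
  have e2 : ∫ x, g' x * φ x = ∫ x, g x * φ x :=
    integral_congr_ae (by filter_upwards [hg] with x hx; rw [hx])
  rw [e1, e2]
  exact h.2.2 φ h1 h2

variable [BorelSpace E]

theorem IsWeakPartial.sub {v : E} {f f' g g' : E → ℝ} (h : IsWeakPartial v f g)
    (h' : IsWeakPartial v f' g') :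
    IsWeakPartial v (fun x => f x - f' x) (fun x => g x - g' x) := by
  refine ⟨h.1.sub h'.1, h.2.1.sub h'.2.1, fun φ h1 h2 => ?_⟩
  have c1 := continuous_fderiv_apply_of_contDiff h1 v
  have c2 := hasCompactSupport_fderiv_apply h2 v
  simp only [sub_mul]
  rw [integral_sub (integrable_mul_of_hasCompactSupport h.1 c1 c2)
    (integrable_mul_of_hasCompactSupport h'.1 c1 c2),
    integral_sub (integrable_mul_of_hasCompactSupport h.2.1 h1.continuous h2)
    (integrable_mul_of_hasCompactSupport h'.2.1 h1.continuous h2), h.2.2 φ h1 h2, h'.2.2 φ h1 h2]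
  ring

variable [FiniteDimensional ℝ E]

/-- The product rule for a weak derivative and a smooth function. -/
theorem IsWeakPartial.mul_contDiff {v : E} {f f' g : E → ℝ} (h : IsWeakPartial v f f')
    (hg : ContDiff ℝ ∞ g) :
    IsWeakPartial v (fun x => f x * g x) (fun x => f' x * g x + f x * fderiv ℝ g x v) := by
  have : ProperSpace E := FiniteDimensional.proper ℝ E
  have hg' := continuous_fderiv_apply_of_contDiff hg v
  refine ⟨h.1.mul_continuous hg.continuous, (h.2.1.mul_continuous hg.continuous).add
    (h.1.mul_continuous hg'), fun φ h1 h2 => ?_⟩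
  have c1 := continuous_fderiv_apply_of_contDiff h1 v
  have c2 := hasCompactSupport_fderiv_apply h2 v
  -- Testing `f` against `g φ` produces an extra term `f φ ∂_v g`, which is moved to the other side.
  have key := h.2.2 (fun x => g x * φ x) (hg.mul h1) h2.mul_left
  have hd : ∀ x, fderiv ℝ (fun x => g x * φ x) x v
      = g x * fderiv ℝ φ x v + φ x * fderiv ℝ g x v := by
    intro x
    rw [fderiv_fun_mul ((hg.differentiable (by simp)) x) ((h1.differentiable (by simp)) x)]
    simp
  simp only [hd] at key
  have i1 : Integrable fun x => f x * (g x * fderiv ℝ φ x v) :=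
    integrable_mul_of_hasCompactSupport h.1 (hg.continuous.mul c1) c2.mul_left
  have i2 : Integrable fun x => f x * (φ x * fderiv ℝ g x v) :=
    integrable_mul_of_hasCompactSupport h.1 (h1.continuous.mul hg') h2.mul_right
  have i3 : Integrable fun x => f' x * (g x * φ x) :=
    integrable_mul_of_hasCompactSupport h.2.1 (hg.continuous.mul h1.continuous) h2.mul_left
  simp only [mul_add] at key
  rw [integral_add i1 i2] at key
  have e1 : ∀ x, f x * g x * fderiv ℝ φ x v = f x * (g x * fderiv ℝ φ x v) := fun x => by ring
  have e2 : ∀ x, (f' x * g x + f x * fderiv ℝ g x v) * φ x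
      = f' x * (g x * φ x) + f x * (φ x * fderiv ℝ g x v) := fun x => by ring
  simp only [e1, e2]
  rw [integral_add i3 i2]
  linarith

variable {ι : Type*} [Fintype ι] {b : Module.Basis ι ℝ E} {p : ℝ}

/-- `weakPartial` is an arbitrary choice; uniqueness and linearity allow it to be replaced by the
difference of any given weak derivatives. -/
theorem normW1p_sub_eq (hp : 1 ≤ p) {f f' : E → ℝ} {g g' : ι → E → ℝ}
    (h : ∀ i, IsWeakPartial (b i) f (g i)) (h' : ∀ i, IsWeakPartial (b i) f' (g' i)) :
    normW1p p b (fun x => f x - f' x) = ((∫⁻ x, ‖f x - f' x‖ₑ ^ p)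
      + ∑ i, ∫⁻ x, ‖g i x - g' i x‖ₑ ^ p) ^ (1 / p) := by
  rw [normW1p, eLpNorm_ofReal_rpow hp]
  congr 2
  refine Finset.sum_congr rfl fun i _ => ?_
  have hs := (h i).sub (h' i)
  rw [eLpNorm_congr_ae ((isWeakPartial_weakPartial hs).ae_eq hs), eLpNorm_ofReal_rpow hp]

theorem tendsto_normW1p_sub_iff (hp : 1 ≤ p) {F : ℕ → E → ℝ} {f : E → ℝ} {D : ℕ → ι → E → ℝ}
    {g : ι → E → ℝ} (h : ∀ n i, IsWeakPartial (b i) (F n) (D n i))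
    (h' : ∀ i, IsWeakPartial (b i) f (g i)) :
    Tendsto (fun n => normW1p p b (fun x => F n x - f x)) atTop (𝓝 0) ↔
      Tendsto (fun n => ∫⁻ x, ‖F n x - f x‖ₑ ^ p) atTop (𝓝 0) ∧
        ∀ i, Tendsto (fun n => ∫⁻ x, ‖D n i x - g i x‖ₑ ^ p) atTop (𝓝 0) := by
  have hp0 : 0 < p := by linarith
  simp only [fun n => normW1p_sub_eq hp (h n) h']
  constructor
  · intro ht
    have h1 := (ENNReal.continuous_rpow_const (y := p)).tendsto _ |>.comp ht
    simp only [Function.comp_def, ← ENNReal.rpow_mul, one_div, inv_mul_cancel₀ hp0.ne',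
      ENNReal.rpow_one, ENNReal.zero_rpow_of_pos hp0] at h1
    refine ⟨tendsto_of_tendsto_of_tendsto_of_le_of_le tendsto_const_nhds h1 (fun _ => bot_le)
      fun n => le_self_add, fun i => tendsto_of_tendsto_of_tendsto_of_le_of_le tendsto_const_nhds h1
      (fun _ => bot_le) fun n => ?_⟩
    exact (Finset.single_le_sum (f := fun i => ∫⁻ x, ‖D n i x - g i x‖ₑ ^ p)
      (fun _ _ => bot_le) (Finset.mem_univ i)).trans le_add_self
  · rintro ⟨h1, h2⟩
    have h3 := h1.add (tendsto_finsetSum Finset.univ fun i _ => h2 i)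
    have h4 := (ENNReal.continuous_rpow_const (y := 1 / p)).tendsto _ |>.comp h3
    simpa [Function.comp_def, hp0] using h4

variable [IsLocallyFiniteMeasure (volume : Measure E)]

/-- Hölder's inequality: a continuous function with compact support lies in `L^q` for the conjugate
exponent, including `q = ∞` when `p = 1`. -/
theorem tendsto_integral_mul_of_tendsto_lintegral {p : ℝ} (hp : 1 ≤ p) {F : ℕ → E → ℝ} {f φ : E → ℝ}
    (hF : ∀ n, LocallyIntegrable (F n) volume) (hf : LocallyIntegrable f volume)
    (hφ : Continuous φ) (hc : HasCompactSupport φ)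
    (h : Tendsto (fun n => ∫⁻ x, ‖F n x - f x‖ₑ ^ p) atTop (𝓝 0)) :
    Tendsto (fun n => ∫ x, F n x * φ x) atTop (𝓝 (∫ x, f x * φ x)) := by
  have h' := (tendsto_eLpNorm_ofReal_iff hp).2 h
  have : (ENNReal.ofReal p).HolderConjugate (ENNReal.conjExponent (ENNReal.ofReal p)) :=
    ENNReal.HolderConjugate.conjExponent (one_le_ofReal hp)
  set q := ENNReal.conjExponent (ENNReal.ofReal p)
  have hφq : MemLp φ q volume := hφ.memLp_of_hasCompactSupport hc
  rw [tendsto_iff_edist_tendsto_0]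
  refine tendsto_of_tendsto_of_tendsto_of_le_of_le tendsto_const_nhds
    (h := fun n => eLpNorm (fun x => F n x - f x) (ENNReal.ofReal p) volume * eLpNorm φ q volume)
    ?_ (fun _ => bot_le) fun n => ?_
  · simpa using ENNReal.Tendsto.mul_const h' (Or.inr hφq.eLpNorm_ne_top)
  · rw [edist_eq_enorm_sub, ← integral_sub (integrable_mul_of_hasCompactSupport (hF n) hφ hc)
      (integrable_mul_of_hasCompactSupport hf hφ hc)]
    refine (enorm_integral_le_lintegral_enorm _).trans ?_
    have := eLpNorm_smul_le_mul_eLpNorm (p := ENNReal.ofReal p) (q := q) (r := 1)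
      hφq.aestronglyMeasurable
      ((hF n).aestronglyMeasurable.sub hf.aestronglyMeasurable)
    rw [eLpNorm_one_eq_lintegral_enorm] at this
    simpa [sub_mul, Pi.sub_def] using this

/-- Weak derivatives are closed under convergence in `L^p`. -/
theorem IsWeakPartial.of_tendsto {p : ℝ} (hp : 1 ≤ p) {v : E} {F D : ℕ → E → ℝ} {f g : E → ℝ}
    (h : ∀ n, IsWeakPartial v (F n) (D n)) (hf : LocallyIntegrable f volume)
    (hg : LocallyIntegrable g volume)
    (hF : Tendsto (fun n => ∫⁻ x, ‖F n x - f x‖ₑ ^ p) atTop (𝓝 0))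
    (hD : Tendsto (fun n => ∫⁻ x, ‖D n x - g x‖ₑ ^ p) atTop (𝓝 0)) : IsWeakPartial v f g := by
  refine ⟨hf, hg, fun φ h1 h2 => ?_⟩
  have t1 := tendsto_integral_mul_of_tendsto_lintegral hp (fun n => (h n).1) hf
    (continuous_fderiv_apply_of_contDiff h1 v) (hasCompactSupport_fderiv_apply h2 v) hF
  have t2 := tendsto_integral_mul_of_tendsto_lintegral hp (fun n => (h n).2.1) hg
    h1.continuous h2 hD
  simp only [fun n => (h n).2.2 φ h1 h2] at t1
  exact tendsto_nhds_unique t1 t2.neg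

end WeakPartial

/-! ### Tensor products of functions of one factor each -/

theorem insertNth_eq_single_add {E : Type*} [AddCommGroup E] {n : ℕ} (k : Fin (n + 1)) (x : E) (Z : Fin n → E) :
    (k.insertNth x Z : Fin (n + 1) → E) = Pi.single k x + k.insertNth (α := fun _ => E) 0 Z := by
  refine Fin.insertNth_eq_iff.2 ⟨by simp, ?_⟩
  ext l
  simp [Fin.removeNth]

theorem memLp_prod_eval {E : Type*} [MeasureSpace E] [SigmaFinite (volume : Measure E)]
    {p : ℝ} {N : ℕ} (hp : 1 ≤ p) {r : Fin N → E → ℝ}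
    (hr : ∀ l, MemLp (r l) (ENNReal.ofReal p) volume) :
    MemLp (fun X : Fin N → E => ∏ l, r l (X l)) (ENNReal.ofReal p) volume := by
  have hp0 : 0 < p := by linarith
  have hm : AEStronglyMeasurable (fun X : Fin N → E => ∏ l, r l (X l)) volume :=
    Finset.aestronglyMeasurable_fun_prod _ fun l _ =>
      (hr l).aestronglyMeasurable.comp_quasiMeasurePreserving
        (Measure.quasiMeasurePreserving_eval (fun _ => volume) l)
  rw [← integrable_norm_rpow_iff hm (by simpa using hp0) ENNReal.ofReal_ne_top,
    ENNReal.toReal_ofReal hp0.le]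
  have : ∀ X : Fin N → E, ‖∏ l, r l (X l)‖ ^ p = ∏ l, ‖r l (X l)‖ ^ p := fun X => by
    rw [norm_prod, Real.finsetProd_rpow _ _ fun _ _ => norm_nonneg _]
  simp only [this]
  refine Integrable.fintype_prod (μ := fun _ => volume) (f := fun l x => ‖r l x‖ ^ p) fun l => ?_
  have := (hr l).integrable_norm_rpow (by simpa using hp0) ENNReal.ofReal_ne_top
  rwa [ENNReal.toReal_ofReal hp0.le] at this

section Tensor

variable {E : Type*} [NormedAddCommGroup E] [NormedSpace ℝ E] [MeasureSpace E] [BorelSpace E]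
  [FiniteDimensional ℝ E] [(volume : Measure E).IsAddHaarMeasure] {p : ℝ}

/-- The weak derivative of a tensor product in one of its factors. -/
theorem isWeakPartial_prod_eval {N : ℕ} (hp : 1 ≤ p) {r : Fin N → E → ℝ} {s : E → ℝ} {k : Fin N}
    {v : E} (hr : ∀ l, MemLp (r l) (ENNReal.ofReal p) volume)
    (hs : MemLp s (ENNReal.ofReal p) volume) (h : IsWeakPartial v (r k) s) :
    IsWeakPartial (Pi.single k v) (fun X : Fin N → E => ∏ l, r l (X l))
      (fun X => ∏ l, Function.update r k s l (X l)) := by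
  have hl1 : LocallyIntegrable (fun X : Fin N → E => ∏ l, r l (X l)) volume :=
    (memLp_prod_eval hp hr).locallyIntegrable (one_le_ofReal hp)
  have hl2 : LocallyIntegrable (fun X : Fin N → E => ∏ l, Function.update r k s l (X l)) volume := by
    refine (memLp_prod_eval hp fun l => ?_).locallyIntegrable (one_le_ofReal hp)
    rcases eq_or_ne l k with rfl | hl
    · simpa using hs
    · simpa [hl] using hr l
  refine ⟨hl1, hl2, fun φ h1 h2 => ?_⟩
  have c1 := continuous_fderiv_apply_of_contDiff h1 (Pi.single k v)
  have c2 := hasCompactSupport_fderiv_apply h2 (Pi.single k v)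
  have i1 := integrable_mul_of_hasCompactSupport hl1 c1 c2
  have i2 := integrable_mul_of_hasCompactSupport hl2 h1.continuous h2
  obtain ⟨n, rfl⟩ : ∃ n, N = n + 1 := ⟨N - 1, by have := k.isLt; omega⟩
  have he := (volume_preserving_piFinSuccAbove (fun _ : Fin (n + 1) => E) k).symm
  have hfub : ∀ F : (Fin (n + 1) → E) → ℝ, Integrable F →
      ∫ X, F X = ∫ Z : Fin n → E, ∫ x : E, F (k.insertNth x Z) := by
    intro F hF
    rw [← he.integral_comp (MeasurableEquiv.measurableEmbedding _)]
    exact integral_prod_symm _ (he.integrable_comp_of_integrable hF)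
  rw [hfub _ i1, hfub _ i2, ← integral_neg]
  refine integral_congr_ae (Eventually.of_forall fun Z => ?_)
  obtain ⟨c, hins⟩ : ∃ c : Fin (n + 1) → E, ∀ x : E,
      (k.insertNth x Z : Fin (n + 1) → E) = Pi.single k x + c :=
    ⟨_, fun x => insertNth_eq_single_add k x Z⟩
  -- With the other coordinates `Z` frozen, `φ` is a test function of the `k`-th coordinate alone,
  -- since the insertion map is affine with linear part `Pi.single k`. The one-factor definition
  -- then applies on each slice.
  have hsm : ContDiff ℝ ∞ fun x : E => φ (k.insertNth x Z) := by
    simp only [hins]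
    exact h1.comp (((ContinuousLinearMap.single ℝ (fun _ => E) k).contDiff).add contDiff_const)
  have hcs : HasCompactSupport fun x : E => φ (k.insertNth x Z) := by
    refine HasCompactSupport.intro (h2.isCompact.image (continuous_apply k)) fun x hx => ?_
    by_contra hne
    exact hx ⟨_, subset_tsupport _ hne, by simp⟩
  have hder : ∀ x : E, fderiv ℝ (fun x : E => φ (k.insertNth x Z)) x v
      = fderiv ℝ φ (k.insertNth x Z) (Pi.single k v) := by
    intro x
    have hd1 : HasFDerivAt (fun x : E => (k.insertNth x Z : Fin (n + 1) → E))
        (ContinuousLinearMap.single ℝ (fun _ => E) k) x := by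
      simp only [hins]
      exact ((ContinuousLinearMap.single ℝ (fun _ => E) k).hasFDerivAt).add_const _
    have hd2 := ((h1.differentiable (by simp)) (k.insertNth x Z)).hasFDerivAt.comp x hd1
    have hd3 := hd2.fderiv
    simp only [Function.comp_def] at hd3
    rw [hd3]
    simp
  have key := h.2.2 _ hsm hcs
  simp only [hder] at key
  simp only [Fin.prod_univ_succAbove _ k, Fin.insertNth_apply_same, Fin.insertNth_apply_succAbove,
    Function.update_self, Function.update_of_ne (Fin.succAbove_ne k _)]
  have e : ∀ (u : E → ℝ) (t : E → ℝ), ∫ x, u x * (∏ l, r (k.succAbove l) (Z l)) * t x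
      = (∏ l, r (k.succAbove l) (Z l)) * ∫ x, u x * t x := by
    intro u t
    rw [← integral_const_mul]
    congr 1
    ext x
    ring
  rw [e, e, key]
  ring

end Tensor

/-! ### Tonelli's theorem and densities of product measures -/

section Product

variable {E : Type*} [MeasureSpace E] [SigmaFinite (volume : Measure E)]

theorem measurable_prod_eval {F : Type*} [MeasurableSpace F] {N : ℕ} {f : Fin N → F → ℝ≥0∞}
    (hf : ∀ l, Measurable (f l)) : Measurable fun X : Fin N → F => ∏ l, f l (X l) :=
  Finset.measurable_fun_prod _ fun l _ => (hf l).comp (measurable_pi_apply l)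

/-- **Tonelli's theorem** for a product of functions of one factor each. -/
theorem lintegral_prod_eval {N : ℕ} {f : Fin N → E → ℝ≥0∞} (hf : ∀ l, Measurable (f l)) :
    ∫⁻ X : Fin N → E, ∏ l, f l (X l) = ∏ l, ∫⁻ x, f l x := by
  induction N with
  | zero =>
    simp [volume_pi, Measure.pi_empty_univ]
  | succ n ih =>
    have he := (volume_preserving_piFinSuccAbove (fun _ : Fin (n + 1) => E) 0).symm
    rw [← he.lintegral_comp (measurable_prod_eval hf), Fin.prod_univ_succ, ← ih fun l => hf l.succ,
      ← lintegral_prod_mul (hf 0).aemeasurable (measurable_prod_eval fun l => hf l.succ).aemeasurable]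
    refine lintegral_congr fun q => ?_
    simp [Fin.prod_univ_succ]

theorem pi_withDensity {N : ℕ} {ρ : Fin N → Measure E} [∀ l, SigmaFinite (ρ l)]
    {f : Fin N → E → ℝ≥0∞} (hf : ∀ l, Measurable (f l))
    (hρ : ∀ l, ρ l = volume.withDensity (f l)) :
    Measure.pi ρ = volume.withDensity fun X => ∏ l, f l (X l) := by
  refine (Measure.pi_eq fun s hs => ?_)
  rw [withDensity_apply _ (MeasurableSet.univ_pi hs),
    ← lintegral_indicator (MeasurableSet.univ_pi hs)]
  have : ∀ X : Fin N → E, (Set.univ.pi s).indicator (fun X => ∏ l, f l (X l)) X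
      = ∏ l, (s l).indicator (f l) (X l) := by
    intro X
    by_cases hX : X ∈ Set.univ.pi s
    · rw [Set.indicator_of_mem hX]
      exact Finset.prod_congr rfl fun l _ => (Set.indicator_of_mem (hX l trivial) _).symm
    · rw [Set.indicator_of_notMem hX]
      obtain ⟨l, hl⟩ : ∃ l, X l ∉ s l := by simpa [Set.mem_pi] using hX
      exact (Finset.prod_eq_zero (Finset.mem_univ l) (Set.indicator_of_notMem hl _)).symm
  simp only [this]
  rw [lintegral_prod_eval fun l => (hf l).indicator (hs l)]
  refine Finset.prod_congr rfl fun l _ => ?_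
  rw [lintegral_indicator (hs l), hρ l, withDensity_apply _ (hs l)]

end Product

/-! ### Gaussian kernels, the density ratio and exact masses of the smoothed plan -/

section Gauss

variable {N d : ℕ} {ε : ℝ}

theorem gaussKernel_pos (hε : 0 < ε) (z : Space d) : 0 < gaussKernel ε z := by
  unfold gaussKernel
  have := Real.pi_pos
  positivity

theorem contDiff_gaussKernel : ContDiff ℝ ∞ (gaussKernel ε : Space d → ℝ) := by
  unfold gaussKernel
  exact contDiff_const.mul (Real.contDiff_exp.comp ((contDiff_norm_sq ℝ).neg.div_const _))

theorem integral_exp_neg_norm_sq_div {b : ℝ} (hb : 0 < b) :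
    ∫ z : Space d, Real.exp (-‖z‖ ^ 2 / b) = (Real.pi * b) ^ ((d : ℝ) / 2) := by
  have h := GaussianFourier.integral_rexp_neg_mul_sq_norm (V := Space d) (b := 1 / b)
    (by positivity)
  rw [finrank_euclideanSpace_fin, one_div, div_inv_eq_mul] at h
  rw [← h]
  congr 1
  ext z
  congr 1
  ring

theorem integrable_exp_neg_norm_sq_div {b : ℝ} (hb : 0 < b) :
    Integrable fun z : Space d => Real.exp (-‖z‖ ^ 2 / b) := by
  -- The integral of a non-integrable function is 0 by convention, so a nonzero value already proves
  -- integrability.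
  refine Integrable.of_integral_ne_zero ?_
  rw [integral_exp_neg_norm_sq_div hb]
  have := Real.pi_pos
  positivity

theorem lintegral_gaussKernel (hε : 0 < ε) :
    ∫⁻ z : Space d, ENNReal.ofReal (gaussKernel ε z) = 1 := by
  have hi : Integrable (gaussKernel ε : Space d → ℝ) := by
    unfold gaussKernel
    exact (integrable_exp_neg_norm_sq_div (by positivity)).const_mul _
  rw [← ofReal_integral_eq_lintegral_ofReal hi
    (Eventually.of_forall fun z => (gaussKernel_pos hε z).le)]
  have : ∫ z : Space d, gaussKernel ε z = 1 := by
    unfold gaussKernel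
    rw [integral_const_mul, integral_exp_neg_norm_sq_div (by positivity)]
    have := Real.pi_pos
    have h2 : Real.pi * (2 * ε) = 2 * Real.pi * ε := by ring
    rw [h2]
    field_simp
  rw [this, ENNReal.ofReal_one]

theorem lintegral_gaussKernel_sub_right (hε : 0 < ε) (x : Space d) :
    ∫⁻ y : Space d, ENNReal.ofReal (gaussKernel ε (y - x)) = 1 := by
  rw [lintegral_sub_right_eq_self fun z => ENNReal.ofReal (gaussKernel ε z)]
  exact lintegral_gaussKernel hε

/-- Polynomial factors are absorbed by half of the exponent of the Gaussian kernel. -/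
theorem exists_rpow_norm_mul_gaussKernel_le (hε : 0 < ε) {e : ℝ} (he : 0 ≤ e) :
    ∃ C : ℝ, 0 ≤ C ∧ ∀ z : Space d,
      ‖z‖ ^ e * gaussKernel ε z ≤ C * Real.exp (-‖z‖ ^ 2 / (4 * ε)) := by
  obtain ⟨n, hn⟩ := exists_nat_ge e
  have := Real.pi_pos
  -- For `e ≤ n` one has `t^e ≤ 1 + t^(2n)`, and the `n`-th term of the exponential series at `t² /
  -- (4ε)` bounds `t^(2n)` by `n! (4ε)^n exp(t² / (4ε))`.
  refine ⟨(1 + n.factorial * (4 * ε) ^ n) * (1 / (2 * Real.pi * ε) ^ ((d : ℝ) / 2)),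
    by positivity, fun z => ?_⟩
  set t := ‖z‖ with ht
  have ht0 : 0 ≤ t := norm_nonneg _
  have h1 : t ^ e ≤ (1 + n.factorial * (4 * ε) ^ n) * Real.exp (t ^ 2 / (4 * ε)) := by
    have h2 := Real.pow_div_factorial_le_exp (t ^ 2 / (4 * ε)) (by positivity) n
    have h3 : t ^ (2 * n) ≤ n.factorial * (4 * ε) ^ n * Real.exp (t ^ 2 / (4 * ε)) := by
      rw [div_pow, div_div, div_le_iff₀ (by positivity), ← pow_mul] at h2
      linarith
    have h4 : 1 ≤ Real.exp (t ^ 2 / (4 * ε)) := Real.one_le_exp (by positivity)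
    have h5 : t ^ e ≤ 1 + t ^ (2 * n) := by
      rcases le_total t 1 with h | h
      · exact (Real.rpow_le_one ht0 h he).trans (by simp; positivity)
      · have : t ^ e ≤ t ^ ((2 * n : ℕ) : ℝ) := by
          refine Real.rpow_le_rpow_of_exponent_le h ?_
          push_cast
          have : (0 : ℝ) ≤ n := Nat.cast_nonneg n
          linarith
        rw [Real.rpow_natCast] at this
        linarith
    linarith
  have h6 : Real.exp (t ^ 2 / (4 * ε)) * Real.exp (-t ^ 2 / (2 * ε))
      = Real.exp (-t ^ 2 / (4 * ε)) := by
    rw [← Real.exp_add]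
    congr 1
    field_simp
    ring
  unfold gaussKernel
  calc t ^ e * (1 / (2 * Real.pi * ε) ^ ((d : ℝ) / 2) * Real.exp (-t ^ 2 / (2 * ε)))
      ≤ ((1 + n.factorial * (4 * ε) ^ n) * Real.exp (t ^ 2 / (4 * ε)))
        * (1 / (2 * Real.pi * ε) ^ ((d : ℝ) / 2) * Real.exp (-t ^ 2 / (2 * ε))) := by gcongr
    _ = (1 + n.factorial * (4 * ε) ^ n) * (1 / (2 * Real.pi * ε) ^ ((d : ℝ) / 2))
        * (Real.exp (t ^ 2 / (4 * ε)) * Real.exp (-t ^ 2 / (2 * ε))) := by ring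
    _ = _ := by rw [h6]

theorem abs_coord_le (z : Space d) (i : Fin d) : |z i| ≤ ‖z‖ := by
  simpa using PiLp.norm_apply_le z i

theorem exists_abs_coord_rpow_mul_gaussKernel_le (hε : 0 < ε) {e : ℝ} (he : 0 ≤ e) (i : Fin d) :
    ∃ C : ℝ, 0 ≤ C ∧ ∀ z : Space d,
      |z i / ε| ^ e * gaussKernel ε z ≤ C * Real.exp (-‖z‖ ^ 2 / (4 * ε)) := by
  obtain ⟨C, hC, h⟩ := exists_rpow_norm_mul_gaussKernel_le (d := d) hε he
  refine ⟨(1 / ε) ^ e * C, by positivity, fun z => ?_⟩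
  have h1 : |z i / ε| ^ e ≤ (1 / ε) ^ e * ‖z‖ ^ e := by
    rw [← Real.mul_rpow (by positivity) (norm_nonneg _), abs_div, abs_of_pos hε]
    refine Real.rpow_le_rpow (by positivity) ?_ he
    rw [div_eq_mul_one_div, mul_comm]
    gcongr
    exact abs_coord_le z i
  calc |z i / ε| ^ e * gaussKernel ε z ≤ ((1 / ε) ^ e * ‖z‖ ^ e) * gaussKernel ε z := by
        have := (gaussKernel_pos hε z).le
        gcongr
    _ = (1 / ε) ^ e * (‖z‖ ^ e * gaussKernel ε z) := by ring
    _ ≤ (1 / ε) ^ e * (C * Real.exp (-‖z‖ ^ 2 / (4 * ε))) :=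
        mul_le_mul_of_nonneg_left (h z) (by positivity)
    _ = _ := by ring

theorem lintegral_abs_coord_rpow_mul_gaussKernel_ne_top (hε : 0 < ε) {e : ℝ} (he : 0 ≤ e)
    (i : Fin d) : ∫⁻ z : Space d, ENNReal.ofReal (|z i / ε| ^ e * gaussKernel ε z) ≠ ⊤ := by
  obtain ⟨C, hC, h⟩ := exists_abs_coord_rpow_mul_gaussKernel_le hε he i
  have hi : Integrable fun z : Space d => C * Real.exp (-‖z‖ ^ 2 / (4 * ε)) :=
    (integrable_exp_neg_norm_sq_div (by positivity)).const_mul _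
  refine ne_top_of_le_ne_top hi.lintegral_lt_top.ne (lintegral_mono fun z => ?_)
  exact ENNReal.ofReal_le_ofReal (h z)

theorem gaussKernel_le (hε : 0 < ε) :
    ∀ z : Space d, gaussKernel ε z ≤ 1 / (2 * Real.pi * ε) ^ ((d : ℝ) / 2) := by
  intro z
  unfold gaussKernel
  have := Real.pi_pos
  refine mul_le_of_le_one_right (by positivity) (Real.exp_le_one_iff.2 ?_)
  rw [neg_div]
  exact neg_nonpos.2 (by positivity)

/-- The product kernel `∏ₖ η^ε(yₖ - xₖ)`. -/
noncomputable def gaussProd (ε : ℝ) (X Y : Config N d) : ℝ := ∏ k, gaussKernel ε (Y k - X k)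

theorem gaussProd_pos (hε : 0 < ε) (X Y : Config N d) : 0 < gaussProd ε X Y :=
  Finset.prod_pos fun _ _ => gaussKernel_pos hε _

theorem gaussProd_le (hε : 0 < ε) (X Y : Config N d) :
    gaussProd ε X Y ≤ (1 / (2 * Real.pi * ε) ^ ((d : ℝ) / 2)) ^ N := by
  unfold gaussProd
  refine (Finset.prod_le_prod (fun k _ => (gaussKernel_pos hε _).le)
    fun k _ => gaussKernel_le hε _).trans ?_
  simp

theorem contDiff_gaussProd : ContDiff ℝ ∞ fun q : Config N d × Config N d =>
    gaussProd ε q.1 q.2 := by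
  unfold gaussProd
  exact contDiff_prod fun k _ => contDiff_gaussKernel.comp
    (((contDiff_apply ℝ (Space d) k).comp contDiff_snd).sub
      ((contDiff_apply ℝ (Space d) k).comp contDiff_fst))

theorem continuous_gaussProd : Continuous fun q : Config N d × Config N d =>
    gaussProd ε q.1 q.2 := contDiff_gaussProd.continuous

theorem continuous_gaussProd_left (Y : Config N d) : Continuous fun X => gaussProd ε X Y :=
  continuous_gaussProd.comp (g := fun q : Config N d × Config N d => gaussProd ε q.1 q.2)
    (f := fun X => (X, Y)) (continuous_id.prodMk continuous_const)

theorem measurable_gaussProd : Measurable (Function.uncurry (gaussProd ε : Config N d → _)) :=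
  continuous_gaussProd.measurable

variable {μ : Measure (Config N d)} [IsProbabilityMeasure μ]

theorem integrable_gaussKernel_sub (hε : 0 < ε) (ρ : Measure (Space d)) [IsFiniteMeasure ρ]
    (y : Space d) : Integrable (fun x => gaussKernel ε (y - x)) ρ := by
  refine Integrable.of_bound (C := 1 / (2 * Real.pi * ε) ^ ((d : ℝ) / 2))
    ((continuous_gaussKernel ε).comp (by fun_prop)).aestronglyMeasurable
    (Eventually.of_forall fun x => ?_)
  rw [Real.norm_of_nonneg (gaussKernel_pos hε _).le]
  exact gaussKernel_le hε _

theorem integrable_gaussProd (hε : 0 < ε) (Y : Config N d) :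
    Integrable (fun X => gaussProd ε X Y) μ := by
  refine Integrable.of_bound (C := (1 / (2 * Real.pi * ε) ^ ((d : ℝ) / 2)) ^ N)
    (continuous_gaussProd_left Y).aestronglyMeasurable
    (Eventually.of_forall fun X => ?_)
  rw [Real.norm_of_nonneg (gaussProd_pos hε _ _).le]
  exact gaussProd_le hε _ _

theorem convDensity_pos (hε : 0 < ε) (ρ : Measure (Space d)) [IsProbabilityMeasure ρ]
    (y : Space d) : 0 < convDensity ε ρ y := by
  rw [convDensity, integral_pos_iff_support_of_nonneg (fun _ => (gaussKernel_pos hε _).le)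
    (integrable_gaussKernel_sub hε ρ y)]
  have : (Function.support fun x => gaussKernel ε (y - x)) = Set.univ :=
    Set.eq_univ_of_forall fun _ => (gaussKernel_pos hε _).ne'
  rw [this]
  simp

theorem ofReal_convDensity (hε : 0 < ε) (ρ : Measure (Space d)) [IsProbabilityMeasure ρ]
    (y : Space d) :
    ENNReal.ofReal (convDensity ε ρ y) = ∫⁻ x, ENNReal.ofReal (gaussKernel ε (y - x)) ∂ρ :=
  ofReal_integral_eq_lintegral_ofReal (integrable_gaussKernel_sub hε ρ y)
    (Eventually.of_forall fun _ => (gaussKernel_pos hε _).le)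

theorem lambdaDensity_eq (μ : Measure (Config N d)) (Y : Config N d) :
    lambdaDensity ε μ Y = ∫ X, gaussProd ε X Y ∂μ := rfl

theorem lambdaDensity_pos (hε : 0 < ε) (Y : Config N d) : 0 < lambdaDensity ε μ Y := by
  rw [lambdaDensity_eq, integral_pos_iff_support_of_nonneg (fun _ => (gaussProd_pos hε _ _).le)
    (integrable_gaussProd hε Y)]
  have : (Function.support fun X => gaussProd ε X Y) = Set.univ :=
    Set.eq_univ_of_forall fun _ => (gaussProd_pos hε _ _).ne'
  rw [this]
  simp

theorem ofReal_lambdaDensity (hε : 0 < ε) (Y : Config N d) :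
    ENNReal.ofReal (lambdaDensity ε μ Y) = ∫⁻ X, ENNReal.ofReal (gaussProd ε X Y) ∂μ :=
  ofReal_integral_eq_lintegral_ofReal (integrable_gaussProd hε Y)
    (Eventually.of_forall fun _ => (gaussProd_pos hε _ _).le)

theorem measurable_lambdaDensity : Measurable (lambdaDensity ε μ) := by
  have h : StronglyMeasurable fun q : Config N d × Config N d => gaussProd ε q.2 q.1 :=
    (continuous_gaussProd.comp (g := fun q : Config N d × Config N d => gaussProd ε q.1 q.2)
      continuous_swap).stronglyMeasurable
  exact (h.integral_prod_right (ν := μ)).measurable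

/-- The density of `Λ^ε[μ]` relative to the product of the smoothed marginals. -/
noncomputable def planRatio (ε : ℝ) (μ : Measure (Config N d)) (Y : Config N d) : ℝ :=
  lambdaDensity ε μ Y / ∏ k, convDensity ε (marginal μ k) (Y k)

/-- Collects all the denominators of the kernel into a factor that depends on `Y` alone, so that the
dependence on `X` is purely Gaussian and smooth. -/
theorem gaussProd_mul_planRatio (μ : Measure (Config N d)) (X Y : Config N d) :
    gaussProd ε X Y * planRatio ε μ Y = lambdaDensity ε μ Y * thetaKernel ε μ Y X := by
  rw [gaussProd, planRatio, thetaKernel, Finset.prod_div_distrib]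
  ring

theorem planRatio_pos (hε : 0 < ε) (Y : Config N d) : 0 < planRatio ε μ Y :=
  div_pos (lambdaDensity_pos hε Y) (Finset.prod_pos fun _ _ => convDensity_pos hε _ _)

theorem measurable_planRatio : Measurable (planRatio ε μ) := by
  unfold planRatio
  refine measurable_lambdaDensity.div (Finset.measurable_fun_prod _ fun k _ => ?_)
  exact (measurable_convDensity ε _).comp (measurable_pi_apply k)

theorem ofReal_planRatio (hε : 0 < ε) (Y : Config N d) :
    ENNReal.ofReal (planRatio ε μ Y) = (∫⁻ X, ENNReal.ofReal (gaussProd ε X Y) ∂μ)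
      * ∏ k, (ENNReal.ofReal (convDensity ε (marginal μ k) (Y k)))⁻¹ := by
  rw [planRatio, ENNReal.ofReal_div_of_pos (Finset.prod_pos fun _ _ => convDensity_pos hε _ _),
    ofReal_lambdaDensity hε, ENNReal.ofReal_prod_of_nonneg fun k _ => (convDensity_pos hε _ _).le,
    div_eq_mul_inv, ENNReal.prod_inv_distrib]
  intro i _ j _ _
  exact Or.inl (by simpa using convDensity_pos hε _ _)

/-- The mass of the smoothed plan with a weight that is a product over the coordinates. -/
theorem lintegral_prod_mul_gaussProd_mul_planRatio (hε : 0 < ε)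
    {h : Fin N → Space d → Space d → ℝ≥0∞} (hh : ∀ l, Measurable (Function.uncurry (h l))) :
    ∫⁻ X : Config N d, ∫⁻ Y : Config N d, (∏ l, h l (X l) (Y l))
        * ENNReal.ofReal (gaussProd ε X Y * planRatio ε μ Y)
      = ∫⁻ Z, ∏ l, (∫⁻ y, (∫⁻ x, h l x y * ENNReal.ofReal (gaussKernel ε (y - x)))
        * (ENNReal.ofReal (convDensity ε (marginal μ l) y))⁻¹
        * ENNReal.ofReal (gaussKernel ε (y - Z l))) ∂μ := by
  have hgm : Measurable fun q : Space d × Space d => ENNReal.ofReal (gaussKernel ε (q.2 - q.1)) :=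
    (((continuous_gaussKernel ε).comp (by fun_prop)).measurable).ennreal_ofReal
  have hgm' : ∀ x : Space d, Measurable fun y => ENNReal.ofReal (gaussKernel ε (y - x)) :=
    fun x => ((continuous_gaussKernel ε).comp (by fun_prop)).measurable.ennreal_ofReal
  have hhm : ∀ l, Measurable fun q : Space d × Space d => h l q.1 q.2 := hh
  have hS : ∀ l, Measurable fun y => ∫⁻ x, h l x y * ENNReal.ofReal (gaussKernel ε (y - x)) :=
    fun l => ((hhm l).mul hgm).lintegral_prod_left'
  have hmm : ∀ l, Measurable fun y => (ENNReal.ofReal (convDensity ε (marginal μ l) y))⁻¹ :=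
    fun l => (measurable_convDensity ε _).ennreal_ofReal.inv
  have hprod : ∀ X Y : Config N d, ENNReal.ofReal (gaussProd ε X Y)
      = ∏ l, ENNReal.ofReal (gaussKernel ε (Y l - X l)) := fun X Y =>
    ENNReal.ofReal_prod_of_nonneg fun l _ => (gaussKernel_pos hε _).le
  rw [lintegral_lintegral_swap]
  swap
  · refine Measurable.aemeasurable (Measurable.mul ?_ ?_)
    · refine Finset.measurable_fun_prod _ fun l _ => ?_
      exact (hhm l).comp (by fun_prop : Measurable fun q : Config N d × Config N d =>
        (q.1 l, q.2 l))
    · exact (measurable_gaussProd.mul (measurable_planRatio.comp measurable_snd)).ennreal_ofReal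
  -- For fixed `Y` the integral over `X` factorizes. Writing `lambdaDensity` as an integral over `Z`
  -- against `μ` confines the correlations of the plan to `Z`, so after a second interchange the
  -- integral over `Y` factorizes as well.
  have step : ∀ Y : Config N d, ∫⁻ X : Config N d, (∏ l, h l (X l) (Y l))
      * ENNReal.ofReal (gaussProd ε X Y * planRatio ε μ Y)
      = ∫⁻ Z, ∏ l, (∫⁻ x, h l x (Y l) * ENNReal.ofReal (gaussKernel ε (Y l - x)))
        * (ENNReal.ofReal (convDensity ε (marginal μ l) (Y l)))⁻¹
        * ENNReal.ofReal (gaussKernel ε (Y l - Z l)) ∂μ := by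
    intro Y
    have e1 : ∀ X : Config N d, (∏ l, h l (X l) (Y l))
        * ENNReal.ofReal (gaussProd ε X Y * planRatio ε μ Y)
        = (∏ l, (h l (X l) (Y l) * ENNReal.ofReal (gaussKernel ε (Y l - X l))))
          * ENNReal.ofReal (planRatio ε μ Y) := by
      intro X
      rw [ENNReal.ofReal_mul (gaussProd_pos hε _ _).le, hprod, Finset.prod_mul_distrib, mul_assoc]
    simp only [e1]
    have m1 : ∀ l, Measurable fun x => h l x (Y l) * ENNReal.ofReal (gaussKernel ε (Y l - x)) :=
      fun l => ((hhm l).mul hgm).comp (by fun_prop : Measurable fun x => (x, Y l))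
    rw [lintegral_mul_const _ (measurable_prod_eval m1), lintegral_prod_eval m1, ofReal_planRatio hε,
      mul_left_comm, ← Finset.prod_mul_distrib, mul_comm, ← lintegral_const_mul]
    · simp only [hprod, ← Finset.prod_mul_distrib]
    · exact (continuous_gaussProd_left Y).measurable.ennreal_ofReal
  simp only [step]
  rw [lintegral_lintegral_swap]
  · refine lintegral_congr fun Z => ?_
    exact lintegral_prod_eval (f := fun l y =>
      (∫⁻ x, h l x y * ENNReal.ofReal (gaussKernel ε (y - x)))
        * (ENNReal.ofReal (convDensity ε (marginal μ l) y))⁻¹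
        * ENNReal.ofReal (gaussKernel ε (y - Z l)))
      fun l => ((hS l).mul (hmm l)).mul (hgm' _)
  · refine Measurable.aemeasurable (Finset.measurable_fun_prod _ fun l _ => ?_)
    refine Measurable.mul (((hS l).mul (hmm l)).comp
      (by fun_prop : Measurable fun q : Config N d × Config N d => q.1 l)) ?_
    exact ((continuous_gaussKernel ε).comp (by fun_prop : Continuous
      fun q : Config N d × Config N d => q.1 l - q.2 l)).measurable.ennreal_ofReal

variable {ρ : Fin N → Space d → ℝ≥0∞}

theorem lintegral_density_mul_gaussKernel (hε : 0 < ε) (hρ : ∀ l, Measurable (ρ l))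
    (hm : ∀ l, marginal μ l = volume.withDensity (ρ l)) (l : Fin N) (y : Space d) :
    ∫⁻ x, ρ l x * ENNReal.ofReal (gaussKernel ε (y - x))
      = ENNReal.ofReal (convDensity ε (marginal μ l) y) := by
  rw [ofReal_convDensity hε, hm l, lintegral_withDensity_eq_lintegral_mul _ (hρ l)]
  · rfl
  · exact ((continuous_gaussKernel ε).comp (by fun_prop)).measurable.ennreal_ofReal

/-- With the density of the marginal as weight, the inner integral is exactly the smoothed marginal.
It cancels its inverse and leaves a Gaussian of mass 1, so every coordinate with an unaltered weight
drops out. -/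
theorem lintegral_lintegral_density_mul_gaussKernel (hε : 0 < ε) (hρ : ∀ l, Measurable (ρ l))
    (hm : ∀ l, marginal μ l = volume.withDensity (ρ l)) (l : Fin N) (z : Space d) :
    ∫⁻ y, (∫⁻ x, ρ l x * ENNReal.ofReal (gaussKernel ε (y - x)))
        * (ENNReal.ofReal (convDensity ε (marginal μ l) y))⁻¹
        * ENNReal.ofReal (gaussKernel ε (y - z)) = 1 := by
  rw [← lintegral_gaussKernel_sub_right hε z]
  refine lintegral_congr fun y => ?_
  rw [lintegral_density_mul_gaussKernel hε hρ hm, ENNReal.mul_inv_cancel _ ENNReal.ofReal_ne_top,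
    one_mul]
  simpa using convDensity_pos hε _ _

theorem lintegral_density_mul_gaussProd_mul_planRatio (hε : 0 < ε) (hρ : ∀ l, Measurable (ρ l))
    (hm : ∀ l, marginal μ l = volume.withDensity (ρ l)) :
    ∫⁻ X : Config N d, ∫⁻ Y : Config N d, (∏ l, ρ l (X l))
        * ENNReal.ofReal (gaussProd ε X Y * planRatio ε μ Y) = 1 := by
  have := lintegral_prod_mul_gaussProd_mul_planRatio (μ := μ) hε (h := fun l x _ => ρ l x)
    fun l => (hρ l).comp measurable_fst
  simp only [this, lintegral_lintegral_density_mul_gaussKernel hε hρ hm]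
  simp

/-- The mass of the smoothed plan with one density replaced by a weight in that coordinate. -/
theorem lintegral_update_mul_gaussProd_mul_planRatio (hε : 0 < ε) (hρ : ∀ l, Measurable (ρ l))
    (hm : ∀ l, marginal μ l = volume.withDensity (ρ l)) (k : Fin N)
    {h : Space d → Space d → ℝ≥0∞} (hh : Measurable (Function.uncurry h)) :
    ∫⁻ X : Config N d, ∫⁻ Y : Config N d,
        (∏ l, Function.update (fun l x _ => ρ l x) k h l (X l) (Y l))
        * ENNReal.ofReal (gaussProd ε X Y * planRatio ε μ Y)
      = ∫⁻ y, ∫⁻ x, h x y * ENNReal.ofReal (gaussKernel ε (y - x)) := by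
  have hgm : Measurable fun q : Space d × Space d => ENNReal.ofReal (gaussKernel ε (q.2 - q.1)) :=
    (((continuous_gaussKernel ε).comp (by fun_prop)).measurable).ennreal_ofReal
  have hS : Measurable fun y => ∫⁻ x, h x y * ENNReal.ofReal (gaussKernel ε (y - x)) :=
    (Measurable.mul (f := fun q : Space d × Space d => h q.1 q.2) hh hgm).lintegral_prod_left'
  have hmm : Measurable fun y => (ENNReal.ofReal (convDensity ε (marginal μ k) y))⁻¹ :=
    (measurable_convDensity ε _).ennreal_ofReal.inv
  rw [lintegral_prod_mul_gaussProd_mul_planRatio hε]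
  swap
  · intro l
    rcases eq_or_ne l k with rfl | hl
    · simpa using hh
    · simp only [Function.update_of_ne hl]
      exact (hρ l).comp measurable_fst
  have e1 : ∀ Z : Config N d, ∏ l,
      (∫⁻ y, (∫⁻ x, Function.update (fun l x _ => ρ l x) k h l x y
          * ENNReal.ofReal (gaussKernel ε (y - x)))
        * (ENNReal.ofReal (convDensity ε (marginal μ l) y))⁻¹
        * ENNReal.ofReal (gaussKernel ε (y - Z l)))
      = ∫⁻ y, (∫⁻ x, h x y * ENNReal.ofReal (gaussKernel ε (y - x)))
        * (ENNReal.ofReal (convDensity ε (marginal μ k) y))⁻¹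
        * ENNReal.ofReal (gaussKernel ε (y - Z k)) := by
    intro Z
    rw [Finset.prod_eq_single k]
    · simp
    · intro l _ hl
      simp only [Function.update_of_ne hl]
      exact lintegral_lintegral_density_mul_gaussKernel hε hρ hm l _
    · simp
  simp only [e1]
  have hT : Measurable fun q : Space d × Space d =>
      (∫⁻ x, h x q.2 * ENNReal.ofReal (gaussKernel ε (q.2 - x)))
        * (ENNReal.ofReal (convDensity ε (marginal μ k) q.2))⁻¹
        * ENNReal.ofReal (gaussKernel ε (q.2 - q.1)) :=
    ((hS.mul hmm).comp measurable_snd).mul hgm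
  rw [← lintegral_map (μ := μ) (g := fun X : Config N d => X k)
    (f := fun z => ∫⁻ y, (∫⁻ x, h x y * ENNReal.ofReal (gaussKernel ε (y - x)))
        * (ENNReal.ofReal (convDensity ε (marginal μ k) y))⁻¹
        * ENNReal.ofReal (gaussKernel ε (y - z))) hT.lintegral_prod_right' (measurable_pi_apply k)]
  -- Only `Z k` remains, so just the `k`-th marginal is seen. Integrating the Gaussian in `z`
  -- against it gives the smoothed marginal, which cancels the remaining inverse.
  change ∫⁻ z, _ ∂(marginal μ k) = _
  rw [lintegral_lintegral_swap hT.aemeasurable]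
  refine lintegral_congr fun y => ?_
  rw [lintegral_const_mul _ (show Measurable fun x => ENNReal.ofReal (gaussKernel ε (y - x)) from
      ((continuous_gaussKernel ε).comp (by fun_prop)).measurable.ennreal_ofReal),
    ← ofReal_convDensity hε, mul_assoc, ENNReal.inv_mul_cancel _ ENNReal.ofReal_ne_top, mul_one]
  simpa using convDensity_pos hε _ _

end Gauss

/-! ### Smoothness of the kernel factor for weights of bounded support -/

section Truncated

variable {N d : ℕ} {ε : ℝ} {q : Config N d → ℝ}

/-- The weight `(yₖ - xₖ)ᵢ / ε`, the logarithmic derivative of the product kernel. -/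
noncomputable def coordWeight (ε : ℝ) (k : Fin N) (i : Fin d) (X Y : Config N d) : ℝ :=
  (Y k - X k) i / ε

theorem continuous_coordWeight (k : Fin N) (i : Fin d) :
    Continuous (Function.uncurry (coordWeight ε k i : Config N d → _)) := by
  unfold coordWeight
  simp only [Function.uncurry_def]
  fun_prop

theorem measurable_coordWeight (k : Fin N) (i : Fin d) :
    Measurable (Function.uncurry (coordWeight ε k i : Config N d → _)) :=
  (continuous_coordWeight k i).measurable

/-- The integral is a convolution of `q`, evaluated at the fixed point 0, with a kernel depending
smoothly on the parameter `X`; smoothness in the parameter is inherited. -/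
theorem contDiff_integral_gaussProd_mul {R : ℝ} (hR : 0 ≤ R) (hq : Integrable q)
    (hq0 : ∀ Y, Y ∉ Metric.closedBall 0 R → q Y = 0) :
    ContDiff ℝ ∞ fun X : Config N d => ∫ Y, gaussProd ε X Y * q Y := by
  -- The bump is 1 where `q` may be nonzero, so it does not change the integral, but it gives the
  -- kernel compact support. The inner radius is `R + 1` because it must be positive even if `R =
  -- 0`.
  let χ : ContDiffBump (0 : Config N d) := ⟨R + 1, R + 2, by linarith, by linarith⟩
  let g : Config N d → Config N d → ℝ := fun X t => χ t * gaussProd ε X (-t)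
  have hg : ContDiff ℝ ∞ (Function.uncurry g) := by
    refine (χ.contDiff.comp contDiff_snd).mul ?_
    exact contDiff_gaussProd.comp (g := fun q : Config N d × Config N d => gaussProd ε q.1 q.2)
      (f := fun q : Config N d × Config N d => (q.1, -q.2)) (contDiff_fst.prodMk contDiff_snd.neg)
  have h := contDiffOn_convolution_right_with_param_comp (𝕜 := ℝ) (n := ⊤) (μ := volume)
    (ContinuousLinearMap.mul ℝ ℝ) (s := Set.univ) (v := fun _ : Config N d => (0 : Config N d))
    (f := q) (g := g) (k := tsupport χ) contDiffOn_const isOpen_univ χ.hasCompactSupport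
    (fun X t _ ht => by simp [g, image_eq_zero_of_notMem_tsupport ht]) hq.locallyIntegrable
    hg.contDiffOn
  convert contDiffOn_univ.1 h using 2 with X
  rw [convolution_def]
  refine integral_congr_ae (Eventually.of_forall fun Y => ?_)
  simp only [ContinuousLinearMap.mul_apply', zero_sub, g, neg_neg]
  by_cases hY : Y ∈ Metric.closedBall (0 : Config N d) R
  · rw [χ.one_of_mem_closedBall]
    · ring
    · have h2 : ‖Y‖ ≤ R := by simpa using hY
      have h3 : ‖Y‖ ≤ R + 1 := by linarith
      simpa using h3
  · rw [hq0 Y hY]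
    ring

/-- The unit vector of `(ℝ^d)^N` in the direction of the `i`-th coordinate of the `k`-th factor. -/
noncomputable def unitVec (k : Fin N) (i : Fin d) : Config N d := Pi.single k (stdBasis d i)

theorem hasDerivAt_gaussKernel_sub_smul (z : Space d) (i : Fin d) (t : ℝ) :
    HasDerivAt (fun t : ℝ => gaussKernel ε (z - t • stdBasis d i))
      ((z - t • stdBasis d i) i / ε * gaussKernel ε (z - t • stdBasis d i)) t := by
  have h1 : HasDerivAt (fun t : ℝ => z - t • stdBasis d i) (-stdBasis d i) t := by
    simpa using ((hasDerivAt_id t).smul_const (stdBasis d i)).const_sub z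
  have h2 := (h1.norm_sq.neg.div_const (2 * ε)).exp.const_mul
    (1 / (2 * Real.pi * ε) ^ ((d : ℝ) / 2))
  have h3 : inner ℝ (z - t • stdBasis d i) (-stdBasis d i) = -(z - t • stdBasis d i) i := by
    rw [inner_neg_right, stdBasis, OrthonormalBasis.coe_toBasis, EuclideanSpace.basisFun_apply,
      EuclideanSpace.inner_single_right]
    simp
  refine h2.congr_deriv ?_
  rw [h3]
  unfold gaussKernel
  simp only [Pi.neg_apply]
  ring

theorem hasDerivAt_gaussProd_add_smul (k : Fin N) (i : Fin d) (X Y : Config N d) (t : ℝ) :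
    HasDerivAt (fun t : ℝ => gaussProd ε (X + t • unitVec k i) Y)
      (coordWeight ε k i (X + t • unitVec k i) Y
        * gaussProd ε (X + t • unitVec k i) Y) t := by
  have e1 : ∀ t : ℝ, gaussProd ε (X + t • unitVec k i) Y
      = gaussKernel ε ((Y k - X k) - t • stdBasis d i)
        * ∏ l ∈ Finset.univ.erase k, gaussKernel ε (Y l - X l) := by
    intro t
    rw [gaussProd, ← Finset.mul_prod_erase _ _ (Finset.mem_univ k)]
    congr 1
    · simp [sub_sub, unitVec]
    · refine Finset.prod_congr rfl fun l hl => ?_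
      simp [unitVec, Finset.ne_of_mem_erase hl]
  have e2 : coordWeight ε k i (X + t • unitVec k i) Y
      = ((Y k - X k) - t • stdBasis d i) i / ε := by
    simp [coordWeight, sub_sub, unitVec]
  simp only [e1, e2]
  have := (hasDerivAt_gaussKernel_sub_smul (ε := ε) (Y k - X k) i t).mul_const
    (∏ l ∈ Finset.univ.erase k, gaussKernel ε (Y l - X l))
  rwa [mul_assoc] at this

theorem exists_abs_coordWeight_mul_gaussProd_le (hε : 0 < ε) (k : Fin N) (i : Fin d) :
    ∃ C : ℝ, ∀ X Y : Config N d, |coordWeight ε k i X Y * gaussProd ε X Y| ≤ C := by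
  obtain ⟨C, hC, h⟩ := exists_abs_coord_rpow_mul_gaussKernel_le (d := d) hε zero_le_one i
  set M := 1 / (2 * Real.pi * ε) ^ ((d : ℝ) / 2)
  refine ⟨C * ∏ _l ∈ (Finset.univ : Finset (Fin N)).erase k, M, fun X Y => ?_⟩
  rw [abs_mul, abs_of_pos (gaussProd_pos hε X Y), gaussProd,
    ← Finset.mul_prod_erase _ _ (Finset.mem_univ k), ← mul_assoc]
  refine mul_le_mul ?_ (Finset.prod_le_prod (fun l _ => (gaussKernel_pos hε _).le)
    fun l _ => gaussKernel_le hε _) (Finset.prod_nonneg fun l _ => (gaussKernel_pos hε _).le) hC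
  have h1 := h (Y k - X k)
  rw [Real.rpow_one] at h1
  refine h1.trans (mul_le_of_le_one_right hC (Real.exp_le_one_iff.2 ?_))
  rw [neg_div]
  exact neg_nonpos.2 (by positivity)

theorem fderiv_integral_gaussProd_mul (hε : 0 < ε) {R : ℝ} (hR : 0 ≤ R) (hq : Integrable q)
    (hq0 : ∀ Y, Y ∉ Metric.closedBall 0 R → q Y = 0) (k : Fin N) (i : Fin d) (X : Config N d) :
    fderiv ℝ (fun X : Config N d => ∫ Y, gaussProd ε X Y * q Y) X (unitVec k i)
      = ∫ Y, coordWeight ε k i X Y * (gaussProd ε X Y * q Y) := by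
  have hd := ((contDiff_integral_gaussProd_mul (ε := ε) hR hq hq0).differentiable (by simp)) X
  obtain ⟨C, hC⟩ := exists_abs_coordWeight_mul_gaussProd_le hε k i
  -- Differentiability is already known, so differentiating under the integral along a single line
  -- suffices; the dominating function is a constant times `|q|`.
  rw [← hd.lineDeriv_eq_fderiv]
  refine HasDerivAt.deriv ?_
  have hmeas : ∀ X : Config N d, AEStronglyMeasurable (fun Y => gaussProd ε X Y) volume :=
    fun X => (continuous_gaussProd.comp (g := fun q : Config N d × Config N d => gaussProd ε q.1 q.2)
      (f := fun Y => (X, Y)) (continuous_const.prodMk continuous_id)).aestronglyMeasurable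
  have hmeas' : AEStronglyMeasurable (fun Y => coordWeight ε k i X Y) volume :=
    ((continuous_coordWeight k i).comp (g := Function.uncurry (coordWeight ε k i))
      (f := fun Y => (X, Y)) (continuous_const.prodMk continuous_id)).aestronglyMeasurable
  have h := hasDerivAt_integral_of_dominated_loc_of_deriv_le (μ := volume) (x₀ := (0 : ℝ))
    (s := Set.univ)
    (F := fun t Y => gaussProd ε (X + t • unitVec k i) Y * q Y)
    (F' := fun t Y => coordWeight ε k i (X + t • unitVec k i) Y
        * gaussProd ε (X + t • unitVec k i) Y * q Y)
    (bound := fun Y => C * |q Y|) univ_mem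
    (Eventually.of_forall fun t => (hmeas _).mul hq.aestronglyMeasurable)
    (by
      refine hq.bdd_mul (c := (1 / (2 * Real.pi * ε) ^ ((d : ℝ) / 2)) ^ N) (hmeas _)
        (Eventually.of_forall fun Y => ?_)
      rw [Real.norm_of_nonneg (gaussProd_pos hε _ _).le]
      exact gaussProd_le hε _ _)
    (by
      simp only [zero_smul, add_zero]
      exact (hmeas'.mul (hmeas X)).mul hq.aestronglyMeasurable)
    (Eventually.of_forall fun Y t _ => by
      rw [norm_mul, Real.norm_eq_abs, Real.norm_eq_abs]
      exact mul_le_mul_of_nonneg_right (hC _ _) (abs_nonneg _))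
    (hq.abs.const_mul C)
    (Eventually.of_forall fun Y t _ => (hasDerivAt_gaussProd_add_smul k i X Y t).mul_const _)
  have h2 := h.2
  simp only [zero_smul, add_zero, mul_assoc] at h2
  exact h2

end Truncated

/-! ### The root of the plan density and its formal derivative -/

section RootPlan

variable {N d : ℕ} {p ε : ℝ} {r : Fin N → Space d → ℝ} {q : Config N d → ℝ}

/-- The function `∏ₗ rₗ(xₗ) · (∫ ∏ₖ η^ε(yₖ - xₖ) q(Y) dY)^{1/p}`. -/
noncomputable def rootPlan (p ε : ℝ) (r : Fin N → Space d → ℝ) (q : Config N d → ℝ)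
    (X : Config N d) : ℝ :=
  (∏ l, r l (X l)) * (∫ Y, gaussProd ε X Y * q Y) ^ (1 / p)

/-- The part of the derivative of `rootPlan` that comes from the second factor, up to `1 / p`. -/
noncomputable def rootPlanKernelDeriv (p ε : ℝ) (r : Fin N → Space d → ℝ) (q : Config N d → ℝ)
    (k : Fin N) (i : Fin d) (X : Config N d) : ℝ :=
  (∏ l, r l (X l)) * ((∫ Y, gaussProd ε X Y * q Y) ^ (1 / p - 1)
    * ∫ Y, coordWeight ε k i X Y * (gaussProd ε X Y * q Y))

/-- The derivative of `rootPlan` in the direction of the `i`-th coordinate of the `k`-th factor,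
where `s` is the derivative of `r k`. -/
noncomputable def rootPlanDeriv (p ε : ℝ) (r : Fin N → Space d → ℝ) (s : Space d → ℝ)
    (q : Config N d → ℝ) (k : Fin N) (i : Fin d) (X : Config N d) : ℝ :=
  rootPlan p ε (Function.update r k s) q X + 1 / p * rootPlanKernelDeriv p ε r q k i X

/-- Here the kernel factor is smooth and strictly positive, so its power `1 / p` is smooth and the
product rule for a weak derivative and a smooth function applies to the tensor product of the `r l`.
-/
theorem isWeakPartial_rootPlan_of_bounded_support (hp : 1 ≤ p) (hε : 0 < ε) {R : ℝ} (hR : 0 ≤ R)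
    (hq : Integrable q) (hq0 : ∀ Y, Y ∉ Metric.closedBall 0 R → q Y = 0)
    (hpos : ∀ X, 0 < ∫ Y, gaussProd ε X Y * q Y) {s : Space d → ℝ} {k : Fin N} {i : Fin d}
    (hr : ∀ l, MemLp (r l) (ENNReal.ofReal p) volume) (hs : MemLp s (ENNReal.ofReal p) volume)
    (h : IsWeakPartial (stdBasis d i) (r k) s) :
    IsWeakPartial (unitVec k i) (rootPlan p ε r q)
      (rootPlanDeriv p ε r s q k i) := by
  have hG := contDiff_integral_gaussProd_mul (ε := ε) hR hq hq0
  have h1 := (isWeakPartial_prod_eval hp hr hs h).mul_contDiff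
    (hG.rpow_const_of_ne (p := 1 / p) fun X => (hpos X).ne')
  refine h1.congr_ae (Eventually.of_forall fun X => rfl) (Eventually.of_forall fun X => ?_)
  have h2 := (((hG.differentiable (by simp)) X).hasFDerivAt.rpow_const (p := 1 / p)
    (Or.inl (hpos X).ne')).fderiv
  have h3 := fderiv_integral_gaussProd_mul hε hR hq hq0 k i X
  rw [unitVec] at h3
  simp only [h2, h3, smul_apply,
    rootPlanDeriv, rootPlan, rootPlanKernelDeriv, smul_eq_mul]
  ring

end RootPlan

/-! ### `L^p` convergence of `rootPlan` and its derivative from convergence of masses -/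

section PlanConvergence

variable {N d : ℕ} {p ε : ℝ}

/-- The mass of the plan `∏ₗ |rₗ(xₗ)|^p ∏ₖ η^ε(yₖ - xₖ) q(Y)` weighted with `W`. -/
noncomputable def planMass (p ε : ℝ) (W : Config N d → Config N d → ℝ) (r : Fin N → Space d → ℝ)
    (q : Config N d → ℝ) : ℝ≥0∞ :=
  ∫⁻ X, ∫⁻ Y, ENNReal.ofReal (W X Y * (|∏ l, r l (X l)| ^ p * (gaussProd ε X Y * q Y)))

theorem measurable_prod_eval_real {r : Fin N → Space d → ℝ} (hr : ∀ l, Measurable (r l)) :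
    Measurable fun X : Config N d => ∏ l, r l (X l) :=
  Finset.measurable_fun_prod _ fun l _ => (hr l).comp (measurable_pi_apply l)

theorem measurable_gaussProd_mul {q : Config N d → ℝ} (hq : Measurable q) :
    Measurable (Function.uncurry fun X Y => gaussProd ε X Y * q Y) :=
  measurable_gaussProd.mul (hq.comp measurable_snd)

theorem tendsto_prod_eval {r : ℕ → Fin N → Space d → ℝ} {r' : Fin N → Space d → ℝ}
    (h : ∀ l, ∀ᵐ x, Tendsto (fun n => r n l x) atTop (𝓝 (r' l x))) :
    ∀ᵐ X : Config N d, Tendsto (fun n => ∏ l, r n l (X l)) atTop (𝓝 (∏ l, r' l (X l))) := by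
  have h1 : ∀ᵐ X : Config N d, ∀ l, Tendsto (fun n => r n l (X l)) atTop (𝓝 (r' l (X l))) :=
    ae_all_iff.2 fun l =>
      (Measure.quasiMeasurePreserving_eval (fun _ : Fin N => (volume : Measure (Space d))) l).ae
        (h l)
  filter_upwards [h1] with X hX using tendsto_finsetProd _ fun l _ => hX l

variable {r : ℕ → Fin N → Space d → ℝ} {r' : Fin N → Space d → ℝ} {q : ℕ → Config N d → ℝ}
  {q' : Config N d → ℝ}

/-- Serves two limits: the sequence of plans, and the removal of a truncation of `q` with `r` fixed.
Convergence of the masses takes the place of a dominating function. -/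
theorem tendsto_rootPlan (hp : 1 ≤ p) (hε : 0 < ε) (hr : ∀ n l, Measurable (r n l))
    (hr' : ∀ l, Measurable (r' l)) (hq : ∀ n, Measurable (q n)) (hq' : Measurable q')
    (hq0 : ∀ n Y, 0 ≤ q n Y) (hq0' : ∀ Y, 0 ≤ q' Y)
    (hrt : ∀ l, ∀ᵐ x, Tendsto (fun n => r n l x) atTop (𝓝 (r' l x)))
    (hqt : ∀ Y, Tendsto (fun n => q n Y) atTop (𝓝 (q' Y)))
    (hfin_n : ∀ n, planMass p ε (fun _ _ => 1) (r n) (q n) ≠ ⊤)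
    (hfin : planMass p ε (fun _ _ => 1) r' q' ≠ ⊤)
    (hm : Tendsto (fun n => planMass p ε (fun _ _ => 1) (r n) (q n)) atTop
      (𝓝 (planMass p ε (fun _ _ => 1) r' q'))) :
    Tendsto (fun n => ∫⁻ X, ‖rootPlan p ε (r n) (q n) X - rootPlan p ε r' q' X‖ₑ ^ p)
      atTop (𝓝 0) := by
  simp only [planMass, one_mul] at hfin_n hfin hm
  exact tendsto_lintegral_mul_root hp (fun n => measurable_prod_eval_real (hr n))
    (measurable_prod_eval_real hr') (fun n => measurable_gaussProd_mul (hq n))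
    (measurable_gaussProd_mul hq') (fun n X Y => mul_nonneg (gaussProd_pos hε _ _).le (hq0 n Y))
    (fun X Y => mul_nonneg (gaussProd_pos hε _ _).le (hq0' Y)) (tendsto_prod_eval hrt)
    (fun X Y => (hqt Y).const_mul _) hfin_n hfin hm

theorem tendsto_rootPlanKernelDeriv (hp : 1 ≤ p) (hε : 0 < ε) (k : Fin N) (i : Fin d)
    (hr : ∀ n l, Measurable (r n l))
    (hr' : ∀ l, Measurable (r' l)) (hq : ∀ n, Measurable (q n)) (hq' : Measurable q')
    (hq0 : ∀ n Y, 0 ≤ q n Y) (hq0' : ∀ Y, 0 ≤ q' Y)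
    (hrt : ∀ l, ∀ᵐ x, Tendsto (fun n => r n l x) atTop (𝓝 (r' l x)))
    (hqt : ∀ Y, Tendsto (fun n => q n Y) atTop (𝓝 (q' Y)))
    (hfin_n : ∀ e : ℝ, 0 ≤ e →
      ∀ n, planMass p ε (fun X Y => |coordWeight ε k i X Y| ^ e) (r n) (q n) ≠ ⊤)
    (hfin : ∀ e : ℝ, 0 ≤ e → planMass p ε (fun X Y => |coordWeight ε k i X Y| ^ e) r' q' ≠ ⊤)
    (hm : ∀ e : ℝ, 0 ≤ e → Tendsto
      (fun n => planMass p ε (fun X Y => |coordWeight ε k i X Y| ^ e) (r n) (q n)) atTop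
      (𝓝 (planMass p ε (fun X Y => |coordWeight ε k i X Y| ^ e) r' q'))) :
    Tendsto (fun n => ∫⁻ X, ‖rootPlanKernelDeriv p ε (r n) (q n) k i X
      - rootPlanKernelDeriv p ε r' q' k i X‖ₑ ^ p) atTop (𝓝 0) :=
  tendsto_lintegral_mul_root_deriv hp (fun n => measurable_prod_eval_real (hr n))
    (measurable_prod_eval_real hr') (fun n => measurable_gaussProd_mul (hq n))
    (measurable_gaussProd_mul hq') (measurable_coordWeight k i)
    (fun n _ Y => mul_nonneg (gaussProd_pos hε _ _).le (hq0 n Y))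
    (fun _ Y => mul_nonneg (gaussProd_pos hε _ _).le (hq0' Y)) (tendsto_prod_eval hrt)
    (fun _ Y => (hqt Y).const_mul _) hfin_n hfin hm

theorem measurable_rootPlan {r : Fin N → Space d → ℝ} {q : Config N d → ℝ}
    (hr : ∀ l, Measurable (r l)) (hq : Measurable q) : Measurable (rootPlan p ε r q) :=
  (measurable_prod_eval_real hr).mul
    (((measurable_gaussProd_mul hq).stronglyMeasurable.integral_prod_right
      (ν := (volume : Measure (Config N d)))).measurable.pow_const _)

theorem measurable_rootPlanKernelDeriv {r : Fin N → Space d → ℝ} {q : Config N d → ℝ}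
    (hr : ∀ l, Measurable (r l)) (hq : Measurable q) (k : Fin N) (i : Fin d) :
    Measurable (rootPlanKernelDeriv p ε r q k i) := by
  have h1 : Measurable (Function.uncurry fun X Y : Config N d =>
      coordWeight ε k i X Y * (gaussProd ε X Y * q Y)) :=
    (measurable_coordWeight k i).mul (measurable_gaussProd_mul hq)
  exact (measurable_prod_eval_real hr).mul
    ((((measurable_gaussProd_mul hq).stronglyMeasurable.integral_prod_right
      (ν := (volume : Measure (Config N d)))).measurable.pow_const _).mul
    (h1.stronglyMeasurable.integral_prod_right
      (ν := (volume : Measure (Config N d)))).measurable)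

theorem measurable_update {r : Fin N → Space d → ℝ} {s : Space d → ℝ} (k : Fin N)
    (hr : ∀ l, Measurable (r l)) (hs : Measurable s) (l : Fin N) :
    Measurable (Function.update r k s l) := by
  rcases eq_or_ne l k with rfl | hl
  · simpa using hs
  · simpa [hl] using hr l

theorem tendsto_lintegral_enorm_add_sub_rpow {α : Type*} [MeasurableSpace α] {μ : Measure α}
    (hp : 1 ≤ p) (c : ℝ) {f g : ℕ → α → ℝ} {f' g' : α → ℝ} (hf : ∀ n, Measurable (f n))
    (hf' : Measurable f')
    (hft : Tendsto (fun n => ∫⁻ x, ‖f n x - f' x‖ₑ ^ p ∂μ) atTop (𝓝 0))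
    (hgt : Tendsto (fun n => ∫⁻ x, ‖g n x - g' x‖ₑ ^ p ∂μ) atTop (𝓝 0)) :
    Tendsto (fun n => ∫⁻ x, ‖(f n x + c * g n x) - (f' x + c * g' x)‖ₑ ^ p ∂μ) atTop (𝓝 0) := by
  have hp0 : 0 < p := by linarith
  have hC : (2 : ℝ≥0∞) ^ (p - 1) ≠ ⊤ := ENNReal.rpow_ne_top_of_nonneg (by linarith) (by simp)
  have hc : ‖c‖ₑ ^ p ≠ ⊤ := ENNReal.rpow_ne_top_of_nonneg hp0.le (by simp)
  refine tendsto_of_tendsto_of_tendsto_of_le_of_le tendsto_const_nhds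
    (h := fun n => 2 ^ (p - 1) * (∫⁻ x, ‖f n x - f' x‖ₑ ^ p ∂μ
      + ‖c‖ₑ ^ p * ∫⁻ x, ‖g n x - g' x‖ₑ ^ p ∂μ)) ?_ (fun _ => bot_le) fun n => ?_
  · have := ENNReal.Tendsto.const_mul (a := 2 ^ (p - 1))
      (hft.add (ENNReal.Tendsto.const_mul (a := ‖c‖ₑ ^ p) hgt (Or.inr hc))) (Or.inr hC)
    simpa using this
  · beta_reduce
    rw [← lintegral_const_mul' _ _ hc, ← lintegral_add_left
      (show Measurable fun x => ‖f n x - f' x‖ₑ ^ p from ((hf n).sub hf').enorm.pow_const p), ← lintegral_const_mul' _ _ hC]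
    refine lintegral_mono fun x => ?_
    have e : (f n x + c * g n x) - (f' x + c * g' x) = (f n x - f' x) + c * (g n x - g' x) := by
      ring
    rw [e, ← ENNReal.mul_rpow_of_nonneg _ _ hp0.le, ← enorm_mul]
    exact (ENNReal.rpow_le_rpow (enorm_add_le _ _) hp0.le).trans
      (ENNReal.rpow_add_le_mul_rpow_add_rpow _ _ hp)

theorem tendsto_rootPlanDeriv (hp : 1 ≤ p) (hε : 0 < ε) (k : Fin N) (i : Fin d)
    {s : ℕ → Space d → ℝ} {s' : Space d → ℝ} (hr : ∀ n l, Measurable (r n l))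
    (hr' : ∀ l, Measurable (r' l)) (hs : ∀ n, Measurable (s n)) (hs' : Measurable s')
    (hq : ∀ n, Measurable (q n)) (hq' : Measurable q')
    (hq0 : ∀ n Y, 0 ≤ q n Y) (hq0' : ∀ Y, 0 ≤ q' Y)
    (hrt : ∀ l, ∀ᵐ x, Tendsto (fun n => r n l x) atTop (𝓝 (r' l x)))
    (hst : ∀ᵐ x, Tendsto (fun n => s n x) atTop (𝓝 (s' x)))
    (hqt : ∀ Y, Tendsto (fun n => q n Y) atTop (𝓝 (q' Y)))
    (hsfin_n : ∀ n, planMass p ε (fun _ _ => 1) (Function.update (r n) k (s n)) (q n) ≠ ⊤)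
    (hsfin : planMass p ε (fun _ _ => 1) (Function.update r' k s') q' ≠ ⊤)
    (hsm : Tendsto (fun n => planMass p ε (fun _ _ => 1) (Function.update (r n) k (s n)) (q n))
      atTop (𝓝 (planMass p ε (fun _ _ => 1) (Function.update r' k s') q')))
    (hfin_n : ∀ e : ℝ, 0 ≤ e →
      ∀ n, planMass p ε (fun X Y => |coordWeight ε k i X Y| ^ e) (r n) (q n) ≠ ⊤)
    (hfin : ∀ e : ℝ, 0 ≤ e → planMass p ε (fun X Y => |coordWeight ε k i X Y| ^ e) r' q' ≠ ⊤)
    (hm : ∀ e : ℝ, 0 ≤ e → Tendsto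
      (fun n => planMass p ε (fun X Y => |coordWeight ε k i X Y| ^ e) (r n) (q n)) atTop
      (𝓝 (planMass p ε (fun X Y => |coordWeight ε k i X Y| ^ e) r' q'))) :
    Tendsto (fun n => ∫⁻ X, ‖rootPlanDeriv p ε (r n) (s n) (q n) k i X
      - rootPlanDeriv p ε r' s' q' k i X‖ₑ ^ p) atTop (𝓝 0) := by
  refine tendsto_lintegral_enorm_add_sub_rpow hp (1 / p)
    (fun n => measurable_rootPlan (measurable_update k (hr n) (hs n)) (hq n))
    (measurable_rootPlan (measurable_update k hr' hs') hq') ?_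
    (tendsto_rootPlanKernelDeriv hp hε k i hr hr' hq hq' hq0 hq0' hrt hqt hfin_n hfin hm)
  refine tendsto_rootPlan hp hε (fun n => measurable_update k (hr n) (hs n))
    (measurable_update k hr' hs') hq hq' hq0 hq0' (fun l => ?_) hqt hsfin_n hsfin hsm
  rcases eq_or_ne l k with rfl | hl
  · simpa using hst
  · simpa [hl] using hrt l

end PlanConvergence

/-! ### Removing the truncation: the weak derivative of `rootPlan` -/

section Sobolev

variable {N d : ℕ} {p ε : ℝ} {r : Fin N → Space d → ℝ} {q : Config N d → ℝ}

theorem memLp_ofReal_of_lintegral {α : Type*} [MeasurableSpace α] {μ : Measure α} (hp : 1 ≤ p)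
    {f : α → ℝ} (hf : Measurable f) (h : ∫⁻ x, ‖f x‖ₑ ^ p ∂μ ≠ ⊤) :
    MemLp f (ENNReal.ofReal p) μ := by
  refine ⟨hf.aestronglyMeasurable, ?_⟩
  rw [← eLpNorm_ofReal_rpow hp] at h
  by_contra hne
  rw [not_lt_top_iff.1 hne, ENNReal.top_rpow_of_pos (by linarith)] at h
  exact h rfl

theorem memLp_rootPlan (hp : 1 ≤ p) (hε : 0 < ε) (hr : ∀ l, Measurable (r l)) (hq : Measurable q)
    (hq0 : ∀ Y, 0 ≤ q Y) (hfin : planMass p ε (fun _ _ => 1) r q ≠ ⊤) :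
    MemLp (rootPlan p ε r q) (ENNReal.ofReal p) volume := by
  refine memLp_ofReal_of_lintegral hp (measurable_rootPlan hr hq) ?_
  simp only [planMass, one_mul] at hfin
  exact ne_top_of_le_ne_top hfin (lintegral_enorm_mul_root_rpow_le hp _
    fun X Y => mul_nonneg (gaussProd_pos hε _ _).le (hq0 Y))

theorem memLp_rootPlanDeriv (hp : 1 ≤ p) (hε : 0 < ε) {s : Space d → ℝ} (k : Fin N) (i : Fin d)
    (hr : ∀ l, Measurable (r l)) (hs : Measurable s) (hq : Measurable q) (hq0 : ∀ Y, 0 ≤ q Y)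
    (hsfin : planMass p ε (fun _ _ => 1) (Function.update r k s) q ≠ ⊤)
    (hfin : ∀ e : ℝ, 0 ≤ e → planMass p ε (fun X Y => |coordWeight ε k i X Y| ^ e) r q ≠ ⊤) :
    MemLp (rootPlanDeriv p ε r s q k i) (ENNReal.ofReal p) volume := by
  refine (memLp_rootPlan hp hε (measurable_update k hr hs) hq hq0 hsfin).add
    (MemLp.const_mul ?_ (1 / p))
  refine memLp_ofReal_of_lintegral hp (measurable_rootPlanKernelDeriv hr hq k i) ?_
  exact ne_top_of_le_ne_top (hfin p (by linarith)) (lintegral_enorm_mul_root_deriv_rpow_le hp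
    (measurable_prod_eval_real hr) (measurable_gaussProd_mul hq) (measurable_coordWeight k i)
    (fun X Y => mul_nonneg (gaussProd_pos hε _ _).le (hq0 Y)) hfin)

/-- The truncation of `q` in size and support at `n + 1`. -/
noncomputable def truncate (q : Config N d → ℝ) (n : ℕ) : Config N d → ℝ :=
  (Metric.closedBall (0 : Config N d) (n + 1)).indicator fun Y => min (q Y) (n + 1)

theorem measurable_truncate (hq : Measurable q) (n : ℕ) : Measurable (truncate q n) :=
  (hq.min measurable_const).indicator Metric.isClosed_closedBall.measurableSet

theorem truncate_nonneg (hq0 : ∀ Y, 0 ≤ q Y) (n : ℕ) (Y : Config N d) : 0 ≤ truncate q n Y :=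
  Set.indicator_nonneg (fun Y _ => le_min (hq0 Y) (by positivity)) Y

theorem truncate_le (hq0 : ∀ Y, 0 ≤ q Y) (n : ℕ) (Y : Config N d) : truncate q n Y ≤ q Y :=
  Set.indicator_apply_le' (fun _ => min_le_left _ _) fun _ => hq0 Y

theorem truncate_eq_zero (n : ℕ) {Y : Config N d} (hY : Y ∉ Metric.closedBall 0 ((n : ℝ) + 1)) :
    truncate q n Y = 0 :=
  Set.indicator_of_notMem hY _

theorem tendsto_truncate (Y : Config N d) :
    Tendsto (fun n => truncate q n Y) atTop (𝓝 (q Y)) := by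
  obtain ⟨m, hm⟩ := exists_nat_ge (max ‖Y‖ (q Y))
  refine tendsto_const_nhds.congr' ?_
  filter_upwards [eventually_ge_atTop m] with n hn
  have h1 : (m : ℝ) ≤ n := by exact_mod_cast hn
  have h2 := (le_max_left _ _).trans hm
  have h3 := (le_max_right _ _).trans hm
  rw [truncate, Set.indicator_of_mem, min_eq_left (by linarith)]
  rw [mem_closedBall_zero_iff]
  linarith

theorem integrable_truncate (hq : Measurable q) (hq0 : ∀ Y, 0 ≤ q Y) (n : ℕ) :
    Integrable (truncate q n) := by
  rw [truncate, integrable_indicator_iff Metric.isClosed_closedBall.measurableSet]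
  refine Measure.integrableOn_of_bounded (M := (n : ℝ) + 1)
    (isCompact_closedBall _ _).measure_lt_top.ne (hq.min measurable_const).aestronglyMeasurable
    (Eventually.of_forall fun Y => ?_)
  rw [Real.norm_of_nonneg (le_min (hq0 Y) (by positivity))]
  exact min_le_right _ _

/-- The level `n + 1` makes both the radius and the cap positive already at `n = 0`, so the
truncation of a positive `q` is positive on a ball of positive measure. -/
theorem integral_gaussProd_mul_truncate_pos (hε : 0 < ε) (hq : Measurable q)
    (hqpos : ∀ Y, 0 < q Y) (n : ℕ) (X : Config N d) :
    0 < ∫ Y, gaussProd ε X Y * truncate q n Y := by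
  have h0 := truncate_nonneg (fun Y => (hqpos Y).le) n
  have hi : Integrable fun Y => gaussProd ε X Y * truncate q n Y := by
    refine (integrable_truncate hq (fun Y => (hqpos Y).le) n).bdd_mul
      (c := (1 / (2 * Real.pi * ε) ^ ((d : ℝ) / 2)) ^ N)
      (measurable_gaussProd.of_uncurry_left).aestronglyMeasurable
      (Eventually.of_forall fun Y => ?_)
    rw [Real.norm_of_nonneg (gaussProd_pos hε _ _).le]
    exact gaussProd_le hε _ _
  rw [integral_pos_iff_support_of_nonneg
    (fun Y => mul_nonneg (gaussProd_pos hε _ _).le (h0 Y)) hi]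
  refine (Metric.measure_closedBall_pos volume (0 : Config N d)
    (by positivity : (0 : ℝ) < n + 1)).trans_le (measure_mono fun Y hY => ?_)
  refine (mul_pos (gaussProd_pos hε _ _) ?_).ne'
  rw [truncate, Set.indicator_of_mem hY]
  exact lt_min (hqpos Y) (by positivity)

theorem planMass_mono (hε : 0 < ε) {W : Config N d → Config N d → ℝ} (hW0 : ∀ X Y, 0 ≤ W X Y)
    {q₁ q₂ : Config N d → ℝ} (h : ∀ Y, q₁ Y ≤ q₂ Y) :
    planMass p ε W r q₁ ≤ planMass p ε W r q₂ := by
  refine lintegral_mono fun X => lintegral_mono fun Y => ENNReal.ofReal_le_ofReal ?_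
  have := hW0 X Y
  have := (gaussProd_pos hε X Y).le
  have := h Y
  gcongr

theorem tendsto_planMass_truncate (hε : 0 < ε) {W : Config N d → Config N d → ℝ}
    (hW : Measurable (Function.uncurry W)) (hW0 : ∀ X Y, 0 ≤ W X Y) (hr : ∀ l, Measurable (r l))
    (hq : Measurable q) (hq0 : ∀ Y, 0 ≤ q Y) (hfin : planMass p ε W r q ≠ ⊤) :
    Tendsto (fun n => planMass p ε W r (truncate q n)) atTop (𝓝 (planMass p ε W r q)) := by
  have hmeas : ∀ {q : Config N d → ℝ}, Measurable q → Measurable fun z : Config N d × Config N d =>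
      ENNReal.ofReal (W z.1 z.2 * (|∏ l, r l (z.1 l)| ^ p * (gaussProd ε z.1 z.2 * q z.2))) := by
    intro q hq
    refine (Measurable.mul hW (Measurable.mul ?_ (measurable_gaussProd_mul hq))).ennreal_ofReal
    exact (_root_.continuous_abs.measurable.comp
      ((measurable_prod_eval_real hr).comp measurable_fst)).pow_const p
  have heq : ∀ {q : Config N d → ℝ}, Measurable q → planMass p ε W r q
      = ∫⁻ z : Config N d × Config N d, ENNReal.ofReal
        (W z.1 z.2 * (|∏ l, r l (z.1 l)| ^ p * (gaussProd ε z.1 z.2 * q z.2))) := by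
    intro q hq
    rw [Measure.volume_eq_prod, lintegral_prod _ (hmeas hq).aemeasurable]
    rfl
  rw [heq hq] at hfin ⊢
  simp only [fun n => heq (measurable_truncate hq n)]
  refine tendsto_lintegral_of_dominated_convergence _ (fun n => hmeas (measurable_truncate hq n))
    (fun n => Eventually.of_forall fun z => ENNReal.ofReal_le_ofReal ?_) hfin
    (Eventually.of_forall fun z => ENNReal.tendsto_ofReal
      ((((tendsto_truncate z.2).const_mul _).const_mul _).const_mul _))
  have := hW0 z.1 z.2
  have := (gaussProd_pos hε z.1 z.2).le
  have := truncate_le hq0 n z.2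
  gcongr

/-- `rootPlan` has the weak derivative that the product and chain rules suggest, although its kernel
factor may be infinite on a null set. -/
theorem isWeakPartial_rootPlan (hp : 1 ≤ p) (hε : 0 < ε) {s : Space d → ℝ} {k : Fin N} {i : Fin d}
    (hr : ∀ l, Measurable (r l)) (hs : Measurable s) (hq : Measurable q) (hqpos : ∀ Y, 0 < q Y)
    (hrp : ∀ l, MemLp (r l) (ENNReal.ofReal p) volume) (hsp : MemLp s (ENNReal.ofReal p) volume)
    (h : IsWeakPartial (stdBasis d i) (r k) s)
    (hfin1 : planMass p ε (fun _ _ => 1) r q ≠ ⊤)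
    (hsfin : planMass p ε (fun _ _ => 1) (Function.update r k s) q ≠ ⊤)
    (hfin : ∀ e : ℝ, 0 ≤ e → planMass p ε (fun X Y => |coordWeight ε k i X Y| ^ e) r q ≠ ⊤) :
    IsWeakPartial (Pi.single k (stdBasis d i)) (rootPlan p ε r q)
      (rootPlanDeriv p ε r s q k i) := by
  have hq0 : ∀ Y, 0 ≤ q Y := fun Y => (hqpos Y).le
  have hW1 : Measurable (Function.uncurry fun _ _ : Config N d => (1 : ℝ)) := measurable_const
  have hWe : ∀ e : ℝ, Measurable
      (Function.uncurry fun X Y : Config N d => |coordWeight ε k i X Y| ^ e) := fun e =>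
    (_root_.continuous_abs.measurable.comp (measurable_coordWeight k i)).pow_const e
  have hWe0 : ∀ (e : ℝ) (X Y : Config N d), 0 ≤ |coordWeight ε k i X Y| ^ e := fun e X Y =>
    Real.rpow_nonneg (abs_nonneg _) _
  have hmono : ∀ {r : Fin N → Space d → ℝ} {W : Config N d → Config N d → ℝ},
      (∀ X Y, 0 ≤ W X Y) → planMass p ε W r q ≠ ⊤ → ∀ n, planMass p ε W r (truncate q n) ≠ ⊤ :=
    fun hW0 hf n => ne_top_of_le_ne_top hf (planMass_mono hε hW0 (truncate_le hq0 n))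
  -- Truncations lie below `q` and converge to it pointwise, so their masses converge to the finite
  -- masses of `q`, and functions and derivatives converge in `L^p`.
  refine IsWeakPartial.of_tendsto hp (fun n => isWeakPartial_rootPlan_of_bounded_support hp hε
      (by positivity : (0 : ℝ) ≤ n + 1) (integrable_truncate hq hq0 n)
      (fun Y hY => truncate_eq_zero n hY) (integral_gaussProd_mul_truncate_pos hε hq hqpos n)
      hrp hsp h)
    ((memLp_rootPlan hp hε hr hq hq0 hfin1).locallyIntegrable (one_le_ofReal hp))
    ((memLp_rootPlanDeriv hp hε k i hr hs hq hq0 hsfin hfin).locallyIntegrable (one_le_ofReal hp))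
    ?_ ?_
  · exact tendsto_rootPlan hp hε (fun _ => hr) hr (fun n => measurable_truncate hq n) hq
      (truncate_nonneg hq0) hq0 (fun l => Eventually.of_forall fun x => tendsto_const_nhds)
      tendsto_truncate (hmono (fun _ _ => zero_le_one) hfin1) hfin1
      (tendsto_planMass_truncate hε hW1 (fun _ _ => zero_le_one) hr hq hq0 hfin1)
  · exact tendsto_rootPlanDeriv hp hε k i (fun _ => hr) hr (fun _ => hs) hs
      (fun n => measurable_truncate hq n) hq (truncate_nonneg hq0) hq0
      (fun l => Eventually.of_forall fun x => tendsto_const_nhds)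
      (Eventually.of_forall fun x => tendsto_const_nhds) tendsto_truncate
      (hmono (fun _ _ => zero_le_one) hsfin) hsfin
      (tendsto_planMass_truncate hε hW1 (fun _ _ => zero_le_one) (measurable_update k hr hs) hq hq0
        hsfin)
      (fun e he => hmono (hWe0 e) (hfin e he)) hfin
      (fun e he => tendsto_planMass_truncate hε (hWe e) (hWe0 e) hr hq hq0 (hfin e he))

end Sobolev

/-! ### The masses and the density of `Θ^ε[μ]` -/

section Theta

variable {N d : ℕ} {p ε : ℝ} {μ : Measure (Config N d)} [IsProbabilityMeasure μ]
  {r : Fin N → Space d → ℝ}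

theorem ofReal_abs_prod_rpow_mul (r : Fin N → Space d → ℝ) (X : Config N d) {a : ℝ} :
    ENNReal.ofReal (|∏ l, r l (X l)| ^ p * a)
      = (∏ l, ENNReal.ofReal (|r l (X l)| ^ p)) * ENNReal.ofReal a := by
  rw [ENNReal.ofReal_mul (Real.rpow_nonneg (abs_nonneg _) _), Finset.abs_prod,
    ← Real.finsetProd_rpow _ _ fun _ _ => abs_nonneg _,
    ENNReal.ofReal_prod_of_nonneg fun _ _ => Real.rpow_nonneg (abs_nonneg _) _]

theorem measurable_ofReal_abs_rpow {f : Space d → ℝ} (hf : Measurable f) :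
    Measurable fun x => ENNReal.ofReal (|f x| ^ p) :=
  ((_root_.continuous_abs.measurable.comp hf).pow_const p).ennreal_ofReal

theorem planMass_one_planRatio (hε : 0 < ε) (hr : ∀ l, Measurable (r l))
    (hm : ∀ l, marginal μ l = volume.withDensity fun x => ENNReal.ofReal (|r l x| ^ p)) :
    planMass p ε (fun _ _ => 1) r (planRatio ε μ) = 1 := by
  simp only [planMass, one_mul, ofReal_abs_prod_rpow_mul]
  exact lintegral_density_mul_gaussProd_mul_planRatio hε
    (fun l => measurable_ofReal_abs_rpow (hr l)) hm

theorem prod_update_eval_eq {ρ : Fin N → Space d → ℝ≥0∞} (k : Fin N)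
    (h : Space d → Space d → ℝ≥0∞) (X Y : Config N d) :
    ∏ l, Function.update (fun l x _ => ρ l x) k h l (X l) (Y l)
      = h (X k) (Y k) * ∏ l ∈ Finset.univ.erase k, ρ l (X l) := by
  rw [← Finset.mul_prod_erase _ _ (Finset.mem_univ k), Function.update_self]
  congr 1
  exact Finset.prod_congr rfl fun l hl => by rw [Function.update_of_ne (Finset.ne_of_mem_erase hl)]

/-- After the other coordinates have cancelled, the Gaussian integrates to 1 in `y`. The plan enters
no further, so convergence of this mass is convergence of `L^p` norms of the derivatives of the
marginal roots. -/
theorem planMass_update_planRatio (hε : 0 < ε) (hr : ∀ l, Measurable (r l))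
    (hm : ∀ l, marginal μ l = volume.withDensity fun x => ENNReal.ofReal (|r l x| ^ p))
    (k : Fin N) {s : Space d → ℝ} (hs : Measurable s) :
    planMass p ε (fun _ _ => 1) (Function.update r k s) (planRatio ε μ)
      = ∫⁻ x, ENNReal.ofReal (|s x| ^ p) := by
  have hsm := measurable_ofReal_abs_rpow (p := p) hs
  have h := lintegral_update_mul_gaussProd_mul_planRatio (μ := μ) hε
    (fun l => measurable_ofReal_abs_rpow (hr l)) hm k (h := fun x _ => ENNReal.ofReal (|s x| ^ p))
    (hsm.comp measurable_fst)
  have hgm : Measurable fun q : Space d × Space d => ENNReal.ofReal (gaussKernel ε (q.1 - q.2)) :=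
    (((continuous_gaussKernel ε).comp (by fun_prop)).measurable).ennreal_ofReal
  replace h := h.trans
    (lintegral_lintegral_swap ((hsm.comp measurable_snd).mul hgm).aemeasurable)
  have e : ∀ x : Space d, ∫⁻ y, ENNReal.ofReal (|s x| ^ p) * ENNReal.ofReal (gaussKernel ε (y - x))
      = ENNReal.ofReal (|s x| ^ p) := fun x => by
    rw [lintegral_const_mul' _ _ ENNReal.ofReal_ne_top, lintegral_gaussKernel_sub_right hε, mul_one]
  simp only [e] at h
  rw [← h]
  simp only [planMass, one_mul, ofReal_abs_prod_rpow_mul, prod_update_eval_eq]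
  refine lintegral_congr fun X => lintegral_congr fun Y => ?_
  rw [← Finset.mul_prod_erase _ _ (Finset.mem_univ k), Function.update_self]
  congr 2
  exact Finset.prod_congr rfl fun l hl => by rw [Function.update_of_ne (Finset.ne_of_mem_erase hl)]

/-- The weight depends on `y_k - x_k` only, so by translation invariance it separates from the
marginal density, which has mass 1. The value is therefore the same for all plans. -/
theorem planMass_coordWeight_planRatio (hε : 0 < ε) (hr : ∀ l, Measurable (r l))
    (hm : ∀ l, marginal μ l = volume.withDensity fun x => ENNReal.ofReal (|r l x| ^ p))
    (k : Fin N) (i : Fin d) (e : ℝ) :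
    planMass p ε (fun X Y => |coordWeight ε k i X Y| ^ e) r (planRatio ε μ)
      = ∫⁻ z : Space d, ENNReal.ofReal (|z i / ε| ^ e * gaussKernel ε z) := by
  have hrm := measurable_ofReal_abs_rpow (p := p) (hr k)
  have hw : Measurable fun q : Space d × Space d =>
      ENNReal.ofReal (|(q.2 - q.1) i / ε| ^ e) := by
    have : Measurable fun q : Space d × Space d => (q.2 - q.1) i / ε :=
      Continuous.measurable (by fun_prop)
    exact ((_root_.continuous_abs.measurable.comp this).pow_const e).ennreal_ofReal
  have h := lintegral_update_mul_gaussProd_mul_planRatio (μ := μ) hε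
    (fun l => measurable_ofReal_abs_rpow (hr l)) hm k
    (h := fun x y => ENNReal.ofReal (|(y - x) i / ε| ^ e) * ENNReal.ofReal (|r k x| ^ p))
    (hw.mul (hrm.comp measurable_fst))
  have hgm : Measurable fun q : Space d × Space d => ENNReal.ofReal (gaussKernel ε (q.1 - q.2)) :=
    (((continuous_gaussKernel ε).comp (by fun_prop)).measurable).ennreal_ofReal
  have hone : ∫⁻ x, ENNReal.ofReal (|r k x| ^ p) = 1 := by
    have h1 : marginal μ k Set.univ = 1 := measure_univ
    rwa [hm k, withDensity_apply _ MeasurableSet.univ, Measure.restrict_univ] at h1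
  replace h := h.trans (lintegral_lintegral_swap (((hw.comp measurable_swap).mul
    (hrm.comp measurable_snd)).mul hgm).aemeasurable)
  have e1 : ∀ x : Space d, ∫⁻ y, ENNReal.ofReal (|(y - x) i / ε| ^ e)
        * ENNReal.ofReal (|r k x| ^ p) * ENNReal.ofReal (gaussKernel ε (y - x))
      = ENNReal.ofReal (|r k x| ^ p)
        * ∫⁻ z : Space d, ENNReal.ofReal (|z i / ε| ^ e * gaussKernel ε z) := fun x => by
    rw [← lintegral_sub_right_eq_self
      (fun z : Space d => ENNReal.ofReal (|z i / ε| ^ e * gaussKernel ε z)) x, ← lintegral_const_mul' _ _ ENNReal.ofReal_ne_top]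
    refine lintegral_congr fun y => ?_
    rw [ENNReal.ofReal_mul (Real.rpow_nonneg (abs_nonneg _) _)]
    ring
  simp only [e1] at h
  rw [lintegral_mul_const _ hrm, hone, one_mul] at h
  rw [← h]
  simp only [planMass, prod_update_eval_eq]
  refine lintegral_congr fun X => lintegral_congr fun Y => ?_
  rw [ENNReal.ofReal_mul (Real.rpow_nonneg (abs_nonneg _) _), ofReal_abs_prod_rpow_mul,
    ← Finset.mul_prod_erase _ _ (Finset.mem_univ k)]
  simp only [coordWeight]
  ring

theorem measurable_lintegral_gaussProd_mul {q : Config N d → ℝ} (hq : Measurable q) :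
    Measurable fun X : Config N d => ∫⁻ Y, ENNReal.ofReal (gaussProd ε X Y * q Y) :=
  (measurable_gaussProd_mul hq).ennreal_ofReal.lintegral_prod_right'

/-- Test with indicators, absorb the density of `Λ^ε[μ]` by `gaussProd_mul_planRatio`, and integrate
over `Y` first. -/
theorem Theta_eq_withDensity (hε : 0 < ε) {ρ : Fin N → Space d → ℝ≥0∞}
    (hρ : ∀ l, Measurable (ρ l)) (hm : ∀ l, marginal μ l = volume.withDensity (ρ l)) :
    Theta ε μ = volume.withDensity fun X => (∏ l, ρ l (X l))
      * ∫⁻ Y, ENNReal.ofReal (gaussProd ε X Y * planRatio ε μ Y) := by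
  have hpm := measurable_prod_eval hρ
  have hθ := measurable_thetaKernel ε μ
  have hl : Measurable (lambdaDensity ε μ) := measurable_lambdaDensity
  ext s hs
  set ψ : Config N d → ℝ≥0∞ := s.indicator 1 with hψ
  have hψm : Measurable ψ := measurable_one.indicator hs
  have hin : ∀ Y : Config N d,
      Measurable fun X => ENNReal.ofReal (thetaKernel ε μ Y X) * ψ X := fun Y =>
    (Measurable.of_uncurry_left (f := thetaKernel ε μ) hθ).ennreal_ofReal.mul hψm
  have hjm : Measurable fun z : Config N d × Config N d => (∏ l, ρ l (z.2 l))
      * (ENNReal.ofReal (thetaKernel ε μ z.1 z.2) * ψ z.2) :=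
    (hpm.comp measurable_snd).mul (hθ.ennreal_ofReal.mul (hψm.comp measurable_snd))
  have h := lintegral_Theta ε μ ψ hψm
  rw [pi_withDensity hρ hm, Lambda, lintegral_indicator_one hs] at h
  simp only [fun Y => lintegral_withDensity_eq_lintegral_mul volume hpm (hin Y)] at h
  refine h.trans ((lintegral_withDensity_eq_lintegral_mul volume hl.ennreal_ofReal
    hjm.lintegral_prod_right').trans ?_)
  rw [withDensity_apply _ hs, ← lintegral_indicator hs]
  have e1 : ∀ Y : Config N d, ENNReal.ofReal (lambdaDensity ε μ Y) * ∫⁻ X : Config N d,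
      (∏ l, ρ l (X l)) * (ENNReal.ofReal (thetaKernel ε μ Y X) * ψ X)
      = ∫⁻ X : Config N d,
        (∏ l, ρ l (X l)) * (ψ X * ENNReal.ofReal (gaussProd ε X Y * planRatio ε μ Y)) := by
    intro Y
    rw [← lintegral_const_mul' _ _ ENNReal.ofReal_ne_top]
    refine lintegral_congr fun X => ?_
    rw [gaussProd_mul_planRatio, ENNReal.ofReal_mul (lambdaDensity_pos hε Y).le]
    ring
  have hgm : Measurable fun z : Config N d × Config N d =>
      ENNReal.ofReal (gaussProd ε z.2 z.1 * planRatio ε μ z.1) :=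
    ((measurable_gaussProd_mul measurable_planRatio).comp measurable_swap).ennreal_ofReal
  refine (lintegral_congr e1).trans ((lintegral_lintegral_swap ((hpm.comp measurable_snd).mul
    ((hψm.comp measurable_snd).mul hgm)).aemeasurable).trans ?_)
  refine lintegral_congr fun X => ?_
  have hgX : Measurable fun Y => ENNReal.ofReal (gaussProd ε X Y * planRatio ε μ Y) :=
    (measurable_gaussProd_mul measurable_planRatio).of_uncurry_left.ennreal_ofReal
  rw [lintegral_const_mul _ (hgX.const_mul _), lintegral_const_mul _ hgX]
  by_cases hX : X ∈ s
  · simp [ψ, hX]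
  · simp [ψ, hX]

theorem isProbabilityMeasure_Theta (hε : 0 < ε) (hr : ∀ l, Measurable (r l))
    (hm : ∀ l, marginal μ l = volume.withDensity fun x => ENNReal.ofReal (|r l x| ^ p)) :
    IsProbabilityMeasure (Theta ε μ) := by
  have hρ := fun l => measurable_ofReal_abs_rpow (p := p) (hr l)
  refine ⟨?_⟩
  rw [Theta_eq_withDensity hε hρ hm, withDensity_apply _ MeasurableSet.univ, Measure.restrict_univ,
    ← lintegral_density_mul_gaussProd_mul_planRatio hε hρ hm]
  refine lintegral_congr fun X => (lintegral_const_mul _ ?_).symm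
  exact (measurable_gaussProd_mul measurable_planRatio).of_uncurry_left.ennreal_ofReal

/-- Where the kernel integral is infinite, `toReal` and the real integral both take the value 0, so
the two expressions agree without a finiteness argument. -/
theorem densityRoot_Theta_ae_eq (hp : 1 ≤ p) (hε : 0 < ε) (hr : ∀ l, Measurable (r l))
    (hr0 : ∀ l x, 0 ≤ r l x)
    (hm : ∀ l, marginal μ l = volume.withDensity fun x => ENNReal.ofReal (|r l x| ^ p)) :
    densityRoot p (Theta ε μ) =ᵐ[volume] rootPlan p ε r (planRatio ε μ) := by
  have hρ := fun l => measurable_ofReal_abs_rpow (p := p) (hr l)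
  have hq : Measurable (planRatio ε μ) := measurable_planRatio
  have hd := Measure.rnDeriv_withDensity (volume : Measure (Config N d))
    ((measurable_prod_eval hρ).mul (measurable_lintegral_gaussProd_mul (ε := ε) hq))
  have hΘ := Theta_eq_withDensity (μ := μ) hε hρ hm
  simp only [Pi.mul_def] at hd
  rw [← hΘ] at hd
  filter_upwards [hd] with X hX
  have h0 : ∀ Y, 0 ≤ gaussProd ε X Y * planRatio ε μ Y := fun Y =>
    mul_nonneg (gaussProd_pos hε _ _).le (planRatio_pos hε _).le
  have hp1 : 0 ≤ ∏ l, r l (X l) := Finset.prod_nonneg fun l _ => hr0 l _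
  have hG0 : 0 ≤ ∫ Y, gaussProd ε X Y * planRatio ε μ Y := integral_nonneg h0
  rw [densityRoot, hX, ENNReal.toReal_mul, ENNReal.toReal_prod,
    ← integral_eq_lintegral_of_nonneg_ae (Eventually.of_forall h0)
      (measurable_gaussProd_mul hq).of_uncurry_left.aestronglyMeasurable, rootPlan]
  have e : ∏ l, (ENNReal.ofReal (|r l (X l)| ^ p)).toReal = (∏ l, r l (X l)) ^ p := by
    rw [← Real.finsetProd_rpow _ _ fun l _ => hr0 l _]
    refine Finset.prod_congr rfl fun l _ => ?_
    rw [ENNReal.toReal_ofReal (Real.rpow_nonneg (abs_nonneg _) _), abs_of_nonneg (hr0 l _)]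
  rw [e, Real.mul_rpow (Real.rpow_nonneg hp1 _) hG0, ← Real.rpow_mul hp1,
    mul_one_div_cancel (by linarith), Real.rpow_one]

end Theta

/-! ### Regularity of `Θ^ε[μ]` and convergence along the sequence of plans -/

section Regular

variable {N d : ℕ} {p ε : ℝ}

theorem measurable_densityRoot (ρ : Measure (Space d)) : Measurable (densityRoot p ρ) := by
  unfold densityRoot
  exact (Measure.measurable_rnDeriv _ _).ennreal_toReal.pow_const _

theorem densityRoot_nonneg (ρ : Measure (Space d)) (x : Space d) : 0 ≤ densityRoot p ρ x :=
  Real.rpow_nonneg ENNReal.toReal_nonneg _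

theorem eq_withDensity_densityRoot (hp : 1 ≤ p) {ρ : Measure (Space d)} [IsFiniteMeasure ρ]
    (h : ρ ≪ volume) :
    ρ = volume.withDensity fun x => ENNReal.ofReal (|densityRoot p ρ x| ^ p) := by
  conv_lhs => rw [← Measure.withDensity_rnDeriv_eq ρ volume h]
  refine withDensity_congr_ae ?_
  filter_upwards [Measure.rnDeriv_ne_top ρ volume] with x hx
  rw [abs_of_nonneg (densityRoot_nonneg ρ x), densityRoot, ← Real.rpow_mul ENNReal.toReal_nonneg,
    one_div_mul_cancel (by linarith), Real.rpow_one, ENNReal.ofReal_toReal hx]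

theorem exists_measurable_isWeakPartial {v : Space d} {f g : Space d → ℝ}
    (h : IsWeakPartial v f g) (hg : MemLp g (ENNReal.ofReal p) volume) :
    ∃ s : Space d → ℝ, Measurable s ∧ MemLp s (ENNReal.ofReal p) volume ∧ IsWeakPartial v f s :=
  ⟨hg.1.mk g, hg.1.stronglyMeasurable_mk.measurable, hg.ae_eq hg.1.ae_eq_mk,
    h.congr_ae EventuallyEq.rfl hg.1.ae_eq_mk⟩

theorem stdBasisConfig_apply (k : Fin N) (i : Fin d) :
    stdBasisConfig N d ⟨k, i⟩ = Pi.single k (stdBasis d i) := by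
  simp [stdBasisConfig]

variable {μ : Measure (Config N d)} [IsProbabilityMeasure μ]

theorem lintegral_abs_rpow_eq {f : Space d → ℝ} (hp : 1 ≤ p) :
    ∫⁻ x, ENNReal.ofReal (|f x| ^ p) = eLpNorm f (ENNReal.ofReal p) volume ^ p := by
  rw [eLpNorm_ofReal_rpow hp]
  refine lintegral_congr fun x => ?_
  rw [Real.enorm_eq_ofReal_abs, ENNReal.ofReal_rpow_of_nonneg (abs_nonneg _) (by linarith)]

theorem planMass_update_ne_top (hp : 1 ≤ p) (hε : 0 < ε) {r : Fin N → Space d → ℝ}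
    (hr : ∀ l, Measurable (r l))
    (hm : ∀ l, marginal μ l = volume.withDensity fun x => ENNReal.ofReal (|r l x| ^ p))
    (k : Fin N) {s : Space d → ℝ} (hs : Measurable s) (hsp : MemLp s (ENNReal.ofReal p) volume) :
    planMass p ε (fun _ _ => 1) (Function.update r k s) (planRatio ε μ) ≠ ⊤ := by
  rw [planMass_update_planRatio hε hr hm k hs, lintegral_abs_rpow_eq hp]
  exact ENNReal.rpow_ne_top_of_nonneg (by linarith) hsp.eLpNorm_ne_top

/-- The weak derivatives of the `p`-th root of the density of `Θ^ε[μ]`, in terms of those of the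
marginals of `μ`. -/
theorem isWeakPartial_densityRoot_Theta (hp : 1 ≤ p) (hε : 0 < ε)
    (hreg : ∀ j, IsW1pRegular p (stdBasis d) (marginal μ j)) {s : Space d → ℝ} {k : Fin N}
    {i : Fin d} (hs : Measurable s) (hsp : MemLp s (ENNReal.ofReal p) volume)
    (h : IsWeakPartial (stdBasis d i) (densityRoot p (marginal μ k)) s) :
    IsWeakPartial (stdBasisConfig N d ⟨k, i⟩) (densityRoot p (Theta ε μ))
        (rootPlanDeriv p ε (fun l => densityRoot p (marginal μ l)) s (planRatio ε μ) k i) ∧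
      MemLp (rootPlanDeriv p ε (fun l => densityRoot p (marginal μ l)) s (planRatio ε μ) k i)
        (ENNReal.ofReal p) volume := by
  have hr : ∀ l, Measurable (densityRoot p (marginal μ l)) := fun l => measurable_densityRoot _
  have hm := fun l => eq_withDensity_densityRoot hp (hreg l).2.1
  have hq : Measurable (planRatio ε μ) := measurable_planRatio
  have hfin1 : planMass p ε (fun _ _ => 1) (fun l => densityRoot p (marginal μ l))
      (planRatio ε μ) ≠ ⊤ := by
    rw [planMass_one_planRatio hε hr hm]
    exact ENNReal.one_ne_top
  have hsfin := planMass_update_ne_top hp hε hr hm k hs hsp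
  have hfin : ∀ e : ℝ, 0 ≤ e → planMass p ε (fun X Y => |coordWeight ε k i X Y| ^ e)
      (fun l => densityRoot p (marginal μ l)) (planRatio ε μ) ≠ ⊤ := fun e he => by
    rw [planMass_coordWeight_planRatio hε hr hm]
    exact lintegral_abs_coord_rpow_mul_gaussKernel_ne_top hε he i
  constructor
  · rw [stdBasisConfig_apply]
    exact (isWeakPartial_rootPlan hp hε hr hs hq (planRatio_pos hε)
      (fun l => (hreg l).2.2.1) hsp h hfin1 hsfin hfin).congr_ae
      (densityRoot_Theta_ae_eq hp hε hr (fun l => densityRoot_nonneg _) hm).symm EventuallyEq.rfl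
  · exact memLp_rootPlanDeriv hp hε k i hr hs hq (fun Y => (planRatio_pos hε Y).le) hsfin hfin

theorem isW1pRegular_Theta (hp : 1 ≤ p) (hε : 0 < ε)
    (hreg : ∀ j, IsW1pRegular p (stdBasis d) (marginal μ j)) :
    IsW1pRegular p (stdBasisConfig N d) (Theta ε μ) := by
  have hr : ∀ l, Measurable (densityRoot p (marginal μ l)) := fun l => measurable_densityRoot _
  have hm := fun l => eq_withDensity_densityRoot hp (hreg l).2.1
  refine ⟨isProbabilityMeasure_Theta hε hr hm, ?_, ?_, ?_⟩
  · rw [Theta_eq_withDensity hε (fun l => measurable_ofReal_abs_rpow (hr l)) hm]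
    exact withDensity_absolutelyContinuous _ _
  · refine (memLp_congr_ae (densityRoot_Theta_ae_eq hp hε hr
      (fun l => densityRoot_nonneg _) hm)).2 (memLp_rootPlan hp hε hr measurable_planRatio
      (fun Y => (planRatio_pos hε Y).le) ?_)
    rw [planMass_one_planRatio hε hr hm]
    exact ENNReal.one_ne_top
  · rintro ⟨k, i⟩
    obtain ⟨g, hg, hgp⟩ := (hreg k).2.2.2 i
    obtain ⟨s, hs, hsp, h⟩ := exists_measurable_isWeakPartial hg hgp
    exact ⟨_, isWeakPartial_densityRoot_Theta hp hε hreg hs hsp h⟩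

theorem convDensity_marginal (μ : Measure (Config N d)) (k : Fin N) (y : Space d) :
    convDensity ε (marginal μ k) y = ∫ X, gaussKernel ε (y - X k) ∂μ := by
  rw [convDensity, marginal, integral_map (measurable_pi_apply k).aemeasurable]
  exact ((continuous_gaussKernel ε).comp (by fun_prop)).aestronglyMeasurable

/-- The point where weak convergence is used: for fixed `Y`, numerator and denominators are
integrals of bounded continuous functions against the plans, and the limit denominator is positive.
-/
theorem tendsto_planRatio (hε : 0 < ε) {μn : ℕ → ProbabilityMeasure (Config N d)}
    {μ : ProbabilityMeasure (Config N d)} (hweak : Tendsto μn atTop (𝓝 μ)) (Y : Config N d) :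
    Tendsto (fun n => planRatio ε (μn n : Measure (Config N d)) Y) atTop
      (𝓝 (planRatio ε (μ : Measure (Config N d)) Y)) := by
  rw [ProbabilityMeasure.tendsto_iff_forall_integral_tendsto] at hweak
  have h1 := hweak (BoundedContinuousFunction.ofNormedAddCommGroup (fun X => gaussProd ε X Y)
    (continuous_gaussProd_left Y) ((1 / (2 * Real.pi * ε) ^ ((d : ℝ) / 2)) ^ N) fun X => by
      rw [Real.norm_of_nonneg (gaussProd_pos hε _ _).le]
      exact gaussProd_le hε _ _)
  have h2 := fun k => hweak (BoundedContinuousFunction.ofNormedAddCommGroup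
    (fun X : Config N d => gaussKernel ε (Y k - X k))
    ((continuous_gaussKernel ε).comp (by fun_prop)) (1 / (2 * Real.pi * ε) ^ ((d : ℝ) / 2))
    fun X => by
      rw [Real.norm_of_nonneg (gaussKernel_pos hε _).le]
      exact gaussKernel_le hε _)
  simp only [BoundedContinuousFunction.coe_ofNormedAddCommGroup, ← convDensity_marginal] at h1 h2
  exact h1.div (tendsto_finsetProd _ fun k _ => h2 k)
    (Finset.prod_pos fun k _ => convDensity_pos hε _ _).ne'

theorem tendsto_eLpNorm_of_tendsto_sub {α : Type*} [MeasurableSpace α] {μ : Measure α} {q : ℝ≥0∞}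
    (hq : 1 ≤ q) {f : ℕ → α → ℝ} {g : α → ℝ} (hf : ∀ n, AEStronglyMeasurable (f n) μ)
    (hg : AEStronglyMeasurable g μ)
    (h : Tendsto (fun n => eLpNorm (fun x => f n x - g x) q μ) atTop (𝓝 0)) :
    Tendsto (fun n => eLpNorm (f n) q μ) atTop (𝓝 (eLpNorm g q μ)) := by
  refine tendsto_of_tendsto_of_tendsto_of_le_of_le
    (g := fun n => eLpNorm g q μ - eLpNorm (fun x => f n x - g x) q μ)
    (h := fun n => eLpNorm g q μ + eLpNorm (fun x => f n x - g x) q μ) ?_ ?_ ?_ ?_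
  · simpa using ENNReal.Tendsto.sub tendsto_const_nhds h (Or.inr ENNReal.zero_ne_top)
  · simpa using tendsto_const_nhds.add h
  · intro n
    refine tsub_le_iff_right.2 ?_
    have := eLpNorm_sub_le (hf n) ((hf n).sub hg) hq
    rwa [sub_sub_cancel] at this
  · intro n
    have := eLpNorm_add_le hg ((hf n).sub hg) hq
    simpa [Pi.sub_def, Pi.add_def] using this

theorem tendstoInMeasure_of_tendsto_lintegral_rpow {α : Type*} [MeasurableSpace α]
    {μ : Measure α} (hp : 1 ≤ p) {F : ℕ → α → ℝ} {f : α → ℝ} (hF : ∀ n, Measurable (F n))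
    (hf : Measurable f) (h : Tendsto (fun n => ∫⁻ x, ‖F n x - f x‖ₑ ^ p ∂μ) atTop (𝓝 0)) :
    TendstoInMeasure μ F atTop f :=
  tendstoInMeasure_of_tendsto_eLpNorm (p := ENNReal.ofReal p)
    (by simpa using (by linarith : 0 < p)) (fun n => (hF n).aestronglyMeasurable)
    hf.aestronglyMeasurable ((tendsto_eLpNorm_ofReal_iff hp).2 h)

section Convergence

variable {μn : ℕ → ProbabilityMeasure (Config N d)} {μ : ProbabilityMeasure (Config N d)}

theorem tendsto_densityRoot_Theta (hp : 1 ≤ p) (hε : 0 < ε) (hweak : Tendsto μn atTop (𝓝 μ))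
    (hreg_n : ∀ n j, IsW1pRegular p (stdBasis d) (marginal (μn n : Measure (Config N d)) j))
    (hreg : ∀ j, IsW1pRegular p (stdBasis d) (marginal (μ : Measure (Config N d)) j))
    (hr : ∀ j, Tendsto (fun n => ∫⁻ x, ‖densityRoot p (marginal (μn n : Measure (Config N d)) j) x
      - densityRoot p (marginal (μ : Measure (Config N d)) j) x‖ₑ ^ p) atTop (𝓝 0)) :
    Tendsto (fun n => ∫⁻ X, ‖densityRoot p (Theta ε (μn n : Measure (Config N d))) X
      - densityRoot p (Theta ε (μ : Measure (Config N d))) X‖ₑ ^ p) atTop (𝓝 0) := by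
  have hmn := fun n l => eq_withDensity_densityRoot hp (hreg_n n l).2.1
  have hm := fun l => eq_withDensity_densityRoot hp (hreg l).2.1
  have hM : ∀ (ν : ProbabilityMeasure (Config N d)) (l : Fin N),
      Measurable (densityRoot p (marginal (ν : Measure (Config N d)) l)) :=
    fun ν l => measurable_densityRoot _
  have hae := densityRoot_Theta_ae_eq hp hε (hM μ) (fun l => densityRoot_nonneg _) hm
  have hae_n := fun n =>
    densityRoot_Theta_ae_eq hp hε (hM (μn n)) (fun l => densityRoot_nonneg _) (hmn n)
  have he : ∀ n, ∫⁻ X, ‖densityRoot p (Theta ε (μn n : Measure (Config N d))) X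
      - densityRoot p (Theta ε (μ : Measure (Config N d))) X‖ₑ ^ p
      = ∫⁻ X, ‖rootPlan p ε (fun l => densityRoot p (marginal (μn n : Measure (Config N d)) l))
          (planRatio ε (μn n : Measure (Config N d))) X
        - rootPlan p ε (fun l => densityRoot p (marginal (μ : Measure (Config N d)) l))
          (planRatio ε (μ : Measure (Config N d))) X‖ₑ ^ p := fun n =>
    lintegral_congr_ae (by filter_upwards [hae, hae_n n] with X h1 h2; rw [h1, h2])
  simp only [he]
  refine tendsto_of_subseq_tendsto fun ns hns => ?_
  obtain ⟨ms, hms, hsub⟩ := exists_common_subseq_tendsto_ae fun j =>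
    tendstoInMeasure_of_tendsto_lintegral_rpow hp (fun n => hM (μn (ns n)) j) (hM μ j)
      ((hr j).comp hns)
  have hone_n := fun n => planMass_one_planRatio hε (hM (μn n)) (hmn n)
  have hone := planMass_one_planRatio hε (hM μ) hm
  refine ⟨ms, tendsto_rootPlan hp hε (fun n => hM _) (hM μ) (fun n => measurable_planRatio)
    measurable_planRatio (fun n Y => (planRatio_pos hε Y).le) (fun Y => (planRatio_pos hε Y).le)
    hsub (fun Y => ((tendsto_planRatio hε hweak Y).comp hns).comp hms.tendsto_atTop)
    (fun n => ?_) ?_ ?_⟩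
  · rw [hone_n]
    exact ENNReal.one_ne_top
  · rw [hone]
    exact ENNReal.one_ne_top
  · simp only [hone_n, hone]
    exact tendsto_const_nhds

theorem tendsto_rootPlanDeriv_Theta (hp : 1 ≤ p) (hε : 0 < ε) (hweak : Tendsto μn atTop (𝓝 μ))
    (hreg_n : ∀ n j, IsW1pRegular p (stdBasis d) (marginal (μn n : Measure (Config N d)) j))
    (hreg : ∀ j, IsW1pRegular p (stdBasis d) (marginal (μ : Measure (Config N d)) j))
    (hr : ∀ j, Tendsto (fun n => ∫⁻ x, ‖densityRoot p (marginal (μn n : Measure (Config N d)) j) x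
      - densityRoot p (marginal (μ : Measure (Config N d)) j) x‖ₑ ^ p) atTop (𝓝 0))
    (k : Fin N) (i : Fin d) {s : ℕ → Space d → ℝ} {s' : Space d → ℝ} (hs : ∀ n, Measurable (s n))
    (hs' : Measurable s') (hsp : ∀ n, MemLp (s n) (ENNReal.ofReal p) volume)
    (hsp' : MemLp s' (ENNReal.ofReal p) volume)
    (hst : Tendsto (fun n => ∫⁻ x, ‖s n x - s' x‖ₑ ^ p) atTop (𝓝 0)) :
    Tendsto (fun n => ∫⁻ X,
      ‖rootPlanDeriv p ε (fun l => densityRoot p (marginal (μn n : Measure (Config N d)) l)) (s n)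
          (planRatio ε (μn n : Measure (Config N d))) k i X
        - rootPlanDeriv p ε (fun l => densityRoot p (marginal (μ : Measure (Config N d)) l)) s'
          (planRatio ε (μ : Measure (Config N d))) k i X‖ₑ ^ p) atTop (𝓝 0) := by
  have hmn := fun n l => eq_withDensity_densityRoot hp (hreg_n n l).2.1
  have hm := fun l => eq_withDensity_densityRoot hp (hreg l).2.1
  have hM : ∀ (ν : ProbabilityMeasure (Config N d)) (l : Fin N),
      Measurable (densityRoot p (marginal (ν : Measure (Config N d)) l)) :=
    fun ν l => measurable_densityRoot _
  have hsnorm : Tendsto (fun n => ∫⁻ x, ENNReal.ofReal (|s n x| ^ p)) atTop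
      (𝓝 (∫⁻ x, ENNReal.ofReal (|s' x| ^ p))) := by
    simp only [lintegral_abs_rpow_eq hp]
    exact (ENNReal.continuous_rpow_const.tendsto _).comp (tendsto_eLpNorm_of_tendsto_sub
      (one_le_ofReal hp) (fun n => (hs n).aestronglyMeasurable) hs'.aestronglyMeasurable
      ((tendsto_eLpNorm_ofReal_iff hp).2 hst))
  have hC := fun (e : ℝ) (he : 0 ≤ e) =>
    lintegral_abs_coord_rpow_mul_gaussKernel_ne_top (d := d) hε he i
  have hwn := fun n => planMass_coordWeight_planRatio hε (hM (μn n)) (hmn n) k i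
  have hw := planMass_coordWeight_planRatio hε (hM μ) hm k i
  refine tendsto_of_subseq_tendsto fun ns hns => ?_
  -- `none` stands for the derivative and `some j` for the root of the `j`-th marginal, so that one
  -- subsequence serves all of them.
  obtain ⟨ms, hms, hsub⟩ := exists_common_subseq_tendsto_ae (μ := volume)
    (F := fun (o : Option (Fin N)) n => o.elim (s (ns n))
      fun j => densityRoot p (marginal (μn (ns n) : Measure (Config N d)) j))
    (f := fun o => o.elim s' fun j => densityRoot p (marginal (μ : Measure (Config N d)) j))
    (fun o => by
      cases o with
      | none =>
        exact tendstoInMeasure_of_tendsto_lintegral_rpow hp (fun n => hs (ns n)) hs'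
          (hst.comp hns)
      | some j =>
        exact tendstoInMeasure_of_tendsto_lintegral_rpow hp (fun n => hM (μn (ns n)) j) (hM μ j)
          ((hr j).comp hns))
  refine ⟨ms, tendsto_rootPlanDeriv hp hε k i (fun n => hM _) (hM μ) (fun n => hs _) hs'
    (fun n => measurable_planRatio) measurable_planRatio (fun n Y => (planRatio_pos hε Y).le)
    (fun Y => (planRatio_pos hε Y).le) (fun l => hsub (some l)) (hsub none)
    (fun Y => ((tendsto_planRatio hε hweak Y).comp hns).comp hms.tendsto_atTop)
    (fun n => planMass_update_ne_top hp hε (hM _) (hmn _) k (hs _) (hsp _))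
    (planMass_update_ne_top hp hε (hM _) hm k hs' hsp') ?_ (fun e he n => ?_) (fun e he => ?_)
    fun e he => ?_⟩
  · simp only [fun n => planMass_update_planRatio hε (hM (μn n)) (hmn n) k (hs n),
      planMass_update_planRatio hε (hM μ) hm k hs']
    exact (hsnorm.comp hns).comp hms.tendsto_atTop
  · rw [hwn]
    exact hC e he
  · rw [hw]
    exact hC e he
  · simp only [hwn, hw]
    exact tendsto_const_nhds

end Convergence

end Regular

end PlanSmoothing

theorem mainTheorem1 (N d : ℕ) (p : ℝ) (hp : 1 ≤ p)
    (μn : ℕ → ProbabilityMeasure (Config N d)) (μ : ProbabilityMeasure (Config N d))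
    (hweak : Tendsto μn atTop (𝓝 μ))
    (hreg_n : ∀ n j, IsW1pRegular p (stdBasis d) (marginal (μn n : Measure (Config N d)) j))
    (hreg : ∀ j, IsW1pRegular p (stdBasis d) (marginal (μ : Measure (Config N d)) j))
    (hmarg : ∀ j, Tendsto
      (fun n => dist1p p (stdBasis d) (marginal (μn n : Measure (Config N d)) j)
        (marginal (μ : Measure (Config N d)) j)) atTop (𝓝 0)) :
    ∀ ε : ℝ, 0 < ε →
      (∀ n, IsW1pRegular p (stdBasisConfig N d) (Theta ε (μn n : Measure (Config N d)))) ∧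
      IsW1pRegular p (stdBasisConfig N d) (Theta ε (μ : Measure (Config N d))) ∧
      Tendsto
        (fun n => dist1p p (stdBasisConfig N d) (Theta ε (μn n : Measure (Config N d)))
          (Theta ε (μ : Measure (Config N d)))) atTop (𝓝 0) := by
  intro ε hε
  refine ⟨fun n => isW1pRegular_Theta hp hε (hreg_n n), isW1pRegular_Theta hp hε hreg, ?_⟩
  -- Genuinely measurable representatives of the derivatives are fixed once, since the mass formulas
  -- require measurability. By uniqueness of weak derivatives, `tendsto_normW1p_sub_iff` allows both
  -- `d^{1,p}` limits to be read off from chosen representatives.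
  have hexn : ∀ n k i, ∃ s : Space d → ℝ, Measurable s ∧ MemLp s (ENNReal.ofReal p) volume ∧
      IsWeakPartial (stdBasis d i)
        (densityRoot p (marginal (μn n : Measure (Config N d)) k)) s := fun n k i => by
    obtain ⟨g, hg, hgp⟩ := (hreg_n n k).2.2.2 i
    exact exists_measurable_isWeakPartial hg hgp
  have hex : ∀ k i, ∃ s : Space d → ℝ, Measurable s ∧ MemLp s (ENNReal.ofReal p) volume ∧
      IsWeakPartial (stdBasis d i)
        (densityRoot p (marginal (μ : Measure (Config N d)) k)) s := fun k i => by
    obtain ⟨g, hg, hgp⟩ := (hreg k).2.2.2 i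
    exact exists_measurable_isWeakPartial hg hgp
  choose s hs hsp hsw using hexn
  choose s' hs' hsp' hsw' using hex
  have hconv := fun j =>
    (tendsto_normW1p_sub_iff hp (fun n i => hsw n j i) (fun i => hsw' j i)).1 (hmarg j)
  have hD_n : ∀ n (i : (_ : Fin N) × Fin d), IsWeakPartial (stdBasisConfig N d i)
      (densityRoot p (Theta ε (μn n : Measure (Config N d))))
      (rootPlanDeriv p ε (fun l => densityRoot p (marginal (μn n : Measure (Config N d)) l))
        (s n i.1 i.2) (planRatio ε (μn n : Measure (Config N d))) i.1 i.2) := fun n ⟨k, i⟩ =>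
    (isWeakPartial_densityRoot_Theta hp hε (hreg_n n) (hs n k i) (hsp n k i) (hsw n k i)).1
  have hD : ∀ i : (_ : Fin N) × Fin d, IsWeakPartial (stdBasisConfig N d i)
      (densityRoot p (Theta ε (μ : Measure (Config N d))))
      (rootPlanDeriv p ε (fun l => densityRoot p (marginal (μ : Measure (Config N d)) l))
        (s' i.1 i.2) (planRatio ε (μ : Measure (Config N d))) i.1 i.2) := fun ⟨k, i⟩ =>
    (isWeakPartial_densityRoot_Theta hp hε hreg (hs' k i) (hsp' k i) (hsw' k i)).1
  refine (tendsto_normW1p_sub_iff hp hD_n hD).2 ⟨?_, fun i => ?_⟩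
  · exact tendsto_densityRoot_Theta hp hε hweak hreg_n hreg fun j => (hconv j).1
  · exact tendsto_rootPlanDeriv_Theta hp hε hweak hreg_n hreg (fun j => (hconv j).1) i.1 i.2
      (fun n => hs n i.1 i.2) (hs' i.1 i.2) (fun n => hsp n i.1 i.2) (hsp' i.1 i.2)
      ((hconv i.1).2 i.2)
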